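/- Let $M$ be a compact (finite-dimensional, Hausdorff) smooth manifold without boundary, $K$ a Banach–Lie group and $\pi\colon P\to M$ a smooth principal $K$-bundle. Let $Z\xrightarrow{\iota}\widehat K\xrightarrow{q}K$ be a central extension of Banach–Lie groups admitting smooth local sections, i.e. $\iota$ and $q$ are smooth homomorphisms, $\iota$ is injective with central image, $q$ is surjective with $\ker q=\iota(Z)$, and on some open neighbourhood $U$ of $1\in K$ there is a smooth section $\sigma$ of $q$ such that $U\times Z\to q^{-1}(U)$, $(u,z)\mapsto\sigma(u)\iota(z)$, is a diffeomorphism. Conjugation makes $K$ act on $\widehat K$ and on its Lie algebra $\widehat{\mathfrak k}$. Let $$C^\infty(P,\widehat K)^K=\{f\in C^\infty(P,\widehat K)\mid f(p\cdot q(l))=l^{-1}f(p)\,l\ \text{ for all } p\in P,\ l\in\widehat K\},$$ $$C^\infty(P,\widehat{\mathfrak k})^K=\{\xi\in C^\infty(P,\widehat{\mathfrak k})\mid \xi(p\cdot q(l))=\mathrm{Ad}(l^{-1})\xi(p)\ \text{ for all } p\in P,\ l\in\widehat K\},$$ and define $C^\infty(P,K)^K$, $C^\infty(P,\mathfrak k)^K$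 in the same way with $q=\mathrm{id}_K$. All spaces of smooth maps carry the $C^\infty$-topology, i.e. the initial topology for the maps $f\mapsto T^nf$ ($n\ge 0$) into the spaces of continuous maps between iterated tangent bundles with the compact-open topology; groups carry the pointwise operations. Smoothness between (open subsets of) locally convex spaces means that all iterated directional derivatives $d^nf\colon U\times E^n\to F$ exist and are continuous. Then: 1. $C^\infty(M,\mathfrak z)$, $C^\infty(P,\widehat{\mathfrak k})^K$ and $C^\infty(P,\mathfrak k)^K$ are Fréchet spaces, and the topological groups $C^\infty(M,Z)$, $C^\infty(P,\widehat K)^K$ and $C^\infty(P,K)^K$ are Fréchet–Lie groups modelled on them, for Lie group structures in which $\xi\mapsto\exp\circ\xi$, restricted to an open neighbourhood of $0$, is the inverse of a chart. 2. For these structures, the sequence $$C^\infty(M,Z)\xrightarrow{\ \iota_*\ }C^\infty(P,\widehat K)^K\xrightarrow{\ q_*\ }C^\infty(P,K)^K,\qquad \iota_*(z)=\iota\circ z\circ\pi,\quad q_*(f)=q\circ f,$$ consists of smooth homomorphisms, $\iota_*$ is injective with central image, and $\iota_*(C^\infty(M,Z))=\ker q_*$. 3. The sequence admits smooth local sections: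 for each $f_0\in C^\infty(P,\widehat K)^K$ there are an open neighbourhood $U$ of $q_*(f_0)$ in $C^\infty(P,K)^K$ and a smooth map $s\colon U\to C^\infty(P,\widehat K)^K$ with $q_*\circ s=\mathrm{id}_U$ and $s(q_*(f_0))=f_0$, and such that $U\times C^\infty(M,Z)\to q_*^{-1}(U)$, $(\gamma,z)\mapsto s(\gamma)\,\iota_*(z)$, is a diffeomorphism. 4. If $Z$ and $K$ are metrizable, then $C^\infty(P,\widehat K)^K$ is metrizable. -/

import Mathlib

open Set Filter Topology
open scoped Manifold ContDiff

universe u v u₁ u₂ u₃ u₄ u₅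

noncomputable section

/-! ## Differential calculus on locally convex spaces -/

/-- `f` is smooth on the open set `U`: the iterated directional derivatives
`dⁿf : U × Eⁿ → F` exist and are continuous.  Here `d n x (v₁, …, vₙ)` is `dⁿf(x)(v₁, …, vₙ)`, and
`dⁿ⁺¹f(x)(v₁, …, vₙ, w) = lim_{h → 0} (dⁿf(x + h w)(v₁, …, vₙ) - dⁿf(x)(v₁, …, vₙ)) / h`. -/
def LCSmooth {E F : Type*} [AddCommGroup E] [Module ℝ E] [TopologicalSpace E]
    [AddCommGroup F] [Module ℝ F] [TopologicalSpace F] (f : E → F) (U : Set E) : Prop :=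
  ∃ d : (n : ℕ) → E → (Fin n → E) → F,
    (∀ x ∈ U, ∀ v, d 0 x v = f x) ∧
    (∀ n, ∀ x ∈ U, ∀ (v : Fin n → E) (w : E),
      Tendsto (fun h : ℝ => h⁻¹ • (d n (x + h • w) v - d n x v)) (𝓝[≠] 0)
        (𝓝 (d (n + 1) x (Fin.snoc v w)))) ∧
    ∀ n, ContinuousOn (fun y : E × (Fin n → E) => d n y.1 y.2) (U ×ˢ univ)

/-- Fréchet spaces: complete metrizable locally convex real topological vector spaces. -/
structure IsFrechetSpace (E : Type*) [AddCommGroup E] [Module ℝ E] [TopologicalSpace E] :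
    Prop where
  addGroup : IsTopologicalAddGroup E
  continuousSMul : ContinuousSMul ℝ E
  locallyConvex : LocallyConvexSpace ℝ E
  metrizable : TopologicalSpace.MetrizableSpace E
  complete : @CompleteSpace E (IsTopologicalAddGroup.rightUniformSpace E)

/-- `f : X → Y` is smooth on the open set `U` with respect to the atlases `A` of `X` and `B` of `Y`:
it is continuous there, and smooth in all charts. -/
def ChartSmoothOn {X Y E F : Type*} [TopologicalSpace X] [TopologicalSpace Y]
    [AddCommGroup E] [Module ℝ E] [TopologicalSpace E]
    [AddCommGroup F] [Module ℝ F] [TopologicalSpace F]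
    (A : Set (OpenPartialHomeomorph X E)) (B : Set (OpenPartialHomeomorph Y F))
    (f : X → Y) (U : Set X) : Prop :=
  ContinuousOn f U ∧ ∀ a ∈ A, ∀ b ∈ B,
    LCSmooth (fun x => b (f (a.symm x))) (a.target ∩ a.symm ⁻¹' (U ∩ f ⁻¹' b.source))

/-- The product atlas on `X × Y`. -/
def prodAtlas {X Y E F : Type*} [TopologicalSpace X] [TopologicalSpace Y]
    [TopologicalSpace E] [TopologicalSpace F]
    (A : Set (OpenPartialHomeomorph X E)) (B : Set (OpenPartialHomeomorph Y F)) :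
    Set (OpenPartialHomeomorph (X × Y) (E × F)) :=
  {e | ∃ a ∈ A, ∃ b ∈ B, e = a.prod b}

/-- A Lie group structure, modelled on the locally convex space `E`, on a group `G` with a given
topology: a smooth atlas for which the group operations are smooth. -/
structure LCLieGroup (E G : Type*) [AddCommGroup E] [Module ℝ E] [TopologicalSpace E]
    [Group G] [TopologicalSpace G] where
  atlas : Set (OpenPartialHomeomorph G E)
  hausdorff : T2Space G
  cover : ∀ g : G, ∃ e ∈ atlas, g ∈ e.source
  compatible : ∀ a ∈ atlas, ∀ b ∈ atlas,
    LCSmooth (fun x => b (a.symm x)) (a.target ∩ a.symm ⁻¹' b.source)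
  smooth_mul : ChartSmoothOn (prodAtlas atlas atlas) atlas (fun x : G × G => x.1 * x.2) univ
  smooth_inv : ChartSmoothOn atlas atlas (fun g : G => g⁻¹) univ

/-! ## Iterated tangent bundles and the `C^∞`-topology -/

/-- A smooth manifold bundled with its model. -/
structure BundledManifold where
  (E H M : Type u)
  [normed : NormedAddCommGroup E]
  [normedSpace : NormedSpace ℝ E]
  [topH : TopologicalSpace H]
  [topM : TopologicalSpace M]
  [charted : ChartedSpace H M]
  (I : ModelWithCorners ℝ E H)
  [manifold : IsManifold I ∞ M]

namespace BundledManifold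

attribute [instance] normed normedSpace topH topM charted manifold

/-- The tangent bundle. -/
def tangent (X : BundledManifold.{u}) : BundledManifold.{u} where
  E := X.E × X.E
  H := ModelProd X.H X.E
  M := TangentBundle X.I X.M
  I := X.I.tangent

/-- The `n`-th iterated tangent bundle `Tⁿ X`. -/
def iterTangent (X : BundledManifold.{u}) : ℕ → BundledManifold.{u}
  | 0 => X
  | n + 1 => (X.iterTangent n).tangent

/-- The `n`-th iterated tangent map `Tⁿ f : Tⁿ X → Tⁿ Y`. -/
def iterTangentMap {X : BundledManifold.{u}} {Y : BundledManifold.{v}} (f : X.M → Y.M) :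
    (n : ℕ) → (X.iterTangent n).M → (Y.iterTangent n).M
  | 0 => f
  | n + 1 => tangentMap (X.iterTangent n).I (Y.iterTangent n).I (iterTangentMap f n)

theorem contMDiff_iterTangentMap {X : BundledManifold.{u}} {Y : BundledManifold.{v}}
    {f : X.M → Y.M} (hf : ContMDiff X.I Y.I ∞ f) (n : ℕ) :
    ContMDiff (X.iterTangent n).I (Y.iterTangent n).I ∞ (iterTangentMap f n) := by
  induction n with
  | zero => exact hf
  | succ n ih => exact ih.contMDiff_tangentMap (by rfl)

end BundledManifold

section SmoothMaps

variable {E N : Type u} [NormedAddCommGroup E] [NormedSpace ℝ E]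
  [TopologicalSpace N] [ChartedSpace E N] [IsManifold 𝓘(ℝ, E) ∞ N]
  {F L : Type v} [NormedAddCommGroup F] [NormedSpace ℝ F]
  [TopologicalSpace L] [ChartedSpace F L] [IsManifold 𝓘(ℝ, F) ∞ L]

/-- The `n`-th iterated tangent map of a smooth map, as a continuous map. -/
def iterTangentContinuousMap (n : ℕ) (f : C^∞⟮𝓘(ℝ, E), N; 𝓘(ℝ, F), L⟯) :
    C((BundledManifold.iterTangent ⟨E, E, N, 𝓘(ℝ, E)⟩ n).M,
      (BundledManifold.iterTangent ⟨F, F, L, 𝓘(ℝ, F)⟩ n).M) :=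
  ⟨BundledManifold.iterTangentMap (X := ⟨E, E, N, 𝓘(ℝ, E)⟩) (Y := ⟨F, F, L, 𝓘(ℝ, F)⟩) f n,
    (BundledManifold.contMDiff_iterTangentMap (X := ⟨E, E, N, 𝓘(ℝ, E)⟩)
      (Y := ⟨F, F, L, 𝓘(ℝ, F)⟩) f.contMDiff n).continuous⟩

/-- The `C^∞`-topology: the initial topology for the maps `f ↦ Tⁿ f` into the spaces
`C(Tⁿ N, Tⁿ L)` with the compact-open topology. -/
instance smoothMapTopology : TopologicalSpace C^∞⟮𝓘(ℝ, E), N; 𝓘(ℝ, F), L⟯ :=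
  ⨅ n : ℕ, TopologicalSpace.induced (iterTangentContinuousMap n) ContinuousMap.compactOpen

end SmoothMaps

/-! ## Banach–Lie groups, exponential function and central extensions

The Lie algebra `T₁L` of a Lie group `L` modelled on `F` is `F` itself (Mathlib's tangent
spaces are copies of the model space, identified through the preferred chart). -/

section BanachLie

variable {F L : Type*} [NormedAddCommGroup F] [NormedSpace ℝ F]
  [TopologicalSpace L] [ChartedSpace F L] [Group L]

/-- The adjoint action of `l` on the Lie algebra: the derivative at `1` of `x ↦ l x l⁻¹`. -/
def lieAd (l : L) : F →L[ℝ] F :=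
  mfderiv 𝓘(ℝ, F) 𝓘(ℝ, F) (fun x : L => l * x * l⁻¹) 1

/-- `c` is the smooth one-parameter subgroup with initial velocity `v`. -/
def IsOneParameterSubgroup (v : F) (c : ℝ → L) : Prop :=
  ContMDiff 𝓘(ℝ, ℝ) 𝓘(ℝ, F) ∞ c ∧ c 0 = 1 ∧ (∀ s t, c (s + t) = c s * c t) ∧
    (mfderiv 𝓘(ℝ, ℝ) 𝓘(ℝ, F) c 0 : ℝ →L[ℝ] F) 1 = v

open Classical in
/-- The exponential function of a Lie group: `exp v = c 1` for the one-parameter subgroup `c` with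
initial velocity `v`. -/
def lieExp (L : Type*) [TopologicalSpace L] [ChartedSpace F L] [Group L] (v : F) : L :=
  if h : ∃ c : ℝ → L, IsOneParameterSubgroup v c then h.choose 1 else 1

end BanachLie

/-- `Z → Khat → K` is a central extension of Banach–Lie groups admitting smooth local sections.
The last field says that there is a smooth section `σ` of `q` on an open
neighbourhood `U` of `1`, such that `(u, z) ↦ σ u * ι z` is a diffeomorphism
`U × Z → q⁻¹(U)` (with inverse `g ↦ (q g, r g)`); that is, `Khat` is a locally trivial smooth
principal `Z`-bundle over `K`. -/
structure IsCentralExtension {EZ Z EKhat Khat EK K : Type*}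
    [NormedAddCommGroup EZ] [NormedSpace ℝ EZ]
    [TopologicalSpace Z] [ChartedSpace EZ Z] [Group Z]
    [NormedAddCommGroup EKhat] [NormedSpace ℝ EKhat]
    [TopologicalSpace Khat] [ChartedSpace EKhat Khat] [Group Khat]
    [NormedAddCommGroup EK] [NormedSpace ℝ EK]
    [TopologicalSpace K] [ChartedSpace EK K] [Group K]
    (ι : Z →* Khat) (q : Khat →* K) : Prop where
  smooth_incl : ContMDiff 𝓘(ℝ, EZ) 𝓘(ℝ, EKhat) ∞ ι
  smooth_proj : ContMDiff 𝓘(ℝ, EKhat) 𝓘(ℝ, EK) ∞ q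
  injective : Function.Injective ι
  exact : ι.range = q.ker
  surjective : Function.Surjective q
  central : ∀ z g, ι z * g = g * ι z
  local_section : ∃ (U : Set K) (σ : K → Khat) (r : Khat → Z), IsOpen U ∧ (1 : K) ∈ U ∧
    ContMDiffOn 𝓘(ℝ, EK) 𝓘(ℝ, EKhat) ∞ σ U ∧ (∀ k ∈ U, q (σ k) = k) ∧
    ContMDiffOn 𝓘(ℝ, EKhat) 𝓘(ℝ, EZ) ∞ r (q ⁻¹' U) ∧ ∀ g ∈ q ⁻¹' U, g = σ (q g) * ι (r g)

/-! ## Principal bundles and gauge groups -/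

/-- A smooth principal `K`-bundle `proj : P → M`, with right action `act`. -/
structure PrincipalBundle (EM M EP P EK K : Type*)
    [NormedAddCommGroup EM] [NormedSpace ℝ EM] [TopologicalSpace M] [ChartedSpace EM M]
    [NormedAddCommGroup EP] [NormedSpace ℝ EP] [TopologicalSpace P] [ChartedSpace EP P]
    [NormedAddCommGroup EK] [NormedSpace ℝ EK] [TopologicalSpace K] [ChartedSpace EK K]
    [Group K] where
  proj : P → M
  act : P → K → P
  smooth_proj : ContMDiff 𝓘(ℝ, EP) 𝓘(ℝ, EM) ∞ proj
  smooth_act : ContMDiff (𝓘(ℝ, EP).prod 𝓘(ℝ, EK)) 𝓘(ℝ, EP) ∞ (fun x : P × K => act x.1 x.2)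
  act_one : ∀ p, act p 1 = p
  act_mul : ∀ p k l, act (act p k) l = act p (k * l)
  proj_act : ∀ p k, proj (act p k) = proj p
  locally_trivial : ∀ x : M, ∃ (V : Set M) (Φ : OpenPartialHomeomorph P (M × K)),
    IsOpen V ∧ x ∈ V ∧ Φ.source = proj ⁻¹' V ∧ Φ.target = V ×ˢ univ ∧
    ContMDiffOn 𝓘(ℝ, EP) (𝓘(ℝ, EM).prod 𝓘(ℝ, EK)) ∞ Φ Φ.source ∧
    ContMDiffOn (𝓘(ℝ, EM).prod 𝓘(ℝ, EK)) 𝓘(ℝ, EP) ∞ Φ.symm Φ.target ∧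
    (∀ p ∈ Φ.source, (Φ p).1 = proj p) ∧
    ∀ p ∈ Φ.source, ∀ k, (Φ (act p k)).2 = (Φ p).2 * k

section Gauge

variable {EM M EP P EK K : Type*}
  [NormedAddCommGroup EM] [NormedSpace ℝ EM] [TopologicalSpace M] [ChartedSpace EM M]
  [NormedAddCommGroup EP] [NormedSpace ℝ EP] [TopologicalSpace P] [ChartedSpace EP P]
  [NormedAddCommGroup EK] [NormedSpace ℝ EK] [TopologicalSpace K] [ChartedSpace EK K] [Group K]
  {EL L : Type*} [NormedAddCommGroup EL] [NormedSpace ℝ EL] [TopologicalSpace L]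
  [ChartedSpace EL L] [Group L] [LieGroup 𝓘(ℝ, EL) ∞ L]

variable (EL)

/-- For a homomorphism `q : L → K`, the group `C^∞(P, L)^K` of smooth maps
`f : P → L` with `f (p · q l) = l⁻¹ * f p * l`.  If `q` is onto with central kernel, conjugation
by `l` depends only on `q l`, and these are the maps that are equivariant for the
resulting action of `K` on `L`; for `q = id` this is the gauge group `C^∞(P, K)^K`. -/
def gaugeGroup (Q : PrincipalBundle EM M EP P EK K) (q : L →* K) :
    Subgroup C^∞⟮𝓘(ℝ, EP), P; 𝓘(ℝ, EL), L⟯ where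
  carrier := {f | ∀ p l, f (Q.act p (q l)) = l⁻¹ * f p * l}
  mul_mem' {f g} hf hg p l := by
    change f _ * g _ = l⁻¹ * (f p * g p) * l
    rw [hf p l, hg p l]; group
  one_mem' p l := by
    change (1 : L) = l⁻¹ * 1 * l
    group
  inv_mem' {f} hf p l := by
    change (f _)⁻¹ = l⁻¹ * (f p)⁻¹ * l
    rw [hf p l]; group

/-- The gauge algebra `C^∞(P, 𝔩)^K`: smooth maps `ξ : P → 𝔩` with `ξ (p · q l) = Ad(l⁻¹) (ξ p)`. -/
def gaugeAlgebra (Q : PrincipalBundle EM M EP P EK K) (q : L →* K) :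
    Submodule ℝ C^∞⟮𝓘(ℝ, EP), P; 𝓘(ℝ, EL), EL⟯ where
  carrier := {ξ | ∀ p l, ξ (Q.act p (q l)) = lieAd l⁻¹ (ξ p)}
  add_mem' {ξ η} hξ hη p l := by
    change ξ _ + η _ = lieAd l⁻¹ (ξ p + η p)
    rw [hξ p l, hη p l, map_add]
  zero_mem' p l := by
    change (0 : EL) = lieAd l⁻¹ (0 : EL)
    rw [map_zero]
  smul_mem' c ξ hξ p l := by
    change c • ξ _ = lieAd l⁻¹ (c • ξ p)
    rw [hξ p l, map_smul]

variable {EL}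

variable {EZ Z : Type*} [NormedAddCommGroup EZ] [NormedSpace ℝ EZ] [TopologicalSpace Z]
  [ChartedSpace EZ Z] [Group Z] [LieGroup 𝓘(ℝ, EZ) ∞ Z] [LieGroup 𝓘(ℝ, EK) ∞ K]

/-- The homomorphism `q_* : C^∞(P, L)^K → C^∞(P, K)^K`, `f ↦ q ∘ f`. -/
def gaugeProj (Q : PrincipalBundle EM M EP P EK K) {ι : Z →* L} {q : L →* K}
    (h : IsCentralExtension (EZ := EZ) (EKhat := EL) (EK := EK) ι q) :
    gaugeGroup EL Q q →* gaugeGroup EK Q (MonoidHom.id K) where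
  toFun f := ⟨⟨fun p => q (f.1 p), h.smooth_proj.comp f.1.contMDiff⟩, fun p k => by
    obtain ⟨l, rfl⟩ := h.surjective k
    change q (f.1 (Q.act p (q l))) = (q l)⁻¹ * q (f.1 p) * q l
    rw [f.2 p l, map_mul, map_mul, map_inv]⟩
  map_one' := by
    ext p
    exact map_one q
  map_mul' f g := by
    ext p
    exact map_mul q (f.1 p) (g.1 p)

/-- The homomorphism `C^∞(M, Z) → C^∞(P, L)^K`, `z ↦ ι ∘ z ∘ proj`. -/
def gaugeIncl (Q : PrincipalBundle EM M EP P EK K) {ι : Z →* L} {q : L →* K}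
    (h : IsCentralExtension (EZ := EZ) (EKhat := EL) (EK := EK) ι q) :
    C^∞⟮𝓘(ℝ, EM), M; 𝓘(ℝ, EZ), Z⟯ →* gaugeGroup EL Q q where
  toFun z := ⟨⟨fun p => ι (z (Q.proj p)),
      h.smooth_incl.comp (z.contMDiff.comp Q.smooth_proj)⟩, fun p l => by
    change ι (z (Q.proj (Q.act p (q l)))) = l⁻¹ * ι (z (Q.proj p)) * l
    rw [Q.proj_act, mul_assoc, h.central, inv_mul_cancel_left]⟩
  map_one' := by
    ext p
    exact map_one ι
  map_mul' z w := by
    ext p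
    exact map_mul ι (z (Q.proj p)) (w (Q.proj p))

end Gauge

/-- The Lie group structure `A` on a group `G` of maps `X → L` (evaluation `ev`), modelled on a
space `V` of maps `X → 𝔩` (evaluation `ev'`), has `ξ ↦ exp ∘ ξ`, restricted to an
open neighbourhood of `0`, as the inverse of one of its charts.  Up to equivalence of atlases there
is at most one such Lie group structure. -/
def HasExpChart {X F L V G : Type*} [NormedAddCommGroup F] [NormedSpace ℝ F]
    [TopologicalSpace L] [ChartedSpace F L] [Group L]
    [AddCommGroup V] [Module ℝ V] [TopologicalSpace V] [Group G] [TopologicalSpace G]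
    (A : LCLieGroup V G) (ev : G → X → L) (ev' : V → X → F) : Prop :=
  ∃ e ∈ A.atlas, (0 : V) ∈ e.target ∧ ∀ ξ ∈ e.target, ∀ x, ev (e.symm ξ) x = lieExp L (ev' ξ x)

end

set_option linter.unusedSectionVars false
set_option linter.style.haveILetI false

noncomputable section

/-! ## Superposition operators on spaces of continuous functions -/

section Superpose

variable {T : Type*} [TopologicalSpace T] [CompactSpace T]
  {E : Type*} [NormedAddCommGroup E] [NormedSpace ℝ E]
  {F : Type*} [NormedAddCommGroup F] [NormedSpace ℝ F]

/-! All three groups and all three model spaces are instances of one object: the space of smooth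
maps `f : P → Y` with `f (p k) = β k (f p)` for an action `β` of `K` on `Y`
(`IsEquivariantMapSpace`). For the gauge groups `β` is conjugation, which descends to `K` because
the kernel of `q` is central, and for the gauge algebras it is the derivative of conjugation. For
maps on `M` it is the trivial action, since smooth maps on `M` are the invariant smooth maps on `P`.
The total space `P` need not be compact; all finiteness comes from `M`, because an equivariant map
is determined by its values on finitely many local sections.

Every map in the theorem is a superposition `f ↦ (p ↦ φ (p, f p))` with `φ` smooth on an open subset
of `P × Y`. Such maps are continuous, because iterated tangent maps respect composition and pairing.
They are smooth by Hadamard's lemma (`IsSuperposition.lcSmooth`): the difference quotient of `φ`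
along the fibre is the integral of its fibre derivative along a segment, hence smooth in all
variables, including the step `h` at `h = 0`. Difference quotients of a superposition are therefore
superpositions with parameter `h`; they converge in the `C^∞`-topology, their limit is again a
superposition, and the argument iterates.

For the charts, the exponential function is shown to be smooth and invertible near `0`: the implicit
function theorem for an integral equation gives smoothness at `0`, and `exp v = exp (v / n) ^ n`
spreads it. A neighbourhood where it is injective need not be invariant under the adjoint action.
Transporting one neighbourhood by the `K`-coordinates of finitely many trivializations gives an
invariant family depending on `p` (`exists_fibreLog`). Its logarithm is smooth on an open subset of
`P × L`, so `ξ ↦ exp ∘ ξ` and its inverse are superpositions. The atlas consists of all charts with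
this property.

The model spaces are Fréchet because the iterated tangent maps of local representatives embed them
in a countable product of spaces `C(O, B)`, with `O` open in a finite-dimensional space and `B`
Banach. The image is closed, since a limit of smooth maps all of whose derivatives converge locally
uniformly is smooth (`exists_contDiffOn_of_tendsto_flat`).

For the local sections, a partition of unity on `M` gives a smooth equivariant family `T` of linear
right inverses of the derivative of `q` (`exists_equivariant_splitting`). As `q (exp (T w)) = exp
w`, the section is `s g = f₀ exp (T (log (g₀⁻¹ g)))` with `g₀ = q ∘ f₀`. The defect `s (q ∘ f)⁻¹ f`
takes values in the image of `ι`, where the inverse of `ι` extends smoothly to a neighbourhood, so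
the second coordinate is a superposition as well. Metrizability is the Birkhoff–Kakutani theorem:
the group is Hausdorff and, by its charts, first countable at `1`. -/

open Classical in
/-- The superposition operator `y ↦ g ∘ y` on `C(T, E)`. -/
def superpose (g : E → F) (y : C(T, E)) : C(T, F) :=
  if h : Continuous (fun t => g (y t)) then ⟨fun t => g (y t), h⟩ else 0

theorem superpose_apply {g : E → F} {O : Set E} (hg : ContinuousOn g O) {y : C(T, E)}
    (hy : ∀ t, y t ∈ O) (t : T) : superpose g y t = g (y t) := by
  have : Continuous (fun t => g (y t)) := hg.comp_continuous y.continuous hy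
  simp [superpose, this]

theorem isOpen_forall_mem {O : Set E} (hO : IsOpen O) : IsOpen {y : C(T, E) | ∀ t, y t ∈ O} := by
  have := ContinuousMap.isOpen_setOfPred_mapsTo (X := T) (Y := E) isCompact_univ hO
  simpa [MapsTo] using this

/-- Pointwise application of operator-valued functions. -/
def pointwiseApply : C(T, E →L[ℝ] F) →L[ℝ] C(T, E) →L[ℝ] C(T, F) :=
  LinearMap.mkContinuous₂
    (LinearMap.mk₂ ℝ (fun (c : C(T, E →L[ℝ] F)) (w : C(T, E)) =>
        (⟨fun t => c t (w t), by fun_prop⟩ : C(T, F)))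
      (fun _ _ _ => by ext; simp) (fun _ _ _ => by ext; simp) (fun _ _ _ => by ext; simp)
      (fun _ _ _ => by ext; simp)) 1 fun c w => by
    rw [one_mul]
    refine (ContinuousMap.norm_le _ (by positivity)).2 fun t => ?_
    exact ((c t).le_opNorm _).trans
      (mul_le_mul (c.norm_coe_le_norm t) (w.norm_coe_le_norm t) (norm_nonneg _) (by positivity))

@[simp] theorem pointwiseApply_apply (c : C(T, E →L[ℝ] F)) (w : C(T, E)) (t : T) :
    pointwiseApply c w t = c t (w t) := rfl

/-- Strict differentiability controls the first-order remainder simultaneously for all base points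
near `y t`. Compactness of `T` then gives one `δ` for all `t`, which is an estimate in the sup norm.
-/
theorem hasFDerivAt_superpose {g : E → F} {O : Set E} (hO : IsOpen O) (hg : ContDiffOn ℝ 1 g O)
    {y : C(T, E)} (hy : ∀ t, y t ∈ O) :
    HasFDerivAt (superpose g) (pointwiseApply (superpose (fderiv ℝ g) y)) y := by
  have hg' : ContinuousOn (fderiv ℝ g) O := hg.continuousOn_fderiv_of_isOpen hO le_rfl
  rw [hasFDerivAt_iff_isLittleO_nhds_zero, Asymptotics.isLittleO_iff]
  intro ε hε
  have key : ∀ᶠ u in 𝓝 (0 : E), ∀ t ∈ (univ : Set T),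
      y t + u ∈ O ∧ ‖g (y t + u) - g (y t) - fderiv ℝ g (y t) u‖ ≤ ε * ‖u‖ := by
    refine IsCompact.eventually_forall_of_forall_eventually isCompact_univ fun t _ => ?_
    have hc : Tendsto (fun z : E × T => y z.2 + z.1) (𝓝 (0, t)) (𝓝 (y t)) := by
      have : Continuous (fun z : E × T => y z.2 + z.1) := by fun_prop
      simpa using this.tendsto (0, t)
    have hc' : Tendsto (fun z : E × T => y z.2) (𝓝 (0, t)) (𝓝 (y t)) := by
      have : Continuous (fun z : E × T => y z.2) := by fun_prop
      simpa using this.tendsto (0, t)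
    have h1 := hc.eventually (hO.mem_nhds (hy t))
    have hs : HasStrictFDerivAt g (fderiv ℝ g (y t)) (y t) :=
      (hg.contDiffAt (hO.mem_nhds (hy t))).hasStrictFDerivAt one_ne_zero
    have h2 := (hc.prodMk_nhds hc').eventually (hs.isLittleO.def (half_pos hε))
    have h3 : ∀ᶠ z : E × T in 𝓝 (0, t), dist (fderiv ℝ g (y z.2)) (fderiv ℝ g (y t)) < ε / 2 :=
      (((hg'.continuousAt (hO.mem_nhds (hy t))).tendsto).comp hc').eventually
        (Metric.ball_mem_nhds _ (half_pos hε))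
    filter_upwards [h1, h2, h3] with z h1 h2 h3
    refine ⟨h1, ?_⟩
    have h4 : ‖(fderiv ℝ g (y z.2) - fderiv ℝ g (y t)) z.1‖ ≤ ε / 2 * ‖z.1‖ :=
      ((fderiv ℝ g (y z.2) - fderiv ℝ g (y t)).le_opNorm _).trans
        (mul_le_mul_of_nonneg_right (by rw [← dist_eq_norm]; exact h3.le) (norm_nonneg _))
    simp only [add_sub_cancel_left] at h2
    calc ‖g (y z.2 + z.1) - g (y z.2) - fderiv ℝ g (y z.2) z.1‖
        = ‖(g (y z.2 + z.1) - g (y z.2) - fderiv ℝ g (y t) z.1)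
            - (fderiv ℝ g (y z.2) - fderiv ℝ g (y t)) z.1‖ := by
          congr 1; simp
      _ ≤ ε / 2 * ‖z.1‖ + ε / 2 * ‖z.1‖ := (norm_sub_le _ _).trans (add_le_add h2 h4)
      _ = ε * ‖z.1‖ := by ring
  obtain ⟨δ, hδ, hball⟩ := Metric.eventually_nhds_iff_ball.1 key
  filter_upwards [Metric.ball_mem_nhds (0 : C(T, E)) hδ] with w hw
  have hw' : ∀ t, w t ∈ Metric.ball (0 : E) δ := fun t => by
    rw [mem_ball_zero_iff] at hw ⊢
    exact (w.norm_coe_le_norm t).trans_lt hw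
  refine (ContinuousMap.norm_le _ (by positivity)).2 fun t => ?_
  have hyw : ∀ t, (y + w) t ∈ O := fun t => (hball _ (hw' t) t trivial).1
  have := (hball _ (hw' t) t trivial).2
  simp only [ContinuousMap.sub_apply, pointwiseApply_apply, superpose_apply hg.continuousOn hyw,
    superpose_apply hg.continuousOn hy, superpose_apply hg' hy]
  exact this.trans (mul_le_mul_of_nonneg_left (w.norm_coe_le_norm t) hε.le)

/-- The derivative is the continuous linear map `pointwiseApply` applied to the superposition
operator of `fderiv ℝ g`, so induction on `n` works with the target generalized. The universe of `F`
absorbs that of `E` because the next target is `E →L[ℝ] F`. -/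
theorem contDiffOn_superpose_nat (T : Type*) [TopologicalSpace T] [CompactSpace T]
    {E : Type u} [NormedAddCommGroup E] [NormedSpace ℝ E] (n : ℕ) :
    ∀ {F : Type max u v} [NormedAddCommGroup F] [NormedSpace ℝ F] {g : E → F} {O : Set E}
      (_ : IsOpen O) (_ : ContDiffOn ℝ ∞ g O),
      ContDiffOn ℝ n (superpose g) {y : C(T, E) | ∀ t, y t ∈ O} := by
  induction n with
  | zero =>
    intro F _ _ g O hO hg
    rw [Nat.cast_zero, contDiffOn_zero]
    exact fun y hy => (hasFDerivAt_superpose hO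
      (hg.of_le (by exact_mod_cast le_top)) hy).continuousAt.continuousWithinAt
  | succ n ih =>
    intro F _ _ g O hO hg
    have h1 : ContDiffOn ℝ 1 g O := hg.of_le (by exact_mod_cast le_top)
    have hO' := isOpen_forall_mem (T := T) hO
    rw [Nat.cast_succ, contDiffOn_succ_iff_fderiv_of_isOpen hO']
    refine ⟨fun y hy => (hasFDerivAt_superpose hO h1 hy).differentiableAt.differentiableWithinAt,
      fun h => by simp at h, ?_⟩
    have hg' : ContDiffOn ℝ ∞ (fderiv ℝ g) O := hg.fderiv_of_isOpen hO (by simp)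
    have hP : ContDiff ℝ n (fun c : C(T, E →L[ℝ] F) => pointwiseApply c) := by fun_prop
    exact (hP.comp_contDiffOn (ih hO hg')).congr fun y hy => (hasFDerivAt_superpose hO h1 hy).fderiv

/-- The universe restriction of the induction is removed by lifting `F` and composing with the
linear equivalence. -/
theorem contDiffOn_superpose (T : Type*) [TopologicalSpace T] [CompactSpace T]
    {E : Type u} [NormedAddCommGroup E] [NormedSpace ℝ E]
    {F : Type v} [NormedAddCommGroup F] [NormedSpace ℝ F] {g : E → F} {O : Set E}
    (hO : IsOpen O) (hg : ContDiffOn ℝ ∞ g O) :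
    ContDiffOn ℝ ∞ (superpose g) {y : C(T, E) | ∀ t, y t ∈ O} := by
  let e : ULift.{u} F ≃L[ℝ] F := ContinuousLinearEquiv.ulift
  have h1 : ContDiffOn ℝ ∞ (fun x => e.symm (g x)) O := e.symm.contDiff.comp_contDiffOn hg
  have h2 : ContDiffOn ℝ ∞ (superpose (T := T) (fun x => e.symm (g x)))
      {y : C(T, E) | ∀ t, y t ∈ O} :=
    contDiffOn_infty.2 fun n => contDiffOn_superpose_nat.{u, v} T n hO h1
  let c : C(T, ULift.{u} F) →L[ℝ] C(T, F) :=
    ContinuousLinearMap.compLeftContinuous ℝ T (e : ULift.{u} F →L[ℝ] F)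
  refine (c.contDiff.comp_contDiffOn h2).congr fun y hy => ?_
  ext t
  simp [c, superpose_apply hg.continuousOn hy, superpose_apply h1.continuousOn hy]

end Superpose

/-! ## Hadamard's lemma -/

section Hadamard

variable {E : Type u} [NormedAddCommGroup E] [NormedSpace ℝ E]
  {F : Type v} [NormedAddCommGroup F] [NormedSpace ℝ F]

/-- Evaluation of a continuous function on a compact interval containing `0`, integrated. -/
def integralIcc (a b : ℝ) (hab : a ≤ b) (c d : ℝ) : C(Icc a b, F) →L[ℝ] F :=
  LinearMap.mkContinuous
    { toFun := fun f => ∫ s in c..d, f (projIcc a b hab s)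
      map_add' := fun f g => intervalIntegral.integral_add
        ((f.continuous.comp continuous_projIcc).intervalIntegrable _ _)
        ((g.continuous.comp continuous_projIcc).intervalIntegrable _ _)
      map_smul' := fun r f => intervalIntegral.integral_smul r _ } |d - c| fun f => by
    rw [mul_comm]
    exact intervalIntegral.norm_integral_le_of_norm_le_const fun s _ => f.norm_coe_le_norm _

theorem integralIcc_apply (a b : ℝ) (hab : a ≤ b) (c d : ℝ) (f : C(Icc a b, F)) :
    integralIcc a b hab c d f = ∫ s in c..d, f (projIcc a b hab s) := rfl

/-- The difference quotient of `φ` at `x` in direction `u` with step `h`, extended to `h = 0`. -/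
def hadamard (φ : E → F) (z : E × E × ℝ) : F :=
  ∫ t in (0 : ℝ)..1, fderiv ℝ φ (z.1 + t • z.2.2 • z.2.1) z.2.1

theorem hadamard_zero [CompleteSpace F] (φ : E → F) (x u : E) :
    hadamard φ (x, u, 0) = fderiv ℝ φ x u := by
  simp [hadamard]

variable {φ : E → F} {Ω : Set E}

/-- The domain of `hadamard φ`. -/
def hadamardDomain (Ω : Set E) : Set (E × E × ℝ) :=
  {z | ∀ t ∈ Icc (0 : ℝ) 1, z.1 + t • z.2.2 • z.2.1 ∈ Ω}

/-- Fundamental theorem of calculus for `φ` along the segment from `x` to `x + h u`. -/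
theorem smul_hadamard [CompleteSpace F] (hΩ : IsOpen Ω) (hφ : ContDiffOn ℝ ∞ φ Ω)
    {z : E × E × ℝ} (hz : z ∈ hadamardDomain Ω) :
    z.2.2 • hadamard φ z = φ (z.1 + z.2.2 • z.2.1) - φ z.1 := by
  have hφ1 : ContDiffOn ℝ 1 φ Ω := hφ.of_le (by exact_mod_cast le_top)
  have hd : ∀ t ∈ uIcc (0 : ℝ) 1, HasDerivAt (fun t : ℝ => φ (z.1 + t • z.2.2 • z.2.1))
      (z.2.2 • fderiv ℝ φ (z.1 + t • z.2.2 • z.2.1) z.2.1) t := by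
    intro t ht
    rw [uIcc_of_le zero_le_one] at ht
    have h1 : HasFDerivAt φ (fderiv ℝ φ (z.1 + t • z.2.2 • z.2.1)) (z.1 + t • z.2.2 • z.2.1) :=
      ((hφ1.contDiffAt (hΩ.mem_nhds (hz t ht))).differentiableAt one_ne_zero).hasFDerivAt
    have h2 : HasDerivAt (fun t : ℝ => z.1 + t • z.2.2 • z.2.1) (z.2.2 • z.2.1) t := by
      simpa using ((hasDerivAt_id t).smul_const (z.2.2 • z.2.1)).const_add z.1
    simpa [Function.comp_def] using h1.comp_hasDerivAt t h2
  have hc : ContinuousOn (fun t : ℝ => z.2.2 • fderiv ℝ φ (z.1 + t • z.2.2 • z.2.1) z.2.1)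
      (uIcc 0 1) := by
    rw [uIcc_of_le zero_le_one]
    refine continuousOn_const.smul (ContinuousOn.clm_apply ?_ continuousOn_const)
    exact (hφ1.continuousOn_fderiv_of_isOpen hΩ le_rfl).comp (by fun_prop) hz
  rw [hadamard, ← intervalIntegral.integral_smul,
    intervalIntegral.integral_eq_sub_of_hasDerivAt hd hc.intervalIntegrable]
  simp

/-- The affine segments `t ↦ (x + t h u, u)`, as continuous functions on the unit interval. -/
def segmentMap (z : E × E × ℝ) : C(Icc (0 : ℝ) 1, E × E) :=
  ⟨fun t => (z.1 + (t : ℝ) • z.2.2 • z.2.1, z.2.1), by fun_prop⟩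

/-- The segment is a sum of continuous linear functions of `x`, `u` and `h u`. -/
theorem contDiff_segmentMap : ContDiff ℝ ∞ (segmentMap (E := E)) := by
  let L1 : E →L[ℝ] C(Icc (0 : ℝ) 1, E × E) :=
    LinearMap.mkContinuous
      { toFun := fun x => ⟨fun _ => (x, 0), by fun_prop⟩
        map_add' := fun x y => by ext <;> simp
        map_smul' := fun r x => by ext <;> simp } 1 fun x =>
      (ContinuousMap.norm_le _ (by positivity)).2 fun t => by simp
  let L2 : E →L[ℝ] C(Icc (0 : ℝ) 1, E × E) :=
    LinearMap.mkContinuous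
      { toFun := fun x => ⟨fun _ => (0, x), by fun_prop⟩
        map_add' := fun x y => by ext <;> simp
        map_smul' := fun r x => by ext <;> simp } 1 fun x =>
      (ContinuousMap.norm_le _ (by positivity)).2 fun t => by simp
  let L3 : E →L[ℝ] C(Icc (0 : ℝ) 1, E × E) :=
    LinearMap.mkContinuous
      { toFun := fun x => ⟨fun t => ((t : ℝ) • x, 0), by fun_prop⟩
        map_add' := fun x y => by ext <;> simp
        map_smul' := fun r x => by ext <;> simp [smul_comm r] } 1 fun x =>
      (ContinuousMap.norm_le _ (by positivity)).2 fun t => by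
        simp only [LinearMap.coe_mk, AddHom.coe_mk, ContinuousMap.coe_mk, Prod.norm_mk, norm_zero,
          norm_smul, Real.norm_eq_abs, one_mul]
        rw [max_eq_left (by positivity), abs_of_nonneg t.2.1]
        exact mul_le_of_le_one_left (norm_nonneg _) t.2.2
  have : segmentMap (E := E) = fun z => L1 z.1 + L2 z.2.1 + L3 (z.2.2 • z.2.1) := by
    funext z
    ext t
    · simp [segmentMap, L1, L2, L3, smul_comm (t : ℝ) z.2.2]
    · simp [segmentMap, L1, L2, L3]
  rw [this]
  fun_prop

theorem mem_hadamardDomain_iff {z : E × E × ℝ} :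
    z ∈ hadamardDomain Ω ↔ ∀ t, segmentMap z t ∈ Ω ×ˢ (univ : Set E) :=
  ⟨fun h t => ⟨h t t.2, trivial⟩, fun h t ht => (h ⟨t, ht⟩).1⟩

theorem isOpen_hadamardDomain (hΩ : IsOpen Ω) : IsOpen (hadamardDomain Ω) := by
  have := (isOpen_forall_mem (T := Icc (0 : ℝ) 1) (E := E × E) (hΩ.prod isOpen_univ)).preimage
    (contDiff_segmentMap (E := E)).continuous
  have h : hadamardDomain Ω = segmentMap ⁻¹' {y | ∀ t, y t ∈ Ω ×ˢ (univ : Set E)} :=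
    Set.ext fun z => mem_hadamardDomain_iff
  rwa [h]

/-- No differentiation under the integral is needed: the function is the composite of the segment
map, a superposition operator on `C([0, 1])` and the continuous linear integral. -/
theorem contDiffOn_hadamard (hΩ : IsOpen Ω) (hφ : ContDiffOn ℝ ∞ φ Ω) :
    ContDiffOn ℝ ∞ (hadamard φ) (hadamardDomain Ω) := by
  let G : E × E → F := fun y => fderiv ℝ φ y.1 y.2
  have hG : ContDiffOn ℝ ∞ G (Ω ×ˢ univ) :=
    ((hφ.fderiv_of_isOpen hΩ (m := ∞) (by simp)).comp contDiffOn_fst fun _ h => h.1).clm_apply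
      contDiffOn_snd
  have h1 := (contDiffOn_superpose (Icc (0 : ℝ) 1) (hΩ.prod isOpen_univ) hG).comp
    (contDiff_segmentMap (E := E)).contDiffOn (s := hadamardDomain Ω)
    fun z hz => mem_hadamardDomain_iff.1 hz
  refine ((integralIcc (F := F) 0 1 zero_le_one 0 1).contDiff.comp_contDiffOn h1).congr ?_
  intro z hz
  simp only [hadamard, Function.comp_apply, integralIcc_apply]
  refine intervalIntegral.integral_congr fun t ht => ?_
  rw [uIcc_of_le zero_le_one] at ht
  simp only [superpose_apply hG.continuousOn (mem_hadamardDomain_iff.1 hz), projIcc_of_mem _ ht]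
  rfl

end Hadamard

/-! ## The exponential function of a Banach–Lie group -/

/-- The base point occurs in the types of the tangent spaces, so an equality of points is
transported once here instead of by rewriting. -/
theorem HasMFDerivAt.of_point_eq {E E' M M' : Type*} [NormedAddCommGroup E] [NormedSpace ℝ E]
    [NormedAddCommGroup E'] [NormedSpace ℝ E'] [TopologicalSpace M] [ChartedSpace E M]
    [TopologicalSpace M'] [ChartedSpace E' M'] {f : M → M'} {x y : M} {f' : E →L[ℝ] E'}
    (h : HasMFDerivAt 𝓘(ℝ, E) 𝓘(ℝ, E') f x f') (hxy : x = y) :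
    HasMFDerivAt 𝓘(ℝ, E) 𝓘(ℝ, E') f y f' := by
  subst hxy
  exact h

section LieExp

variable {F L : Type*} [NormedAddCommGroup F] [NormedSpace ℝ F]
  [TopologicalSpace L] [ChartedSpace F L] [Group L] [LieGroup 𝓘(ℝ, F) ∞ L]

theorem t2Space_of_lieGroup (F L : Type*) [NormedAddCommGroup F] [NormedSpace ℝ F]
    [TopologicalSpace L] [ChartedSpace F L] [Group L] [LieGroup 𝓘(ℝ, F) ∞ L] : T2Space L := by
  haveI := topologicalGroup_of_lieGroup (G := L) 𝓘(ℝ, F) ∞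
  haveI : T1Space L := ChartedSpace.t1Space F L
  infer_instance

/-- The left-invariant vector field on `L` with value `v` at `1`. -/
def leftField (v : F) (g : L) : TangentSpace 𝓘(ℝ, F) g :=
  mulInvariantVectorField (I := 𝓘(ℝ, F)) (G := L) v g

theorem leftField_eq (v : F) (g : L) :
    leftField v g = mfderiv 𝓘(ℝ, F) 𝓘(ℝ, F) (fun x : L => g * x) 1 v := rfl

theorem leftField_smul (a : ℝ) (v : F) : leftField (L := L) (a • v) = a • leftField v := by
  funext g
  exact map_smul (mfderiv 𝓘(ℝ, F) 𝓘(ℝ, F) (fun x : L => g * x) 1) a v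

theorem contMDiff_leftField (v : F) :
    ContMDiff 𝓘(ℝ, F) 𝓘(ℝ, F).tangent 1
      (fun g : L => (⟨g, leftField v g⟩ : TangentBundle 𝓘(ℝ, F) L)) := by
  haveI : LieGroup 𝓘(ℝ, F) (minSmoothness ℝ 3) L := LieGroup.of_le (n := ∞) (by
    rw [minSmoothness_of_isRCLikeNormedField]; exact WithTop.coe_le_coe.2 le_top)
  refine (contMDiff_mulInvariantVectorField (I := 𝓘(ℝ, F)) (G := L) v).of_le ?_
  rw [minSmoothness_of_isRCLikeNormedField]
  exact one_le_two

theorem mdifferentiableAt_const_mul (g h : L) :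
    MDifferentiableAt 𝓘(ℝ, F) 𝓘(ℝ, F) (fun x : L => g * x) h :=
  (contMDiff_mul_left (I := 𝓘(ℝ, F)) (n := ∞) (a := g)).contMDiffAt.mdifferentiableAt (by simp)

/-- Chain rule for `L_g ∘ L_h = L_{gh}`, differentiated at `1`. -/
theorem mfderiv_mul_left_leftField (v : F) (g h : L) :
    mfderiv 𝓘(ℝ, F) 𝓘(ℝ, F) (fun x : L => g * x) h (leftField v h) = leftField v (g * h) := by
  have h1 := (mdifferentiableAt_const_mul (F := F) h 1).hasMFDerivAt
  have h2 : HasMFDerivAt 𝓘(ℝ, F) 𝓘(ℝ, F) (fun x : L => g * x) (h * 1)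
      (mfderiv 𝓘(ℝ, F) 𝓘(ℝ, F) (fun x : L => g * x) h) :=
    (mdifferentiableAt_const_mul (F := F) g h).hasMFDerivAt.of_point_eq (mul_one h).symm
  have h3 := (h2.comp (1 : L) h1).mfderiv
  have h4 : (fun x : L => g * x) ∘ (fun x => h * x) = fun x => g * h * x := by
    funext x; simp [mul_assoc]
  rw [h4] at h3
  rw [leftField_eq, leftField_eq, h3]
  rfl

theorem IsMIntegralCurveOn.mul_left {γ : ℝ → L} {v : F} {s : Set ℝ}
    (hγ : IsMIntegralCurveOn (I := 𝓘(ℝ, F)) γ (leftField v) s) (g : L) :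
    IsMIntegralCurveOn (I := 𝓘(ℝ, F)) (fun t => g * γ t) (leftField v) s := by
  intro t ht
  have h1 := (mdifferentiableAt_const_mul (F := F) g (γ t)).hasMFDerivAt
  have h2 := h1.comp_hasMFDerivWithinAt t (hγ t ht)
  have e : ((mfderiv 𝓘(ℝ, F) 𝓘(ℝ, F) (fun x : L => g * x) (γ t) : F →L[ℝ] F).comp
      ((1 : ℝ →L[ℝ] ℝ).smulRight (leftField v (γ t) : F)) : ℝ →L[ℝ] F) =
      (1 : ℝ →L[ℝ] ℝ).smulRight (leftField v (g * γ t) : F) := by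
    refine ContinuousLinearMap.ext fun r => ?_
    rw [← mfderiv_mul_left_leftField v g (γ t)]
    exact map_smul (mfderiv 𝓘(ℝ, F) 𝓘(ℝ, F) (fun x : L => g * x) (γ t)) r _
  exact e ▸ h2

theorem IsMIntegralCurve.mul_left {γ : ℝ → L} {v : F}
    (hγ : IsMIntegralCurve (I := 𝓘(ℝ, F)) γ (leftField v)) (g : L) :
    IsMIntegralCurve (I := 𝓘(ℝ, F)) (fun t => g * γ t) (leftField v) := by
  rw [isMIntegralCurve_iff_isMIntegralCurveOn] at hγ ⊢
  exact hγ.mul_left g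

theorem eq_of_isMIntegralCurve {γ γ' : ℝ → L} {v : F}
    (hγ : IsMIntegralCurve (I := 𝓘(ℝ, F)) γ (leftField v))
    (hγ' : IsMIntegralCurve (I := 𝓘(ℝ, F)) γ' (leftField v)) (h : γ 0 = γ' 0) : γ = γ' :=
  haveI := t2Space_of_lieGroup F L
  isMIntegralCurve_Ioo_eq_of_contMDiff_boundaryless (t₀ := 0) (contMDiff_leftField v) hγ hγ' h

/-- Left translates of one local integral curve at `1` are integral curves through every point with
the same existence time, and a uniform existence time makes the field complete. -/
theorem exists_isMIntegralCurve_leftField [CompleteSpace F] (v : F) :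
    ∃ γ : ℝ → L, γ 0 = 1 ∧ IsMIntegralCurve (I := 𝓘(ℝ, F)) γ (leftField v) := by
  haveI := t2Space_of_lieGroup F L
  obtain ⟨γ, h0, hγ⟩ := exists_isMIntegralCurveAt_of_contMDiffAt_boundaryless 0
    (contMDiff_leftField v).contMDiffAt (x₀ := (1 : L))
  obtain ⟨ε, hε, hγ⟩ := isMIntegralCurveAt_iff'.1 hγ
  refine exists_isMIntegralCurve_of_isMIntegralCurveOn (contMDiff_leftField v) hε (fun g => ?_) 1
  refine ⟨fun t => g * γ t, by simp [h0], ?_⟩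
  have := hγ.mul_left g
  rwa [Real.ball_eq_Ioo, zero_sub, zero_add] at this

/-- The integral curve through `1` of the left-invariant vector field with value `v` at `1`. -/
def lieCurve [CompleteSpace F] (L : Type*) [TopologicalSpace L] [ChartedSpace F L] [Group L]
    [LieGroup 𝓘(ℝ, F) ∞ L] (v : F) : ℝ → L :=
  (exists_isMIntegralCurve_leftField v).choose

/-- Writing `c s = c t * c (s - t)` moves the velocity at `t` to the one at `0` by left translation.
With uniqueness of integral curves this identifies the curve chosen in `lieExp`. -/
theorem IsOneParameterSubgroup.isMIntegralCurve {v : F} {c : ℝ → L}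
    (h : IsOneParameterSubgroup v c) :
    IsMIntegralCurve (I := 𝓘(ℝ, F)) c (leftField v) := by
  obtain ⟨hs, h0, hadd, hd⟩ := h
  intro t
  have h1 : HasMFDerivAt 𝓘(ℝ, ℝ) 𝓘(ℝ, F) c 0 (mfderiv 𝓘(ℝ, ℝ) 𝓘(ℝ, F) c 0) :=
    (hs.contMDiffAt.mdifferentiableAt (by simp)).hasMFDerivAt
  have h2 : HasMFDerivAt 𝓘(ℝ, F) 𝓘(ℝ, F) (fun x : L => c t * x) (c 0)
      (mfderiv 𝓘(ℝ, F) 𝓘(ℝ, F) (fun x : L => c t * x) 1) :=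
    (mdifferentiableAt_const_mul (F := F) (c t) 1).hasMFDerivAt.of_point_eq h0.symm
  have h3 : HasMFDerivAt 𝓘(ℝ, ℝ) 𝓘(ℝ, ℝ) (fun s : ℝ => s - t) t (ContinuousLinearMap.id ℝ ℝ) :=
    ((hasFDerivAt_id t).sub_const t).hasMFDerivAt
  have h4 : HasMFDerivAt 𝓘(ℝ, ℝ) 𝓘(ℝ, F) ((fun x : L => c t * x) ∘ c) (t - t)
      ((mfderiv 𝓘(ℝ, F) 𝓘(ℝ, F) (fun x : L => c t * x) 1).comp
        (mfderiv 𝓘(ℝ, ℝ) 𝓘(ℝ, F) c 0)) :=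
    (h2.comp 0 h1).of_point_eq (sub_self t).symm
  have h5 := HasMFDerivAt.comp (f := fun s : ℝ => s - t) t h4 h3
  have h6 : (((fun x : L => c t * x) ∘ c) ∘ fun s : ℝ => s - t) = c := by
    funext s
    simp [← hadd]
  rw [h6] at h5
  have e : (((mfderiv 𝓘(ℝ, F) 𝓘(ℝ, F) (fun x : L => c t * x) 1 : F →L[ℝ] F).comp
      (mfderiv 𝓘(ℝ, ℝ) 𝓘(ℝ, F) c 0 : ℝ →L[ℝ] F)).comp (ContinuousLinearMap.id ℝ ℝ)) =
      (1 : ℝ →L[ℝ] ℝ).smulRight (leftField v (c t) : F) := by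
    refine ContinuousLinearMap.ext_ring ?_
    have hd' : (mfderiv 𝓘(ℝ, F) 𝓘(ℝ, F) (fun x : L => c t * x) 1 : F →L[ℝ] F)
        ((mfderiv 𝓘(ℝ, ℝ) 𝓘(ℝ, F) c 0 : ℝ →L[ℝ] F) 1) = leftField v (c t) := by
      rw [hd]; rfl
    exact hd'.trans (one_smul ℝ _).symm
  exact e ▸ h5

section Complete

variable [CompleteSpace F]

theorem lieCurve_zero (v : F) : lieCurve L v 0 = 1 :=
  (exists_isMIntegralCurve_leftField (L := L) v).choose_spec.1

theorem isMIntegralCurve_lieCurve (v : F) :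
    IsMIntegralCurve (I := 𝓘(ℝ, F)) (lieCurve L v) (leftField v) :=
  (exists_isMIntegralCurve_leftField (L := L) v).choose_spec.2

theorem lieCurve_add (v : F) (s t : ℝ) :
    lieCurve L v (s + t) = lieCurve L v s * lieCurve L v t := by
  have h1 := (isMIntegralCurve_lieCurve (L := L) v).comp_add s
  have h2 := (isMIntegralCurve_lieCurve (L := L) v).mul_left (lieCurve L v s)
  have := congrFun (eq_of_isMIntegralCurve h1 h2 (by simp [lieCurve_zero])) t
  simpa [add_comm] using this

theorem lieCurve_smul (a : ℝ) (v : F) (t : ℝ) : lieCurve L (a • v) t = lieCurve L v (a * t) := by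
  have h1 := (isMIntegralCurve_lieCurve (L := L) v).comp_mul a
  rw [← leftField_smul] at h1
  have := congrFun (eq_of_isMIntegralCurve (isMIntegralCurve_lieCurve (L := L) (a • v)) h1
    (by simp [lieCurve_zero])) t
  simpa [mul_comm] using this

end Complete

/-- Multiplication in the preferred chart at `1`. -/
def localMul (L : Type*) [TopologicalSpace L] [ChartedSpace F L] [Group L] (z : F × F) : F :=
  extChartAt 𝓘(ℝ, F) (1 : L) ((extChartAt 𝓘(ℝ, F) (1 : L)).symm z.1 *
    (extChartAt 𝓘(ℝ, F) (1 : L)).symm z.2)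

/-- The domain of `localMul`. -/
def localMulDomain (F L : Type*) [NormedAddCommGroup F] [NormedSpace ℝ F] [TopologicalSpace L]
    [ChartedSpace F L] [Group L] : Set (F × F) :=
  ((extChartAt 𝓘(ℝ, F) (1 : L)).target ×ˢ (extChartAt 𝓘(ℝ, F) (1 : L)).target) ∩
    (fun z => (extChartAt 𝓘(ℝ, F) (1 : L)).symm z.1 * (extChartAt 𝓘(ℝ, F) (1 : L)).symm z.2) ⁻¹'
      (extChartAt 𝓘(ℝ, F) (1 : L)).source

theorem contMDiffOn_symm_mul_symm :
    ContMDiffOn 𝓘(ℝ, F × F) 𝓘(ℝ, F) ∞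
      (fun z : F × F => (extChartAt 𝓘(ℝ, F) (1 : L)).symm z.1 *
        (extChartAt 𝓘(ℝ, F) (1 : L)).symm z.2)
      ((extChartAt 𝓘(ℝ, F) (1 : L)).target ×ˢ (extChartAt 𝓘(ℝ, F) (1 : L)).target) := by
  have h := contMDiffOn_extChartAt_symm (I := 𝓘(ℝ, F)) (n := ∞) (1 : L)
  have h1 : ContMDiffOn 𝓘(ℝ, F × F) 𝓘(ℝ, F) ∞ (Prod.fst : F × F → F) univ :=
    contDiff_fst.contMDiff.contMDiffOn
  have h2 : ContMDiffOn 𝓘(ℝ, F × F) 𝓘(ℝ, F) ∞ (Prod.snd : F × F → F) univ :=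
    contDiff_snd.contMDiff.contMDiffOn
  exact (h.comp (h1.mono (subset_univ _)) fun z hz => hz.1).mul
    (h.comp (h2.mono (subset_univ _)) fun z hz => hz.2)

theorem isOpen_localMulDomain : IsOpen (localMulDomain F L) :=
  (contMDiffOn_symm_mul_symm (F := F) (L := L)).continuousOn.isOpen_inter_preimage
    ((isOpen_extChartAt_target _).prod (isOpen_extChartAt_target _)) (isOpen_extChartAt_source _)

theorem contDiffOn_localMul : ContDiffOn ℝ ∞ (localMul (F := F) L) (localMulDomain F L) := by
  rw [← contMDiffOn_iff_contDiffOn]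
  exact (contMDiffOn_extChartAt (I := 𝓘(ℝ, F)) (n := ∞) (x := (1 : L))).comp
    ((contMDiffOn_symm_mul_symm (F := F) (L := L)).mono inter_subset_left)
    (fun z hz => by simpa using hz.2)

end LieExp

/-! ### Left-invariant fields in a chart, and smooth dependence of their flow on the field. -/

section LocalExp

variable {F L : Type*} [NormedAddCommGroup F] [NormedSpace ℝ F]
  [TopologicalSpace L] [ChartedSpace F L] [Group L] [LieGroup 𝓘(ℝ, F) ∞ L]

/-- The left-invariant vector fields in the preferred chart at `1`. -/
def localField (L : Type*) [TopologicalSpace L] [ChartedSpace F L] [Group L] (z : F × F) : F :=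
  fderiv ℝ (localMul (F := F) L) (z.2, extChartAt 𝓘(ℝ, F) (1 : L) 1) (0, z.1)

theorem mk_mem_localMulDomain {y : F} (hy : y ∈ (extChartAt 𝓘(ℝ, F) (1 : L)).target) :
    (y, extChartAt 𝓘(ℝ, F) (1 : L) 1) ∈ localMulDomain F L := by
  refine ⟨⟨hy, mem_extChartAt_target _⟩, ?_⟩
  simp only [mem_preimage, extChartAt_to_inv, mul_one]
  exact (extChartAt 𝓘(ℝ, F) (1 : L)).map_target hy

theorem contDiffOn_localField :
    ContDiffOn ℝ ∞ (localField (F := F) L) (univ ×ˢ (extChartAt 𝓘(ℝ, F) (1 : L)).target) := by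
  have h1 : ContDiffOn ℝ ∞ (fderiv ℝ (localMul (F := F) L)) (localMulDomain F L) :=
    contDiffOn_localMul.fderiv_of_isOpen isOpen_localMulDomain (by simp)
  refine (h1.comp (f := fun z : F × F => (z.2, extChartAt 𝓘(ℝ, F) (1 : L) 1)) (by fun_prop)
    fun z hz => mk_mem_localMulDomain hz.2).clm_apply (by fun_prop)

theorem localField_zero (y : F) : localField L ((0 : F), y) = 0 := by
  have : ((0 : F), (0 : F)) = 0 := rfl
  simp [localField, this]

/-- Read in the chart, left translation by the point with coordinate `y` is `localMul (y, ·)`, and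
the preferred chart has identity derivative at `1`; the chain rule does the rest. -/
theorem mfderiv_extChartAt_symm_localField (v : F) {y : F}
    (hy : y ∈ (extChartAt 𝓘(ℝ, F) (1 : L)).target) :
    (mfderiv 𝓘(ℝ, F) 𝓘(ℝ, F) (extChartAt 𝓘(ℝ, F) (1 : L)).symm y : F →L[ℝ] F)
      (localField (F := F) L (v, y)) = leftField v ((extChartAt 𝓘(ℝ, F) (1 : L)).symm y) := by
  set c := extChartAt 𝓘(ℝ, F) (1 : L) with hc
  have h1 : HasMFDerivAt 𝓘(ℝ, F) 𝓘(ℝ, F) c 1 (ContinuousLinearMap.id ℝ F) := by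
    have := (mdifferentiableAt_extChartAt (I := 𝓘(ℝ, F))
      (mem_chart_source F (1 : L))).hasMFDerivAt
    rw [mfderiv_extChartAt_self] at this
    exact this
  have h2 : HasFDerivAt (fun z : F => localMul L (y, z))
      ((fderiv ℝ (localMul (F := F) L) (y, c 1)).comp (ContinuousLinearMap.inr ℝ F F)) (c 1) := by
    have hd : HasFDerivAt (localMul (F := F) L) (fderiv ℝ (localMul (F := F) L) (y, c 1))
        (y, c 1) :=
      ((contDiffOn_localMul.contDiffAt
        (isOpen_localMulDomain.mem_nhds (mk_mem_localMulDomain hy))).differentiableAt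
        (by simp)).hasFDerivAt
    exact hd.comp (c 1) (hasFDerivAt_prodMk_right y (c 1))
  have hval : localMul L (y, c 1) = y := by
    simp only [localMul, ← hc]
    rw [hc, extChartAt_to_inv, mul_one, ← hc]
    exact c.right_inv hy
  have h3 : HasMFDerivAt 𝓘(ℝ, F) 𝓘(ℝ, F) c.symm (localMul L (y, c 1))
      (mfderiv 𝓘(ℝ, F) 𝓘(ℝ, F) c.symm y : F →L[ℝ] F) := by
    have : MDifferentiableAt 𝓘(ℝ, F) 𝓘(ℝ, F) c.symm y :=
      ((contMDiffOn_extChartAt_symm (I := 𝓘(ℝ, F)) (n := ∞) (1 : L)).contMDiffAt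
        ((isOpen_extChartAt_target _).mem_nhds hy)).mdifferentiableAt (by simp)
    exact this.hasMFDerivAt.of_point_eq hval.symm
  have h4 := (HasMFDerivAt.comp (c 1) h3 h2.hasMFDerivAt).comp (1 : L) h1
  have h5 : (fun x : L => c.symm y * x) =ᶠ[𝓝 1]
      (c.symm ∘ fun z : F => localMul L (y, z)) ∘ c := by
    haveI := topologicalGroup_of_lieGroup (G := L) 𝓘(ℝ, F) ∞
    have e1 : ∀ᶠ x in 𝓝 (1 : L), x ∈ c.source :=
      (isOpen_extChartAt_source _).mem_nhds (mem_extChartAt_source _)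
    have e2 : ∀ᶠ x in 𝓝 (1 : L), c.symm y * x ∈ c.source := by
      have : Tendsto (fun x : L => c.symm y * x) (𝓝 1) (𝓝 (c.symm y * 1)) :=
        (continuous_const_mul _).tendsto _
      refine this.eventually ((isOpen_extChartAt_source _).mem_nhds ?_)
      rw [mul_one]
      exact c.map_target hy
    filter_upwards [e1, e2] with x hx1 hx2
    simp only [Function.comp_apply, localMul, ← hc]
    rw [c.left_inv hx1, c.left_inv hx2]
  have h6 := (h4.congr_of_eventuallyEq h5).mfderiv
  rw [leftField_eq, h6]
  rfl

theorem isMIntegralCurveOn_symm_comp {v : F} {y : ℝ → F} {s : Set ℝ}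
    (hy : ∀ t ∈ s, y t ∈ (extChartAt 𝓘(ℝ, F) (1 : L)).target)
    (hd : ∀ t ∈ s, HasDerivAt y (localField L (v, y t)) t) :
    IsMIntegralCurveOn (I := 𝓘(ℝ, F)) (fun t => (extChartAt 𝓘(ℝ, F) (1 : L)).symm (y t))
      (leftField v) s := by
  intro t ht
  have h1 : HasMFDerivAt 𝓘(ℝ, ℝ) 𝓘(ℝ, F) y t
      ((1 : ℝ →L[ℝ] ℝ).smulRight (localField (F := F) L (v, y t))) := (hd t ht).hasFDerivAt.hasMFDerivAt
  have h2 : MDifferentiableAt 𝓘(ℝ, F) 𝓘(ℝ, F) (extChartAt 𝓘(ℝ, F) (1 : L)).symm (y t) :=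
    ((contMDiffOn_extChartAt_symm (I := 𝓘(ℝ, F)) (n := ∞) (1 : L)).contMDiffAt
      ((isOpen_extChartAt_target _).mem_nhds (hy t ht))).mdifferentiableAt (by simp)
  have h3 := (h2.hasMFDerivAt.comp t h1).hasMFDerivWithinAt (s := s)
  have e : ((mfderiv 𝓘(ℝ, F) 𝓘(ℝ, F) (extChartAt 𝓘(ℝ, F) (1 : L)).symm (y t) : F →L[ℝ] F).comp
      ((1 : ℝ →L[ℝ] ℝ).smulRight (localField (F := F) L (v, y t))) : ℝ →L[ℝ] F) =
      (1 : ℝ →L[ℝ] ℝ).smulRight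
        (leftField v ((extChartAt 𝓘(ℝ, F) (1 : L)).symm (y t)) : F) := by
    refine ContinuousLinearMap.ext fun r => ?_
    rw [← mfderiv_extChartAt_symm_localField v (hy t ht)]
    exact map_smul (mfderiv 𝓘(ℝ, F) 𝓘(ℝ, F) (extChartAt 𝓘(ℝ, F) (1 : L)).symm (y t)) r _
  exact e ▸ h3

/-- Solutions live on `[-2, 2]` so that both the initial time `0` and the evaluation time `1` are
interior points. -/
theorem neg_two_le_two : (-2 : ℝ) ≤ 2 := by norm_num

/-- The Volterra operator on `C([-2, 2], F)`. -/
def volterra : C(Icc (-2 : ℝ) 2, F) →L[ℝ] C(Icc (-2 : ℝ) 2, F) :=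
  LinearMap.mkContinuous
    { toFun := fun f => ⟨fun t => ∫ s in (0 : ℝ)..t, f (projIcc (-2) 2 neg_two_le_two s),
        (intervalIntegral.continuous_primitive (fun a b =>
          (f.continuous.comp continuous_projIcc).intervalIntegrable a b) 0).comp
          continuous_subtype_val⟩
      map_add' := fun f g => by
        ext t
        exact intervalIntegral.integral_add
          ((f.continuous.comp continuous_projIcc).intervalIntegrable _ _)
          ((g.continuous.comp continuous_projIcc).intervalIntegrable _ _)
      map_smul' := fun r f => by
        ext t
        exact intervalIntegral.integral_smul r _ } 2 fun f => by
    refine (ContinuousMap.norm_le _ (by positivity)).2 fun t => ?_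
    have h := intervalIntegral.norm_integral_le_of_norm_le_const (a := 0) (b := (t : ℝ))
      (C := ‖f‖) (f := fun s => f (projIcc (-2) 2 neg_two_le_two s))
      fun s _ => f.norm_coe_le_norm _
    have ht : |(t : ℝ) - 0| ≤ 2 := by
      rw [sub_zero, abs_le]; exact t.2
    calc _ ≤ ‖f‖ * |(t : ℝ) - 0| := h
      _ ≤ ‖f‖ * 2 := mul_le_mul_of_nonneg_left ht (norm_nonneg _)
      _ = 2 * ‖f‖ := mul_comm _ _

theorem volterra_apply (f : C(Icc (-2 : ℝ) 2, F)) (t : Icc (-2 : ℝ) 2) :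
    volterra f t = ∫ s in (0 : ℝ)..t, f (projIcc (-2) 2 neg_two_le_two s) := rfl

/-- Adjoining a constant parameter to a continuous function. -/
def pairConst : F × C(Icc (-2 : ℝ) 2, F) →L[ℝ] C(Icc (-2 : ℝ) 2, F × F) :=
  LinearMap.mkContinuous
    { toFun := fun z => ⟨fun t => (z.1, z.2 t), by fun_prop⟩
      map_add' := fun z w => by ext <;> simp
      map_smul' := fun r z => by ext <;> simp } 1 fun z => by
    refine (ContinuousMap.norm_le _ (by positivity)).2 fun t => ?_
    rw [one_mul]
    exact max_le_max le_rfl (z.2.norm_coe_le_norm t)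

@[simp] theorem pairConst_apply (z : F × C(Icc (-2 : ℝ) 2, F)) (t : Icc (-2 : ℝ) 2) :
    pairConst z t = (z.1, z.2 t) := rfl

/-- The defect of `y` as a solution of `y' = X(v, y)`, `y(0) = x₀`. -/
def odeDefect (X : F × F → F) (x₀ : F) (z : F × C(Icc (-2 : ℝ) 2, F)) : C(Icc (-2 : ℝ) 2, F) :=
  z.2 - ContinuousMap.const _ x₀ - volterra (superpose X (pairConst z))

/-- Smooth dependence on parameters for an equation `y' = X(v, y)` with `X(0, ·) = 0`. -/
theorem exists_smooth_solution [CompleteSpace F] {X : F × F → F} {O : Set F} (hO : IsOpen O)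
    (hX : ContDiffOn ℝ ∞ X (univ ×ˢ O)) (hX0 : ∀ y, X (0, y) = 0) {x₀ : F} (hx₀ : x₀ ∈ O) :
    ∃ Y : F → C(Icc (-2 : ℝ) 2, F), ContDiffAt ℝ ∞ Y 0 ∧
      ∀ᶠ v in 𝓝 (0 : F), (∀ t, Y v t ∈ O) ∧ odeDefect X x₀ (v, Y v) = 0 := by
  have hO' : IsOpen ((univ : Set F) ×ˢ O) := isOpen_univ.prod hO
  have hopen : IsOpen {z : F × C(Icc (-2 : ℝ) 2, F) | ∀ t, pairConst z t ∈ (univ : Set F) ×ˢ O} :=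
    (isOpen_forall_mem hO').preimage pairConst.continuous
  have hmem : ((0 : F), ContinuousMap.const (Icc (-2 : ℝ) 2) x₀) ∈
      {z : F × C(Icc (-2 : ℝ) 2, F) | ∀ t, pairConst z t ∈ (univ : Set F) ×ˢ O} :=
    fun t => ⟨trivial, hx₀⟩
  have hs : ContDiffOn ℝ ∞ (fun z => superpose X (pairConst z))
      {z : F × C(Icc (-2 : ℝ) 2, F) | ∀ t, pairConst z t ∈ (univ : Set F) ×ˢ O} :=
    (contDiffOn_superpose (Icc (-2 : ℝ) 2) hO' hX).comp
      (by fun_prop) (fun z hz => hz)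
  have hΨ : ContDiffOn ℝ ∞ (odeDefect X x₀)
      {z : F × C(Icc (-2 : ℝ) 2, F) | ∀ t, pairConst z t ∈ (univ : Set F) ×ˢ O} := by
    have : ContDiffOn ℝ ∞ (fun z => volterra (superpose X (pairConst z)))
        {z : F × C(Icc (-2 : ℝ) 2, F) | ∀ t, pairConst z t ∈ (univ : Set F) ×ˢ O} := by
      have hv : ContDiff ℝ ∞ (fun y : C(Icc (-2 : ℝ) 2, F) => volterra y) := by fun_prop
      exact hv.comp_contDiffOn hs
    exact ((contDiff_snd.contDiffOn).sub contDiffOn_const).sub this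
  have hat : ContDiffAt ℝ ∞ (odeDefect X x₀) ((0 : F), ContinuousMap.const _ x₀) :=
    hΨ.contDiffAt (hopen.mem_nhds hmem)
  -- At the parameter `0` the field vanishes, so the defect is `y` minus a constant. Its partial
  -- derivative in `y` is the identity, and the implicit function theorem applies on the whole
  -- interval without any smallness condition on its length.
  have hzero : ∀ y : C(Icc (-2 : ℝ) 2, F), odeDefect X x₀ (0, y) = y - ContinuousMap.const _ x₀ := by
    intro y
    have : superpose X (pairConst ((0 : F), y)) = 0 := by
      ext t
      have hc : ContinuousOn X ((({(0 : F)} : Set F)) ×ˢ univ) :=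
        (continuousOn_const (c := (0 : F))).congr fun z hz => by
          obtain ⟨a, b⟩ := z
          obtain rfl : a = 0 := hz.1
          exact hX0 b
      rw [superpose_apply hc (y := pairConst ((0 : F), y)) (fun t => ⟨rfl, trivial⟩)]
      exact hX0 _
    simp [odeDefect, this]
  have hinv : (fderiv ℝ (odeDefect X x₀) ((0 : F), ContinuousMap.const _ x₀) ∘L
      .inr ℝ F C(Icc (-2 : ℝ) 2, F)).IsInvertible := by
    have h1 := (hat.differentiableAt (by simp)).hasFDerivAt.comp
      (ContinuousMap.const (Icc (-2 : ℝ) 2) x₀) (hasFDerivAt_prodMk_right (0 : F) _)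
    have h2 : HasFDerivAt (odeDefect X x₀ ∘ fun y => ((0 : F), y))
        (ContinuousLinearMap.id ℝ C(Icc (-2 : ℝ) 2, F)) (ContinuousMap.const _ x₀) := by
      have : (odeDefect X x₀ ∘ fun y => ((0 : F), y)) =
          fun y => y - ContinuousMap.const _ x₀ := funext hzero
      rw [this]
      exact (hasFDerivAt_id _).sub_const _
    rw [h1.unique h2]
    exact ⟨ContinuousLinearEquiv.refl ℝ _, rfl⟩
  refine ⟨hat.implicitFunction (by simp) hinv, hat.contDiffAt_implicitFunction (by simp) hinv, ?_⟩
  have hself := hat.implicitFunction_apply_self (by simp) hinv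
  have hcont := (hat.contDiffAt_implicitFunction (by simp) hinv).continuousAt
  have e1 := hat.eventually_apply_implicitFunction (by simp) hinv
  have e2 := hcont.eventually ((isOpen_forall_mem (T := Icc (-2 : ℝ) 2) hO).mem_nhds
    (by rw [hself]; exact fun _ => hx₀))
  filter_upwards [e1, e2] with v h1 h2
  refine ⟨h2, h1.trans ?_⟩
  rw [hzero, sub_self]

theorem hasDerivAt_of_odeDefect_eq_zero [CompleteSpace F] {X : F × F → F} {O : Set F}
    (hX : ContinuousOn X (univ ×ˢ O)) {x₀ v : F} {y : C(Icc (-2 : ℝ) 2, F)} (hy : ∀ t, y t ∈ O)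
    (h : odeDefect X x₀ (v, y) = 0) :
    y ⟨0, by norm_num⟩ = x₀ ∧ ∀ t ∈ Ioo (-2 : ℝ) 2,
      HasDerivAt (fun s => y (projIcc (-2) 2 neg_two_le_two s))
        (X (v, y (projIcc (-2) 2 neg_two_le_two t))) t := by
  have hval : ∀ t, y t = x₀ + ∫ s in (0 : ℝ)..t, X (v, y (projIcc (-2) 2 neg_two_le_two s)) := by
    intro t
    have := congrArg (fun f : C(Icc (-2 : ℝ) 2, F) => f t) h
    simp only [odeDefect, ContinuousMap.sub_apply, ContinuousMap.const_apply, volterra_apply,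
      ContinuousMap.zero_apply,
      superpose_apply hX (y := pairConst (v, y)) (fun t => ⟨trivial, hy t⟩)] at this
    rw [sub_sub, sub_eq_zero] at this
    exact this
  refine ⟨by simpa using hval ⟨0, by norm_num⟩, fun t ht => ?_⟩
  have hc : Continuous fun s => X (v, y (projIcc (-2) 2 neg_two_le_two s)) :=
    hX.comp_continuous (by fun_prop) fun s => ⟨trivial, hy _⟩
  have h1 := (hc.integral_hasStrictDerivAt 0 t).hasDerivAt.const_add x₀
  refine h1.congr_of_eventuallyEq ?_
  filter_upwards [Icc_mem_nhds ht.1 ht.2] with s hs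
  rw [hval, projIcc_of_mem _ hs]

end LocalExp

/-! ### Smoothness, local inverse and naturality of the exponential function. -/

section LieExpSmooth

variable {F L : Type*} [NormedAddCommGroup F] [NormedSpace ℝ F] [CompleteSpace F]
  [TopologicalSpace L] [ChartedSpace F L] [Group L] [LieGroup 𝓘(ℝ, F) ∞ L]

/-- For `v` near `0` the equation in the chart has a solution on all of `[-2, 2]` depending smoothly
on `v`. By uniqueness of integral curves it is the curve in the group, and it is evaluated at time
`1`. -/
theorem contMDiffAt_lieCurve_one :
    ContMDiffAt 𝓘(ℝ, F) 𝓘(ℝ, F) ∞ (fun v : F => lieCurve L v 1) 0 := by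
  have hx₀ := mem_extChartAt_target (I := 𝓘(ℝ, F)) (1 : L)
  obtain ⟨Y, hY, hsol⟩ := exists_smooth_solution (isOpen_extChartAt_target (I := 𝓘(ℝ, F)) (1 : L))
    (contDiffOn_localField (F := F) (L := L)) localField_zero hx₀
  let one : Icc (-2 : ℝ) 2 := ⟨1, by norm_num⟩
  have h1 : ContDiffAt ℝ ∞ (fun v => Y v one) 0 := by
    let ev : C(Icc (-2 : ℝ) 2, F) →L[ℝ] F := ContinuousMap.evalCLM ℝ one
    have hev : ContDiff ℝ ∞ (fun y : C(Icc (-2 : ℝ) 2, F) => ev y) := by fun_prop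
    exact hev.contDiffAt.comp (0 : F) hY
  have h2 : ContMDiffAt 𝓘(ℝ, F) 𝓘(ℝ, F) ∞
      (fun v => (extChartAt 𝓘(ℝ, F) (1 : L)).symm (Y v one)) 0 :=
    ((contMDiffOn_extChartAt_symm (I := 𝓘(ℝ, F)) (n := ∞) (1 : L)).contMDiffAt
      ((isOpen_extChartAt_target _).mem_nhds (hsol.self_of_nhds.1 one))).comp (0 : F)
      h1.contMDiffAt
  refine h2.congr_of_eventuallyEq ?_
  filter_upwards [hsol] with v hv
  obtain ⟨h0, hd⟩ := hasDerivAt_of_odeDefect_eq_zero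
    (contDiffOn_localField (F := F) (L := L)).continuousOn hv.1 hv.2
  have h3 := isMIntegralCurveOn_symm_comp (fun t _ => hv.1 (projIcc (-2) 2 neg_two_le_two t)) hd
  haveI := t2Space_of_lieGroup F L
  have h4 := isMIntegralCurveOn_Ioo_eqOn_of_contMDiff_boundaryless (t₀ := 0) (by norm_num)
    (contMDiff_leftField v) ((isMIntegralCurve_lieCurve (L := L) v).isMIntegralCurveOn
      (Ioo (-2 : ℝ) 2)) h3 (by
        rw [lieCurve_zero, projIcc_of_mem _ (by norm_num : (0 : ℝ) ∈ Icc (-2 : ℝ) 2), h0,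
          extChartAt_to_inv])
  have h5 := h4 (by norm_num : (1 : ℝ) ∈ Ioo (-2 : ℝ) 2)
  simp only at h5
  rw [h5, projIcc_of_mem _ (by norm_num : (1 : ℝ) ∈ Icc (-2 : ℝ) 2)]

theorem lieCurve_eq_lieCurve_smul_one (v : F) (t : ℝ) :
    lieCurve L v t = lieCurve L (t • v) 1 := by
  rw [lieCurve_smul, mul_one]

/-- By the one-parameter law the curve near `t₀` is a translate of `exp ((t - t₀) v)`, so smoothness
of `exp` at `0` suffices. -/
theorem contMDiff_lieCurve (v : F) : ContMDiff 𝓘(ℝ, ℝ) 𝓘(ℝ, F) ∞ (lieCurve L v) := by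
  intro t₀
  have h1 : lieCurve L v = fun t => lieCurve L v t₀ * lieCurve L ((t - t₀) • v) 1 := by
    funext t
    rw [← lieCurve_eq_lieCurve_smul_one, ← lieCurve_add]
    congr 1
    ring
  rw [h1]
  have h2 : ContMDiffAt 𝓘(ℝ, ℝ) 𝓘(ℝ, F) ∞ (fun t : ℝ => (t - t₀) • v) t₀ := by
    have : ContDiff ℝ ∞ (fun t : ℝ => (t - t₀) • v) := by fun_prop
    exact this.contMDiff.contMDiffAt
  have h3 : ContMDiffAt 𝓘(ℝ, F) 𝓘(ℝ, F) ∞ (fun v : F => lieCurve L v 1) ((t₀ - t₀) • v) := by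
    simpa using contMDiffAt_lieCurve_one (F := F) (L := L)
  exact contMDiffAt_const.mul (h3.comp t₀ h2)

theorem hasMFDerivAt_lieCurve_zero (v : F) :
    HasMFDerivAt 𝓘(ℝ, ℝ) 𝓘(ℝ, F) (lieCurve L v) 0 ((1 : ℝ →L[ℝ] ℝ).smulRight v) := by
  have h := isMIntegralCurve_lieCurve (L := L) v 0
  have e : (leftField v (lieCurve L v 0) : F) = v := by
    rw [lieCurve_zero, leftField_eq]
    have : (fun x : L => 1 * x) = id := by funext x; simp
    rw [this, mfderiv_id]
    rfl
  rw [e] at h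
  exact h

theorem isOneParameterSubgroup_lieCurve (v : F) : IsOneParameterSubgroup v (lieCurve L v) := by
  refine ⟨contMDiff_lieCurve v, lieCurve_zero v, lieCurve_add v, ?_⟩
  rw [(hasMFDerivAt_lieCurve_zero (L := L) v).mfderiv]
  exact one_smul ℝ v

theorem IsOneParameterSubgroup.eq_lieCurve {v : F} {c : ℝ → L} (h : IsOneParameterSubgroup v c) :
    c = lieCurve L v :=
  eq_of_isMIntegralCurve h.isMIntegralCurve (isMIntegralCurve_lieCurve v) (by
    rw [h.2.1, lieCurve_zero])

theorem IsOneParameterSubgroup.lieExp_eq {v : F} {c : ℝ → L} (h : IsOneParameterSubgroup v c) :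
    lieExp L v = c 1 := by
  have h' : ∃ c : ℝ → L, IsOneParameterSubgroup v c := ⟨c, h⟩
  rw [lieExp, dif_pos h', h'.choose_spec.eq_lieCurve, h.eq_lieCurve]

theorem lieExp_eq_lieCurve (v : F) : lieExp L v = lieCurve L v 1 :=
  (isOneParameterSubgroup_lieCurve v).lieExp_eq

theorem lieExp_smul (v : F) (t : ℝ) : lieExp L (t • v) = lieCurve L v t := by
  rw [lieExp_eq_lieCurve, ← lieCurve_eq_lieCurve_smul_one]

theorem lieExp_zero : lieExp L (0 : F) = 1 := by
  rw [← zero_smul ℝ (0 : F), lieExp_smul, lieCurve_zero]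

theorem contMDiffAt_lieExp_zero : ContMDiffAt 𝓘(ℝ, F) 𝓘(ℝ, F) ∞ (lieExp (F := F) L) 0 := by
  have : lieExp (F := F) L = fun v => lieCurve L v 1 := funext lieExp_eq_lieCurve
  rw [this]
  exact contMDiffAt_lieCurve_one

theorem lieExp_eq_pow (v : F) (n : ℕ) (hn : n ≠ 0) :
    lieExp L v = lieExp L ((n : ℝ)⁻¹ • v) ^ n := by
  have h : ∀ m : ℕ, lieCurve L ((n : ℝ)⁻¹ • v) m = lieExp L ((n : ℝ)⁻¹ • v) ^ m := by
    intro m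
    induction m with
    | zero => simp [lieCurve_zero]
    | succ m ih => rw [Nat.cast_succ, lieCurve_add, ih, pow_succ, ← lieExp_eq_lieCurve]
  rw [← h, lieCurve_smul, inv_mul_cancel₀ (by exact_mod_cast hn), lieExp_eq_lieCurve]

/-- Since `exp v = exp (v / n) ^ n`, regularity near `0` propagates to every `v` by taking `n`
large. -/
theorem contMDiff_lieExp : ContMDiff 𝓘(ℝ, F) 𝓘(ℝ, F) ∞ (lieExp (F := F) L) := by
  intro v
  rw [contMDiffAt_infty]
  intro m
  -- Regularity at a point spreads to a neighbourhood for each finite order; the neighbourhood, and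
  -- with it `n`, may depend on `m`.
  have h0 : ∀ᶠ w in 𝓝 (0 : F), ContMDiffAt 𝓘(ℝ, F) 𝓘(ℝ, F) m (lieExp (F := F) L) w :=
    (contMDiffAt_iff_contMDiffAt_nhds (by simp)).1
      (contMDiffAt_infty.1 (contMDiffAt_lieExp_zero (F := F) (L := L)) m)
  have h1 : Tendsto (fun n : ℕ => (n : ℝ)⁻¹ • v) atTop (𝓝 0) := by
    have := (tendsto_inv_atTop_nhds_zero_nat (𝕜 := ℝ)).smul_const v
    rwa [zero_smul] at this
  obtain ⟨n, hn, hn0⟩ := ((h1.eventually h0).and (eventually_ne_atTop 0)).exists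
  have h2 : lieExp (F := F) L = fun v => lieExp L ((n : ℝ)⁻¹ • v) ^ n :=
    funext fun v => lieExp_eq_pow v n hn0
  rw [h2]
  have h3 : ContMDiffAt 𝓘(ℝ, F) 𝓘(ℝ, F) m (fun v : F => (n : ℝ)⁻¹ • v) v :=
    (contDiff_const_smul _).contMDiff.contMDiffAt
  exact (contMDiff_pow n).contMDiffAt.comp v (ContMDiffAt.comp v hn h3)

/-- The exponential function restricts to a diffeomorphism between neighbourhoods of `0` and
`1`. -/
theorem exists_lieExp_inverse :
    ∃ (W : Set F) (W' : Set L) (log : L → F), IsOpen W ∧ IsOpen W' ∧ (0 : F) ∈ W ∧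
      MapsTo (lieExp L) W W' ∧ MapsTo log W' W ∧ (∀ v ∈ W, log (lieExp L v) = v) ∧
      (∀ g ∈ W', lieExp L (log g) = g) ∧ ContMDiffOn 𝓘(ℝ, F) 𝓘(ℝ, F) ∞ log W' := by
  set c := extChartAt 𝓘(ℝ, F) (1 : L) with hc
  set D : Set F := lieExp L ⁻¹' c.source with hD
  have hDo : IsOpen D := (isOpen_extChartAt_source _).preimage contMDiff_lieExp.continuous
  have h0D : (0 : F) ∈ D := by
    rw [hD, mem_preimage, lieExp_zero]
    exact mem_extChartAt_source _
  have hf : ContDiffOn ℝ ∞ (fun v => c (lieExp L v)) D := by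
    rw [← contMDiffOn_iff_contDiffOn]
    exact (contMDiffOn_extChartAt (I := 𝓘(ℝ, F)) (n := ∞) (x := (1 : L))).comp
      contMDiff_lieExp.contMDiffOn (fun v hv => by simpa [hD, hc] using hv)
  have hf0 := hf.contDiffAt (hDo.mem_nhds h0D)
  -- The derivative at `0` is tested on lines: `t ↦ exp (t v)` has velocity `v` at `0`, and the
  -- chart has identity derivative there, so the derivative is the identity.
  have hfd : HasFDerivAt (fun v => c (lieExp L v))
      ((ContinuousLinearEquiv.refl ℝ F : F ≃L[ℝ] F) : F →L[ℝ] F) 0 := by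
    have h1 := (hf0.differentiableAt (by simp)).hasFDerivAt
    convert h1 using 1
    refine ContinuousLinearMap.ext fun v => ?_
    have h2 : HasMFDerivAt 𝓘(ℝ, F) 𝓘(ℝ, F) c (lieCurve L v 0) (ContinuousLinearMap.id ℝ F) := by
      have := (mdifferentiableAt_extChartAt (I := 𝓘(ℝ, F))
        (mem_chart_source F (1 : L))).hasMFDerivAt
      rw [mfderiv_extChartAt_self] at this
      exact HasMFDerivAt.of_point_eq (f' := ContinuousLinearMap.id ℝ F) this (lieCurve_zero v).symm
    have h3 : HasMFDerivAt 𝓘(ℝ, ℝ) 𝓘(ℝ, F) (fun t => c (lieCurve L v t)) 0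
        ((ContinuousLinearMap.id ℝ F).comp ((1 : ℝ →L[ℝ] ℝ).smulRight v)) :=
      h2.comp (0 : ℝ) (hasMFDerivAt_lieCurve_zero (L := L) v)
    have h4 : HasFDerivAt (fun t : ℝ => t • v) ((1 : ℝ →L[ℝ] ℝ).smulRight v) 0 :=
      ((1 : ℝ →L[ℝ] ℝ).smulRight v).hasFDerivAt
    have h1' : HasFDerivAt (fun v => c (lieExp L v)) (fderiv ℝ (fun v => c (lieExp L v)) 0)
        ((0 : ℝ) • v) := by rwa [zero_smul]
    have h5 := h1'.comp (0 : ℝ) h4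
    have h6 : ((fun v => c (lieExp L v)) ∘ fun t : ℝ => t • v) = fun t => c (lieCurve L v t) := by
      funext t
      simp only [Function.comp_apply, lieExp_smul]
    rw [h6] at h5
    have h7 := h5.unique h3.hasFDerivAt
    have h8 := congrArg (fun T : ℝ →L[ℝ] F => T 1) h7
    have h9 : fderiv ℝ (fun v => c (lieExp L v)) 0 ((1 : ℝ) • v) = (1 : ℝ) • v := h8
    rw [one_smul] at h9
    exact h9.symm
  set e := hf0.toOpenPartialHomeomorph (fun v => c (lieExp L v)) hfd (by simp) with he
  have hecoe : ∀ v, e v = c (lieExp L v) := fun v => rfl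
  have h0e : (0 : F) ∈ e.source := hf0.mem_toOpenPartialHomeomorph_source hfd (by simp)
  -- The inverse function theorem gives smoothness of the inverse only where the derivative is
  -- invertible, hence the restriction to this open set.
  set N : Set F := {v ∈ D | (fderiv ℝ (fun v => c (lieExp L v)) v).IsInvertible} with hN
  have hNo : IsOpen N := by
    have h1 : ContinuousOn (fderiv ℝ (fun v => c (lieExp L v))) D :=
      hf.continuousOn_fderiv_of_isOpen hDo (by simp)
    exact h1.isOpen_inter_preimage hDo (t := Set.range ((↑) : (F ≃L[ℝ] F) → F →L[ℝ] F))
      (ContinuousLinearEquiv.isOpen)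
  have h0N : (0 : F) ∈ N := ⟨h0D, ⟨ContinuousLinearEquiv.refl ℝ F, hfd.fderiv.symm⟩⟩
  set W := e.source ∩ N with hW
  have hWo : IsOpen W := e.open_source.inter hNo
  have hTo : IsOpen (e '' W) := e.isOpen_image_of_subset_source hWo inter_subset_left
  have hco : IsOpen (c.source ∩ c ⁻¹' (e '' W)) :=
    (continuousOn_extChartAt (I := 𝓘(ℝ, F)) (1 : L)).isOpen_inter_preimage
      (isOpen_extChartAt_source _) hTo
  have hlogW : ∀ g ∈ c.source ∩ c ⁻¹' (e '' W), e.symm (c g) ∈ W := by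
    rintro g ⟨-, w, hw, hwg⟩
    rw [← hwg, e.left_inv hw.1]
    exact hw
  refine ⟨W, c.source ∩ c ⁻¹' (e '' W), fun g => e.symm (c g), hWo, hco, ⟨h0e, h0N⟩, ?_, hlogW,
    ?_, ?_, ?_⟩
  · exact fun v hv => ⟨hv.2.1, v, hv, hecoe v⟩
  · intro v hv
    exact e.left_inv hv.1
  · intro g hg
    have hw := hlogW g hg
    have h1 : c (lieExp L (e.symm (c g))) = c g := by
      rw [← hecoe]
      obtain ⟨-, w, hw, hwg⟩ := hg
      exact e.right_inv (hwg ▸ e.map_source hw.1)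
    exact c.injOn hw.2.1 hg.1 h1
  · have h1 : ContDiffOn ℝ ∞ e.symm (e '' W) := by
      rintro - ⟨w, hw, rfl⟩
      obtain ⟨T, hT⟩ := hw.2.2
      refine (e.contDiffAt_symm (f₀' := T) (e.map_source hw.1) ?_ ?_).contDiffWithinAt
      · rw [e.left_inv hw.1, hT]
        exact ((hf.contDiffAt (hDo.mem_nhds hw.2.1)).differentiableAt (by simp)).hasFDerivAt
      · rw [e.left_inv hw.1]
        exact hf.contDiffAt (hDo.mem_nhds hw.2.1)
    exact h1.contMDiffOn.comp ((contMDiffOn_extChartAt (I := 𝓘(ℝ, F)) (n := ∞)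
      (x := (1 : L))).mono fun g hg => by simpa [hc] using hg.1) fun g hg => hg.2

/-- The exponential function is natural with respect to smooth homomorphisms. -/
theorem map_lieExp {F' L' : Type*} [NormedAddCommGroup F'] [NormedSpace ℝ F'] [CompleteSpace F']
    [TopologicalSpace L'] [ChartedSpace F' L'] [Group L'] [LieGroup 𝓘(ℝ, F') ∞ L']
    {θ : L → L'} (hθ : ContMDiff 𝓘(ℝ, F) 𝓘(ℝ, F') ∞ θ) (hmul : ∀ x y, θ (x * y) = θ x * θ y)
    (v : F) :
    θ (lieExp L v) = lieExp (F := F') L' ((mfderiv 𝓘(ℝ, F) 𝓘(ℝ, F') θ 1 : F →L[ℝ] F') v) := by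
  have h1 : θ 1 = 1 := by
    have := hmul 1 1
    simpa using this
  have hone : IsOneParameterSubgroup (F := F') ((mfderiv 𝓘(ℝ, F) 𝓘(ℝ, F') θ 1 : F →L[ℝ] F') v)
      (fun t => θ (lieCurve L v t)) := by
    refine ⟨hθ.comp (contMDiff_lieCurve v), by simp only [lieCurve_zero, h1], fun s t => by
      simp only [lieCurve_add, hmul], ?_⟩
    have h2 : HasMFDerivAt 𝓘(ℝ, F) 𝓘(ℝ, F') θ (lieCurve L v 0)
        (mfderiv 𝓘(ℝ, F) 𝓘(ℝ, F') θ 1 : F →L[ℝ] F') :=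
      (hθ.contMDiffAt.mdifferentiableAt (by simp)).hasMFDerivAt.of_point_eq
        (lieCurve_zero (L := L) v).symm
    have h3 := (h2.comp (0 : ℝ) (hasMFDerivAt_lieCurve_zero (L := L) v)).mfderiv
    have h4 : (mfderiv 𝓘(ℝ, ℝ) 𝓘(ℝ, F') (fun t => θ (lieCurve L v t)) 0 : ℝ →L[ℝ] F') =
        ((mfderiv 𝓘(ℝ, F) 𝓘(ℝ, F') θ 1 : F →L[ℝ] F').comp
          ((1 : ℝ →L[ℝ] ℝ).smulRight v) : ℝ →L[ℝ] F') := h3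
    rw [h4]
    exact congrArg (mfderiv 𝓘(ℝ, F) 𝓘(ℝ, F') θ 1 : F →L[ℝ] F') (one_smul ℝ v)
  rw [hone.lieExp_eq, lieExp_eq_lieCurve]

end LieExpSmooth

/-! ## Iterated tangent maps -/

/-- Points over different base points are separated in the base, points over the same one in a
trivialization. It makes the iterated tangent bundles Hausdorff, as is needed when compact sets are
cut into compact pieces. -/
theorem t2Space_totalSpace {B F : Type*} [TopologicalSpace B] [TopologicalSpace F] {V : B → Type*}
    [TopologicalSpace (Bundle.TotalSpace F V)] [∀ b, TopologicalSpace (V b)] [FiberBundle F V]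
    [T2Space B] [T2Space F] : T2Space (Bundle.TotalSpace F V) := by
  refine ⟨fun w w' hne => ?_⟩
  by_cases hb : w.proj = w'.proj
  · set e := trivializationAt F V w.proj with he
    have hw : w ∈ e.source := by
      rw [e.mem_source]; exact mem_baseSet_trivializationAt F V w.proj
    have hw' : w' ∈ e.source := by
      rw [e.mem_source, ← hb]; exact mem_baseSet_trivializationAt F V w.proj
    have hne' : e w ≠ e w' := fun h => hne (e.injOn hw hw' h)
    obtain ⟨u, v, hu, hv, hwu, hwv, huv⟩ := t2_separation hne'
    refine ⟨e.source ∩ e ⁻¹' u, e.source ∩ e ⁻¹' v,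
      e.continuousOn.isOpen_inter_preimage e.open_source hu,
      e.continuousOn.isOpen_inter_preimage e.open_source hv, ⟨hw, hwu⟩, ⟨hw', hwv⟩, ?_⟩
    exact disjoint_left.2 fun x hx hx' => disjoint_left.1 huv hx.2 hx'.2
  · obtain ⟨u, v, hu, hv, hwu, hwv, huv⟩ := t2_separation hb
    have hc := FiberBundle.continuous_proj F V
    exact ⟨_, _, hu.preimage hc, hv.preimage hc, hwu, hwv, huv.preimage _⟩

section TangentMap

variable {E H M E' H' M' : Type*} [NormedAddCommGroup E] [NormedSpace ℝ E] [TopologicalSpace H]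
  [TopologicalSpace M] [ChartedSpace H M] {I : ModelWithCorners ℝ E H}
  [NormedAddCommGroup E'] [NormedSpace ℝ E'] [TopologicalSpace H']
  [TopologicalSpace M'] [ChartedSpace H' M'] {I' : ModelWithCorners ℝ E' H'}

theorem tangentMap_congr_of_eventuallyEq {f g : M → M'} {w : TangentBundle I M}
    (h : f =ᶠ[𝓝 w.proj] g) : tangentMap I I' f w = tangentMap I I' g w := by
  have h1 : f w.proj = g w.proj := h.self_of_nhds
  have h2 := h.mfderiv_eq (I := I) (I' := I')
  refine Bundle.TotalSpace.ext h1 (heq_of_eq ?_)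
  exact congrArg (fun T : E →L[ℝ] E' => T w.snd) h2

theorem ContMDiffOn.contMDiffOn_tangentMap_of_isOpen [IsManifold I ∞ M] [IsManifold I' ∞ M']
    {f : M → M'} {s : Set M} (hs : IsOpen s) (hf : ContMDiffOn I I' ∞ f s) :
    ContMDiffOn I.tangent I'.tangent ∞ (tangentMap I I' f) (Bundle.TotalSpace.proj ⁻¹' s) := by
  refine (hf.contMDiffOn_tangentMapWithin (m := ∞) (by simp) hs.uniqueMDiffOn).congr ?_
  intro w hw
  exact (tangentMapWithin_eq_tangentMap (hs.uniqueMDiffOn _ hw)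
    ((hf.contMDiffAt (hs.mem_nhds hw)).mdifferentiableAt (by simp))).symm

end TangentMap

namespace BundledManifold

/-- The projection `Tⁿ X → X`. -/
def iterProj (X : BundledManifold.{u}) : (n : ℕ) → (X.iterTangent n).M → X.M
  | 0 => id
  | n + 1 => fun w => iterProj X n (Bundle.TotalSpace.proj w)

theorem continuous_iterProj (X : BundledManifold.{u}) (n : ℕ) : Continuous (X.iterProj n) := by
  induction n with
  | zero => exact continuous_id
  | succ n ih =>
    exact ih.comp (FiberBundle.continuous_proj (X.iterTangent n).E
      (TangentSpace (X.iterTangent n).I (M := (X.iterTangent n).M)))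

theorem t2Space_iterTangent (X : BundledManifold.{u}) [T2Space X.M] (n : ℕ) :
    T2Space (X.iterTangent n).M := by
  induction n with
  | zero => assumption
  | succ n ih =>
    exact t2Space_totalSpace (F := (X.iterTangent n).E)
      (V := (TangentSpace (X.iterTangent n).I (M := (X.iterTangent n).M)))

variable {X : BundledManifold.{u}} {Y : BundledManifold.{v}} {Z : BundledManifold.{u₁}}

theorem iterProj_iterTangentMap (f : X.M → Y.M) (n : ℕ) (w : (X.iterTangent n).M) :
    Y.iterProj n (iterTangentMap f n w) = f (X.iterProj n w) := by
  induction n with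
  | zero => rfl
  | succ n ih => exact ih _

theorem contMDiffOn_iterTangentMap {f : X.M → Y.M} {s : Set X.M} (hs : IsOpen s)
    (hf : ContMDiffOn X.I Y.I ∞ f s) (n : ℕ) :
    ContMDiffOn (X.iterTangent n).I (Y.iterTangent n).I ∞ (iterTangentMap f n)
      (X.iterProj n ⁻¹' s) := by
  induction n with
  | zero => exact hf
  | succ n ih =>
    exact ih.contMDiffOn_tangentMap_of_isOpen (hs.preimage (X.continuous_iterProj n))

/-- Functoriality of `Tⁿ`, localized to open sets because fibrewise logarithms and local sections
are only smooth there. The induction needs equality near the base point, not just at it. -/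
theorem iterTangentMap_comp {f : X.M → Y.M} {g : Y.M → Z.M} {s : Set X.M} {t : Set Y.M}
    (hs : IsOpen s) (ht : IsOpen t) (hf : ContMDiffOn X.I Y.I ∞ f s)
    (hg : ContMDiffOn Y.I Z.I ∞ g t) (hst : MapsTo f s t) (n : ℕ) (w : (X.iterTangent n).M)
    (hw : X.iterProj n w ∈ s) :
    iterTangentMap (X := X) (Y := Z) (fun x => g (f x)) n w =
      iterTangentMap (X := Y) (Y := Z) g n (iterTangentMap f n w) := by
  induction n with
  | zero => rfl
  | succ n ih =>
    have hs' := hs.preimage (X.continuous_iterProj n)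
    have ht' := ht.preimage (Y.continuous_iterProj n)
    have hf' := ((contMDiffOn_iterTangentMap hs hf n).contMDiffAt
      (hs'.mem_nhds hw)).mdifferentiableAt (by simp)
    have hmem : Y.iterProj n (iterTangentMap f n w.proj) ∈ t := by
      rw [iterProj_iterTangentMap]; exact hst hw
    have hg' := ((contMDiffOn_iterTangentMap ht hg n).contMDiffAt
      (ht'.mem_nhds hmem)).mdifferentiableAt (by simp)
    refine (tangentMap_congr_of_eventuallyEq ?_).trans (tangentMap_comp_at w hg' hf')
    filter_upwards [hs'.mem_nhds hw] with w' hw'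
    exact ih w' hw'

theorem iterTangentMap_congr {f g : X.M → Y.M} {s : Set X.M} (hs : IsOpen s) (h : EqOn f g s)
    (n : ℕ) (w : (X.iterTangent n).M) (hw : X.iterProj n w ∈ s) :
    iterTangentMap (X := X) (Y := Y) f n w = iterTangentMap g n w := by
  induction n with
  | zero => exact h hw
  | succ n ih =>
    refine tangentMap_congr_of_eventuallyEq ?_
    filter_upwards [(hs.preimage (X.continuous_iterProj n)).mem_nhds hw] with w' hw'
    exact ih w' hw'

/-- The product of two manifolds. -/
def prod (X : BundledManifold.{u}) (Y : BundledManifold.{v}) : BundledManifold.{max u v} where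
  E := X.E × Y.E
  H := ModelProd X.H Y.H
  M := X.M × Y.M
  I := X.I.prod Y.I

/-- The canonical map `Tⁿ X × Tⁿ Y → Tⁿ (X × Y)`. -/
def iterPair (X : BundledManifold.{u}) (Y : BundledManifold.{v}) :
    (n : ℕ) → (X.iterTangent n).M × (Y.iterTangent n).M → ((X.prod Y).iterTangent n).M
  | 0 => id
  | n + 1 => fun w =>
    tangentMap ((X.iterTangent n).I.prod (Y.iterTangent n).I) ((X.prod Y).iterTangent n).I
      (iterPair X Y n)
      ((equivTangentBundleProd (X.iterTangent n).I (X.iterTangent n).M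
        (Y.iterTangent n).I (Y.iterTangent n).M).symm w)

theorem contMDiff_iterPair (n : ℕ) :
    ContMDiff ((X.iterTangent n).I.prod (Y.iterTangent n).I) ((X.prod Y).iterTangent n).I ∞
      (iterPair X Y n) := by
  induction n with
  | zero => exact contMDiff_id
  | succ n ih =>
    exact (ih.contMDiff_tangentMap (m := ∞) (by simp)).comp
      (contMDiff_equivTangentBundleProd_symm (n := ∞))

/-- `Tⁿ (f, g)` factors through the fixed smooth map `iterPair`. Only continuity of that map is
needed to pass convergence to pairs, not its invertibility. -/
theorem iterTangentMap_prodMk {f : Z.M → X.M} {g : Z.M → Y.M} {s : Set Z.M} (hs : IsOpen s)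
    (hf : ContMDiffOn Z.I X.I ∞ f s) (hg : ContMDiffOn Z.I Y.I ∞ g s) (n : ℕ)
    (w : (Z.iterTangent n).M) (hw : Z.iterProj n w ∈ s) :
    iterTangentMap (X := Z) (Y := X.prod Y) (fun x => (f x, g x)) n w =
      iterPair X Y n (iterTangentMap f n w, iterTangentMap g n w) := by
  induction n with
  | zero => rfl
  | succ n ih =>
    have hs' := hs.preimage (Z.continuous_iterProj n)
    have hf' := ((contMDiffOn_iterTangentMap hs hf n).contMDiffAt
      (hs'.mem_nhds hw)).mdifferentiableAt (by simp)
    have hg' := ((contMDiffOn_iterTangentMap hs hg n).contMDiffAt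
      (hs'.mem_nhds hw)).mdifferentiableAt (by simp)
    have hp : MDifferentiableAt ((X.iterTangent n).I.prod (Y.iterTangent n).I)
        ((X.prod Y).iterTangent n).I (iterPair X Y n)
        (iterTangentMap f n w.proj, iterTangentMap g n w.proj) :=
      contMDiff_iterPair n |>.contMDiffAt.mdifferentiableAt (by simp)
    refine (tangentMap_congr_of_eventuallyEq ?_).trans
      ((tangentMap_comp_at (f := fun w => (iterTangentMap f n w, iterTangentMap g n w))
        (I' := (X.iterTangent n).I.prod (Y.iterTangent n).I) w hp (hf'.prodMk hg')).trans ?_)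
    · filter_upwards [hs'.mem_nhds hw] with w' hw'
      exact ih w' hw'
    · refine congrArg (tangentMap ((X.iterTangent n).I.prod (Y.iterTangent n).I)
        ((X.prod Y).iterTangent n).I (iterPair X Y n)) ?_
      refine Bundle.TotalSpace.ext rfl (heq_of_eq ?_)
      simp only [tangentMap]
      rw [mfderiv_prodMk hf' hg']
      rfl

end BundledManifold

/-! ## Convergence in the `C^∞`-topology -/

namespace BundledManifold

variable {X : BundledManifold.{u}} {Y : BundledManifold.{v}} {Z : BundledManifold.{u₁}}

/-- Convergence of all iterated tangent maps, uniformly (in the compact-open sense) on the compact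
subsets of the iterated tangent bundles over `S`. -/
def SmTendsto (X : BundledManifold.{u}) (Y : BundledManifold.{v}) {A : Type*} (S : Set X.M)
    (F : A → X.M → Y.M) (l : Filter A) (f : X.M → Y.M) : Prop :=
  ∀ (n : ℕ) (K : Set (X.iterTangent n).M), IsCompact K → K ⊆ X.iterProj n ⁻¹' S →
    ∀ U : Set (Y.iterTangent n).M, IsOpen U → MapsTo (iterTangentMap f n) K U →
      ∀ᶠ a in l, MapsTo (iterTangentMap (X := X) (Y := Y) (F a) n) K U

variable {A : Type*} {S : Set X.M} {F : A → X.M → Y.M} {l : Filter A} {f : X.M → Y.M}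

theorem SmTendsto.mono_left {l' : Filter A} (h : SmTendsto X Y S F l f) (hl : l' ≤ l) :
    SmTendsto X Y S F l' f :=
  fun n K hK hKS U hU hm => hl (h n K hK hKS U hU hm)

theorem SmTendsto.comp_tendsto {B : Type*} {l' : Filter B} {φ : B → A}
    (h : SmTendsto X Y S F l f) (hφ : Tendsto φ l' l) :
    SmTendsto X Y S (fun b => F (φ b)) l' f :=
  fun n K hK hKS U hU hm => hφ.eventually (h n K hK hKS U hU hm)

theorem smTendsto_const : SmTendsto X Y S (fun _ : A => f) l f :=
  fun _ _ _ _ _ _ hm => Eventually.of_forall fun _ => hm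

theorem SmTendsto.congr {N : Set X.M} (hN : IsOpen N) (hSN : S ⊆ N) {F' : A → X.M → Y.M}
    {f' : X.M → Y.M} (h : SmTendsto X Y S F l f) (hF : ∀ᶠ a in l, EqOn (F' a) (F a) N)
    (hf : EqOn f' f N) : SmTendsto X Y S F' l f' := by
  intro n K hK hKS U hU hm
  have h1 : MapsTo (iterTangentMap (X := X) (Y := Y) f n) K U := fun w hw => by
    rw [← iterTangentMap_congr hN hf n w (hSN (hKS hw))]
    exact hm hw
  filter_upwards [h n K hK hKS U hU h1, hF] with a ha hFa w hw
  rw [iterTangentMap_congr hN hFa n w (hSN (hKS hw))]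
  exact ha hw

/-- Post-composition with a smooth map. -/
theorem SmTendsto.comp_left {N : Set X.M} {O : Set Y.M} {φ : Y.M → Z.M}
    (h : SmTendsto X Y S F l f) (hN : IsOpen N) (hSN : S ⊆ N) (hO : IsOpen O)
    (hφ : ContMDiffOn Y.I Z.I ∞ φ O) (hF : ∀ᶠ a in l, ContMDiffOn X.I Y.I ∞ (F a) N)
    (hf : ContMDiffOn X.I Y.I ∞ f N) (hFO : ∀ᶠ a in l, MapsTo (F a) N O) (hfO : MapsTo f N O) :
    SmTendsto X Z S (fun a x => φ (F a x)) l (fun x => φ (f x)) := by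
  intro n K hK hKS U hU hm
  have hO' : IsOpen (Y.iterProj n ⁻¹' O ∩ iterTangentMap (X := Y) (Y := Z) φ n ⁻¹' U) :=
    (contMDiffOn_iterTangentMap hO hφ n).continuousOn.isOpen_inter_preimage
      (hO.preimage (Y.continuous_iterProj n)) hU
  have h1 : MapsTo (iterTangentMap f n) K
      (Y.iterProj n ⁻¹' O ∩ iterTangentMap (X := Y) (Y := Z) φ n ⁻¹' U) := fun w hw => by
    refine ⟨?_, ?_⟩
    · rw [mem_preimage, iterProj_iterTangentMap]
      exact hfO (hSN (hKS hw))
    · rw [mem_preimage, ← iterTangentMap_comp hN hO hf hφ hfO n w (hSN (hKS hw))]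
      exact hm hw
  filter_upwards [h n K hK hKS _ hO' h1, hF, hFO] with a ha hFa hFOa w hw
  rw [iterTangentMap_comp hN hO hFa hφ hFOa n w (hSN (hKS hw))]
  exact (ha hw).2

/-- Pre-composition with a smooth map. -/
theorem SmTendsto.comp_right {N : Set X.M} {N' S' : Set Z.M} {s : Z.M → X.M}
    (h : SmTendsto X Y S F l f) (hN : IsOpen N) (hN' : IsOpen N')
    (hSN' : S' ⊆ N') (hs : ContMDiffOn Z.I X.I ∞ s N') (hF : ∀ᶠ a in l, ContMDiffOn X.I Y.I ∞ (F a) N)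
    (hf : ContMDiffOn X.I Y.I ∞ f N) (hsN : MapsTo s N' N) (hsS : MapsTo s S' S) :
    SmTendsto Z Y S' (fun a x => F a (s x)) l (fun x => f (s x)) := by
  intro n K hK hKS U hU hm
  have h1 : IsCompact (iterTangentMap (X := Z) (Y := X) s n '' K) :=
    hK.image_of_continuousOn ((contMDiffOn_iterTangentMap hN' hs n).continuousOn.mono
      fun w hw => hSN' (hKS hw))
  have h2 : iterTangentMap (X := Z) (Y := X) s n '' K ⊆ X.iterProj n ⁻¹' S := by
    rintro - ⟨w, hw, rfl⟩
    rw [mem_preimage, iterProj_iterTangentMap]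
    exact hsS (hKS hw)
  have h3 : MapsTo (iterTangentMap f n) (iterTangentMap (X := Z) (Y := X) s n '' K) U := by
    rintro - ⟨w, hw, rfl⟩
    rw [← iterTangentMap_comp hN' hN hs hf hsN n w (hSN' (hKS hw))]
    exact hm hw
  filter_upwards [h n _ h1 h2 U hU h3, hF] with a ha hFa w hw
  rw [iterTangentMap_comp hN' hN hs hFa hsN n w (hSN' (hKS hw))]
  exact ha (mem_image_of_mem _ hw)

/-- Pairs of convergent families converge. -/
theorem SmTendsto.prodMk [T2Space X.M] {N : Set X.M} {G : A → X.M → Z.M} {g : X.M → Z.M}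
    (h : SmTendsto X Y S F l f) (h' : SmTendsto X Z S G l g) (hN : IsOpen N) (hSN : S ⊆ N)
    (hF : ∀ᶠ a in l, ContMDiffOn X.I Y.I ∞ (F a) N) (hf : ContMDiffOn X.I Y.I ∞ f N)
    (hG : ∀ᶠ a in l, ContMDiffOn X.I Z.I ∞ (G a) N) (hg : ContMDiffOn X.I Z.I ∞ g N) :
    SmTendsto X (Y.prod Z) S (fun a x => (F a x, G a x)) l (fun x => (f x, g x)) := by
  intro n K hK hKS U hU hm
  haveI := X.t2Space_iterTangent n
  have hU' : IsOpen (iterPair Y Z n ⁻¹' U) := hU.preimage (contMDiff_iterPair n).continuous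
  have hN' := hN.preimage (X.continuous_iterProj n)
  have h1 : ∀ w ∈ K, ∃ (u : Set (Y.iterTangent n).M) (v : Set (Z.iterTangent n).M), IsOpen u ∧
      IsOpen v ∧ iterTangentMap f n w ∈ u ∧ iterTangentMap g n w ∈ v ∧
      u ×ˢ v ⊆ iterPair Y Z n ⁻¹' U := fun w hw => by
    refine isOpen_prod_iff.1 hU' _ _ ?_
    rw [mem_preimage, ← iterTangentMap_prodMk hN hf hg n w (hSN (hKS hw))]
    exact hm hw
  choose! u v hu hv hfu hgv huv using h1
  let V : (X.iterTangent n).M → Set (X.iterTangent n).M := fun w =>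
    (X.iterProj n ⁻¹' N ∩ iterTangentMap f n ⁻¹' u w) ∩
      (X.iterProj n ⁻¹' N ∩ iterTangentMap g n ⁻¹' v w)
  have hVo : ∀ w ∈ K, IsOpen (V w) := fun w hw =>
    ((contMDiffOn_iterTangentMap hN hf n).continuousOn.isOpen_inter_preimage hN' (hu w hw)).inter
      ((contMDiffOn_iterTangentMap hN hg n).continuousOn.isOpen_inter_preimage hN' (hv w hw))
  obtain ⟨t, hKt⟩ := hK.elim_nhds_subcover' (fun w _ => V w) (fun w hw =>
    (hVo w hw).mem_nhds ⟨⟨hSN (hKS hw), hfu w hw⟩, ⟨hSN (hKS hw), hgv w hw⟩⟩)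
  -- The compact set is cut into finitely many compact pieces, on each of which both tangent maps
  -- land in the two factors of a single open box inside the given open set.
  obtain ⟨C, hC, hCV, hKC⟩ := hK.finite_compact_cover t (fun w => V w)
    (fun w _ => hVo w w.2) hKt
  have h2 : ∀ w ∈ t, ∀ᶠ a in l, MapsTo (iterTangentMap (X := X) (Y := Y) (F a) n) (C w) (u w) ∧
      MapsTo (iterTangentMap (X := X) (Y := Z) (G a) n) (C w) (v w) := fun w hw => by
    have hCK : C w ⊆ X.iterProj n ⁻¹' S := fun x hx =>
      hKS (hKC.symm ▸ mem_biUnion hw hx)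
    exact (h n _ (hC w) hCK _ (hu w w.2) fun x hx => (hCV w hx).1.2).and
      (h' n _ (hC w) hCK _ (hv w w.2) fun x hx => (hCV w hx).2.2)
  filter_upwards [(Filter.eventually_all_finset t).2 h2, hF, hG] with a ha hFa hGa w hw
  rw [iterTangentMap_prodMk hN hFa hGa n w (hSN (hKS hw))]
  rw [hKC] at hw
  obtain ⟨i, hi, hwi⟩ := mem_iUnion₂.1 hw
  exact huv i i.2 ⟨(ha i hi).1 hwi, (ha i hi).2 hwi⟩

/-- Convergence can be checked on the members of a finite closed cover. -/
theorem SmTendsto.of_finite_cover {κ : Type*} [Finite κ] {C : κ → Set X.M}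
    (hC : ∀ i, IsClosed (C i)) (hS : S ⊆ ⋃ i, C i) (h : ∀ i, SmTendsto X Y (C i) F l f) :
    SmTendsto X Y S F l f := by
  intro n K hK hKS U hU hm
  have h1 : ∀ i, ∀ᶠ a in l, MapsTo (iterTangentMap (X := X) (Y := Y) (F a) n)
      (K ∩ X.iterProj n ⁻¹' C i) U := fun i =>
    h i n _ (hK.inter_right ((hC i).preimage (X.continuous_iterProj n))) inter_subset_right U hU
      (hm.mono_left inter_subset_left)
  filter_upwards [Filter.eventually_all.2 h1] with a ha w hw
  obtain ⟨i, hi⟩ := mem_iUnion.1 (hS (hKS hw))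
  exact ha i ⟨hw, hi⟩

/-- The iterated zero section. -/
def iterZero (Y : BundledManifold.{v}) : (n : ℕ) → Y.M → (Y.iterTangent n).M
  | 0 => id
  | n + 1 => fun y => (⟨iterZero Y n y, 0⟩ :
      TangentBundle (Y.iterTangent n).I (Y.iterTangent n).M)

theorem continuous_iterZero (n : ℕ) : Continuous (iterZero Y n) := by
  induction n with
  | zero => exact continuous_id
  | succ n ih =>
    have h : ContMDiff (Y.iterTangent n).I (Y.iterTangent n).I.tangent ∞
        (Bundle.zeroSection (Y.iterTangent n).E
          (TangentSpace (Y.iterTangent n).I : (Y.iterTangent n).M → Type _)) :=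
      Bundle.contMDiff_zeroSection ℝ _
    exact h.continuous.comp ih

theorem iterTangentMap_const (y : Y.M) (n : ℕ) (w : (X.iterTangent n).M) :
    iterTangentMap (X := X) (Y := Y) (fun _ => y) n w = iterZero Y n y := by
  induction n with
  | zero => rfl
  | succ n ih =>
    refine (tangentMap_congr_of_eventuallyEq
      (Eventually.of_forall (f := 𝓝 w.proj) (p := fun w' =>
        iterTangentMap (X := X) (Y := Y) (fun _ => y) n w' = iterZero Y n y)
        fun w' => ih w')).trans ?_
    refine Bundle.TotalSpace.ext rfl (heq_of_eq ?_)
    simp only [tangentMap, mfderiv_const]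
    rfl

/-- Constant maps depend continuously on their value. -/
theorem smTendsto_const_of_tendsto {c : A → Y.M} {y : Y.M} (h : Tendsto c l (𝓝 y)) :
    SmTendsto X Y S (fun a _ => c a) l (fun _ => y) := by
  intro n K hK hKS U hU hm
  rcases K.eq_empty_or_nonempty with rfl | ⟨w, hw⟩
  · exact Eventually.of_forall fun a => mapsTo_empty _ _
  · have h1 : iterZero Y n y ∈ U := by
      rw [← iterTangentMap_const (X := X) y n w]
      exact hm hw
    filter_upwards [h.eventually ((hU.preimage (continuous_iterZero n)).mem_nhds h1)]
      with a ha w' _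
    rw [iterTangentMap_const]
    exact ha

theorem SmTendsto.tendsto_apply (h : SmTendsto X Y S F l f) {x : X.M} (hx : x ∈ S) :
    Tendsto (fun a => F a x) l (𝓝 (f x)) := by
  rw [tendsto_nhds]
  intro U hU hxU
  filter_upwards [h 0 {x} isCompact_singleton (singleton_subset_iff.2 hx) U hU
    (fun _ hy => by rw [mem_singleton_iff.1 hy]; exact hxU)] with a ha
  exact ha rfl

end BundledManifold

section SmoothMapTopology

variable {E N : Type u} [NormedAddCommGroup E] [NormedSpace ℝ E]
  [TopologicalSpace N] [ChartedSpace E N] [IsManifold 𝓘(ℝ, E) ∞ N]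
  {F L : Type v} [NormedAddCommGroup F] [NormedSpace ℝ F]
  [TopologicalSpace L] [ChartedSpace F L] [IsManifold 𝓘(ℝ, F) ∞ L]

/-- The bundled form of a manifold modelled on a normed space. -/
abbrev bundle (E N : Type u) [NormedAddCommGroup E] [NormedSpace ℝ E]
    [TopologicalSpace N] [ChartedSpace E N] [IsManifold 𝓘(ℝ, E) ∞ N] : BundledManifold.{u} :=
  ⟨E, E, N, 𝓘(ℝ, E)⟩

open BundledManifold in
-- The bridge between the `C^∞`-topology and `SmTendsto`; later continuity proofs use the stability
-- properties of `SmTendsto` and never return to subbasic sets.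
theorem tendsto_smoothMap_iff {A : Type*} {l : Filter A} {φ : A → C^∞⟮𝓘(ℝ, E), N; 𝓘(ℝ, F), L⟯}
    {f : C^∞⟮𝓘(ℝ, E), N; 𝓘(ℝ, F), L⟯} :
    Tendsto φ l (𝓝 f) ↔
      SmTendsto (bundle E N) (bundle F L) univ (fun a => φ a) l f := by
  rw [nhds_iInf, tendsto_iInf]
  refine forall_congr' fun n => ?_
  rw [nhds_induced, tendsto_comap_iff, ContinuousMap.tendsto_nhds_compactOpen]
  exact ⟨fun h K hK _ U hU hm => h K hK U hU hm, fun h K hK U hU hm =>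
    h K hK (subset_univ _) U hU hm⟩

end SmoothMapTopology

/-! ## Fibrewise difference quotients -/

section FibreHadamard

variable {EP P : Type*} [NormedAddCommGroup EP] [NormedSpace ℝ EP] [TopologicalSpace P]
  [ChartedSpace EP P] [IsManifold 𝓘(ℝ, EP) ∞ P]
  {F : Type*} [NormedAddCommGroup F] [NormedSpace ℝ F]
  {F' : Type*} [NormedAddCommGroup F'] [NormedSpace ℝ F'] [CompleteSpace F']

/-- `hadamard` in the second variable. -/
def fibreHadamard (φ : P × F → F') (z : P × (F × F × ℝ)) : F' :=
  hadamard (fun v => φ (z.1, v)) z.2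

/-- The domain of `fibreHadamard`. -/
def fibreHadamardDomain (Ω : Set (P × F)) : Set (P × (F × F × ℝ)) :=
  {z | ∀ t ∈ Icc (0 : ℝ) 1, (z.1, z.2.1 + t • z.2.2.2 • z.2.2.1) ∈ Ω}

variable {φ : P × F → F'} {Ω : Set (P × F)}

theorem isOpen_fibreHadamardDomain (hΩ : IsOpen Ω) : IsOpen (fibreHadamardDomain Ω) := by
  rw [isOpen_iff_mem_nhds]
  intro z hz
  refine isCompact_Icc.eventually_forall_of_forall_eventually fun t ht => ?_
  have hc : Continuous fun y : (P × (F × F × ℝ)) × ℝ =>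
      (y.1.1, y.1.2.1 + y.2 • y.1.2.2.2 • y.1.2.2.1) := by fun_prop
  exact hc.continuousAt.eventually (hΩ.mem_nhds (hz t ht))

theorem contDiffOn_fibre (hφ : ContMDiffOn (𝓘(ℝ, EP).prod 𝓘(ℝ, F)) 𝓘(ℝ, F') ∞ φ Ω) (p : P) :
    ContDiffOn ℝ ∞ (fun v => φ (p, v)) {v | (p, v) ∈ Ω} := by
  rw [← contMDiffOn_iff_contDiffOn]
  exact hφ.comp (contMDiff_const.prodMk contMDiff_id).contMDiffOn fun v hv => hv

theorem isOpen_fibre (hΩ : IsOpen Ω) (p : P) : IsOpen {v | (p, v) ∈ Ω} :=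
  hΩ.preimage (by fun_prop : Continuous fun v : F => (p, v))

theorem smul_fibreHadamard (hΩ : IsOpen Ω)
    (hφ : ContMDiffOn (𝓘(ℝ, EP).prod 𝓘(ℝ, F)) 𝓘(ℝ, F') ∞ φ Ω) {z : P × (F × F × ℝ)}
    (hz : z ∈ fibreHadamardDomain Ω) :
    z.2.2.2 • fibreHadamard φ z = φ (z.1, z.2.1 + z.2.2.2 • z.2.2.1) - φ (z.1, z.2.1) :=
  smul_hadamard (isOpen_fibre hΩ z.1) (contDiffOn_fibre hφ z.1) hz

theorem fibreHadamard_zero (p : P) (v w : F) :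
    fibreHadamard φ (p, (v, w, 0)) = fderiv ℝ (fun v => φ (p, v)) v w :=
  hadamard_zero _ _ _

/-- In a chart of `P` the fibrewise quotient becomes the ordinary `hadamard` of a function on `EP ×
F` in the direction `(0, w)`, so the case of normed spaces applies. -/
theorem contMDiffOn_fibreHadamard (hΩ : IsOpen Ω)
    (hφ : ContMDiffOn (𝓘(ℝ, EP).prod 𝓘(ℝ, F)) 𝓘(ℝ, F') ∞ φ Ω) :
    ContMDiffOn (𝓘(ℝ, EP).prod 𝓘(ℝ, F × F × ℝ)) 𝓘(ℝ, F') ∞ (fibreHadamard φ)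
      (fibreHadamardDomain Ω) := by
  intro z₀ hz₀
  refine ContMDiffAt.contMDiffWithinAt ?_
  set c := extChartAt 𝓘(ℝ, EP) z₀.1 with hc
  let Ω' : Set (EP × F) := (c.target ×ˢ univ) ∩ (fun y => (c.symm y.1, y.2)) ⁻¹' Ω
  let φ' : EP × F → F' := fun y => φ (c.symm y.1, y.2)
  have hs : ContMDiffOn 𝓘(ℝ, EP × F) (𝓘(ℝ, EP).prod 𝓘(ℝ, F)) ∞
      (fun y : EP × F => (c.symm y.1, y.2)) (c.target ×ˢ univ) :=
    ((contMDiffOn_extChartAt_symm (I := 𝓘(ℝ, EP)) (n := ∞) z₀.1).comp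
      (contDiff_fst.contMDiff.contMDiffOn) fun y hy => hy.1).prodMk
      contDiff_snd.contMDiff.contMDiffOn
  have hΩ' : IsOpen Ω' := hs.continuousOn.isOpen_inter_preimage
    ((isOpen_extChartAt_target _).prod isOpen_univ) hΩ
  have hφ' : ContDiffOn ℝ ∞ φ' Ω' := by
    rw [← contMDiffOn_iff_contDiffOn]
    exact hφ.comp (hs.mono inter_subset_left) fun y hy => hy.2
  have hloc : ∀ z : P × (F × F × ℝ), z.1 ∈ c.source → z ∈ fibreHadamardDomain Ω →
      (((c z.1, z.2.1), (0, z.2.2.1), z.2.2.2) : (EP × F) × (EP × F) × ℝ) ∈ hadamardDomain Ω' := by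
    intro z hz1 hz t ht
    refine ⟨⟨?_, trivial⟩, ?_⟩
    · simpa using c.map_source hz1
    · simpa [c.left_inv hz1] using hz t ht
  have heq : fibreHadamard φ =ᶠ[𝓝 z₀] fun z =>
      hadamard φ' ((c z.1, z.2.1), (0, z.2.2.1), z.2.2.2) := by
    have e1 : ∀ᶠ z : P × (F × F × ℝ) in 𝓝 z₀, z.1 ∈ c.source :=
      continuous_fst.continuousAt.eventually
        ((isOpen_extChartAt_source _).mem_nhds (mem_extChartAt_source _))
    filter_upwards [e1, (isOpen_fibreHadamardDomain hΩ).mem_nhds hz₀] with z hz1 hz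
    refine intervalIntegral.integral_congr fun t ht => ?_
    rw [uIcc_of_le zero_le_one] at ht
    have hmem := hloc z hz1 hz t ht
    have h1 : HasFDerivAt φ' (fderiv ℝ φ' (c z.1, z.2.1 + t • z.2.2.2 • z.2.2.1))
        (c z.1, z.2.1 + t • z.2.2.2 • z.2.2.1) := by
      refine ((hφ'.contDiffAt (hΩ'.mem_nhds ?_)).differentiableAt (by simp)).hasFDerivAt
      simpa using hmem
    have h2 := h1.comp (z.2.1 + t • z.2.2.2 • z.2.2.1)
      (hasFDerivAt_prodMk_right (c z.1) (z.2.1 + t • z.2.2.2 • z.2.2.1))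
    have h3 : (φ' ∘ fun v => (c z.1, v)) = fun v => φ (z.1, v) := by
      funext v
      simp [φ', c.left_inv hz1]
    rw [h3] at h2
    simp only [h2.fderiv]
    simp
  refine ContMDiffAt.congr_of_eventuallyEq ?_ heq
  have h4 : ContMDiffAt 𝓘(ℝ, (EP × F) × (EP × F) × ℝ) 𝓘(ℝ, F') ∞ (hadamard φ')
      ((c z₀.1, z₀.2.1), (0, z₀.2.2.1), z₀.2.2.2) :=
    ((contDiffOn_hadamard hΩ' hφ').contDiffAt ((isOpen_hadamardDomain hΩ').mem_nhds
      (hloc z₀ (mem_extChartAt_source _) hz₀))).contMDiffAt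
  have h5 : ContMDiffAt (𝓘(ℝ, EP).prod 𝓘(ℝ, F × F × ℝ)) 𝓘(ℝ, EP) ∞
      (fun z : P × (F × F × ℝ) => c z.1) z₀ :=
    (contMDiffAt_extChartAt (I := 𝓘(ℝ, EP)) (n := ∞)).comp z₀ contMDiffAt_fst
  have h6 : ContMDiffAt (𝓘(ℝ, EP).prod 𝓘(ℝ, F × F × ℝ)) 𝓘(ℝ, F × F × ℝ) ∞
      (fun z : P × (F × F × ℝ) => z.2) z₀ := contMDiffAt_snd
  have h7 : ContDiff ℝ ∞ (fun y : EP × (F × F × ℝ) =>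
      (((y.1, y.2.1), (0, y.2.2.1), y.2.2.2) : (EP × F) × (EP × F) × ℝ)) := by fun_prop
  have h8 : ContMDiffAt (𝓘(ℝ, EP).prod 𝓘(ℝ, F × F × ℝ)) 𝓘(ℝ, (EP × F) × (EP × F) × ℝ) ∞
      (fun z : P × (F × F × ℝ) =>
        (((c z.1, z.2.1), (0, z.2.2.1), z.2.2.2) : (EP × F) × (EP × F) × ℝ)) z₀ :=
    h7.contMDiff.contMDiffAt.comp z₀ (h5.prodMk_space h6)
  exact h4.comp z₀ h8

/-- The iterated partial derivatives of `φ` in the second variable. -/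
def iterFibre (φ : P × F → F') : (n : ℕ) → P × (F × (Fin n → F)) → F'
  | 0 => fun z => φ (z.1, z.2.1)
  | n + 1 => fun z => fderiv ℝ (fun y => iterFibre φ n (z.1, y))
      (z.2.1, fun j => z.2.2 j.castSucc) (z.2.2 (Fin.last n), 0)

/-- The domain of `iterFibre φ n`. -/
def iterFibreDomain (Ω : Set (P × F)) (n : ℕ) : Set (P × (F × (Fin n → F))) :=
  {z | (z.1, z.2.1) ∈ Ω}

theorem isOpen_iterFibreDomain (hΩ : IsOpen Ω) (n : ℕ) : IsOpen (iterFibreDomain Ω n) :=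
  hΩ.preimage (by fun_prop : Continuous fun z : P × (F × (Fin n → F)) => (z.1, z.2.1))

/-- A partial derivative is the Hadamard quotient at step `0`, which is already known to be smooth
in all variables. The new direction occupies the last slot, and the zero second component keeps the
earlier directions fixed. -/
theorem contMDiffOn_iterFibre (hΩ : IsOpen Ω)
    (hφ : ContMDiffOn (𝓘(ℝ, EP).prod 𝓘(ℝ, F)) 𝓘(ℝ, F') ∞ φ Ω) (n : ℕ) :
    ContMDiffOn (𝓘(ℝ, EP).prod 𝓘(ℝ, F × (Fin n → F))) 𝓘(ℝ, F') ∞ (iterFibre φ n)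
      (iterFibreDomain Ω n) := by
  induction n with
  | zero =>
    refine hφ.comp (ContMDiff.contMDiffOn ?_) fun z hz => hz
    exact contMDiff_fst.prodMk (contDiff_fst.contMDiff.comp contMDiff_snd)
  | succ n ih =>
    have h1 := contMDiffOn_fibreHadamard (isOpen_iterFibreDomain hΩ n) ih
    have h2 : ContMDiff (𝓘(ℝ, EP).prod 𝓘(ℝ, F × (Fin (n + 1) → F)))
        (𝓘(ℝ, EP).prod 𝓘(ℝ, (F × (Fin n → F)) × (F × (Fin n → F)) × ℝ)) ∞
        (fun z : P × (F × (Fin (n + 1) → F)) => ((z.1,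
          ((z.2.1, fun j => z.2.2 j.castSucc), (z.2.2 (Fin.last n), 0), 0)) :
            P × ((F × (Fin n → F)) × (F × (Fin n → F)) × ℝ))) := by
      have h3 : ContDiff ℝ ∞ (fun y : F × (Fin (n + 1) → F) =>
          (((y.1, fun j => y.2 j.castSucc), (y.2 (Fin.last n), 0), 0) :
            (F × (Fin n → F)) × (F × (Fin n → F)) × ℝ)) := by fun_prop
      exact contMDiff_fst.prodMk (h3.contMDiff.comp contMDiff_snd)
    refine (h1.comp h2.contMDiffOn (s := iterFibreDomain Ω (n + 1)) ?_).congr ?_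
    · intro z hz t ht
      simpa [iterFibreDomain] using hz
    · intro z hz
      exact (fibreHadamard_zero (φ := iterFibre φ n) z.1 _ _).symm

end FibreHadamard

section

open BundledManifold

/-! ## Superposition operators between spaces of smooth maps -/

section Superposition

variable {EP P : Type u} [NormedAddCommGroup EP] [NormedSpace ℝ EP] [TopologicalSpace P]
  [ChartedSpace EP P] [IsManifold 𝓘(ℝ, EP) ∞ P]

/-- `A` is realized, through `ev`, as a space of smooth maps `P → Y`, with a topology that is finer
than the `C^∞`-topology. -/
structure Realizes {A : Type*} [TopologicalSpace A] (Y : BundledManifold.{v}) (ev : A → P → Y.M) :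
    Prop where
  smooth : ∀ a, ContMDiff 𝓘(ℝ, EP) Y.I ∞ (ev a)
  smTendsto : ∀ a, SmTendsto (bundle EP P) Y univ ev (𝓝 a) (ev a)

/-- `A` is realized, through `ev`, as a space of smooth maps `P → Y`, with the `C^∞`-topology. -/
structure RealizesInducing {A : Type*} [TopologicalSpace A] (Y : BundledManifold.{v})
    (ev : A → P → Y.M) : Prop extends Realizes (EP := EP) Y ev where
  le_nhds : ∀ (a : A) (l : Filter A), SmTendsto (bundle EP P) Y univ ev l (ev a) → l ≤ 𝓝 a

variable {A B C : Type*} [TopologicalSpace A] [TopologicalSpace B] [TopologicalSpace C]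
  {Y : BundledManifold.{v}} {Z : BundledManifold.{u₁}} {W : BundledManifold.{u₂}}
  {evA : A → P → Y.M} {evB : B → P → Z.M} {evC : C → P → W.M}

theorem RealizesInducing.tendsto {ι : Type*} {l : Filter ι} {u : ι → A} {a : A}
    (h : RealizesInducing (EP := EP) Y evA)
    (hu : SmTendsto (bundle EP P) Y univ (fun i => evA (u i)) l (evA a)) :
    Tendsto u l (𝓝 a) :=
  h.le_nhds a (map u l) fun n K hK hKS U hU hm => hu n K hK hKS U hU hm

theorem Realizes.comp (h : Realizes (EP := EP) Y evA) {φ : Y.M → Z.M}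
    (hφ : ContMDiff Y.I Z.I ∞ φ) : Realizes (EP := EP) Z (fun a p => φ (evA a p)) where
  smooth a := hφ.comp (h.smooth a)
  smTendsto a := (h.smTendsto a).comp_left isOpen_univ (subset_univ _) isOpen_univ hφ.contMDiffOn
    (Eventually.of_forall fun a => (h.smooth a).contMDiffOn) (h.smooth a).contMDiffOn
    (Eventually.of_forall fun _ => mapsTo_univ _ _) (mapsTo_univ _ _)

theorem Realizes.comp_continuous (h : Realizes (EP := EP) Y evA) {f : B → A} (hf : Continuous f) :
    Realizes (EP := EP) Y (fun b => evA (f b)) where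
  smooth _ := h.smooth _
  smTendsto b := (h.smTendsto (f b)).comp_tendsto (hf.tendsto b)

theorem Realizes.prodMk [T2Space P] {evB' : A → P → Z.M} (h : Realizes (EP := EP) Y evA)
    (h' : Realizes (EP := EP) Z evB') :
    Realizes (EP := EP) (Y.prod Z) (fun a p => (evA a p, evB' a p)) where
  smooth a := (h.smooth a).prodMk (h'.smooth a)
  smTendsto a := (h.smTendsto a).prodMk (h'.smTendsto a) isOpen_univ (subset_univ _)
    (Eventually.of_forall fun a => (h.smooth a).contMDiffOn) (h.smooth a).contMDiffOn
    (Eventually.of_forall fun a => (h'.smooth a).contMDiffOn) (h'.smooth a).contMDiffOn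

theorem Realizes.const {f : P → Y.M} (hf : ContMDiff 𝓘(ℝ, EP) Y.I ∞ f) :
    Realizes (EP := EP) Y (fun (_ : A) => f) where
  smooth _ := hf
  smTendsto _ := smTendsto_const

theorem Realizes.prod [T2Space P] (h : Realizes (EP := EP) Y evA)
    (h' : Realizes (EP := EP) Z evB) :
    Realizes (EP := EP) (Y.prod Z) (fun (c : A × B) p => (evA c.1 p, evB c.2 p)) :=
  (h.comp_continuous continuous_fst).prodMk (h'.comp_continuous continuous_snd)

/-- On `s`, the map `Φ` is post-composition with a smooth map that may depend on the point of `P`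
and need only be defined on an open set. -/
def IsSuperposition (Y : BundledManifold.{v}) (Z : BundledManifold.{u₁}) {A B : Type*}
    (evA : A → P → Y.M) (evB : B → P → Z.M) (Φ : A → B) (s : Set A) : Prop :=
  ∃ (Ω : Set (P × Y.M)) (φ : P × Y.M → Z.M), IsOpen Ω ∧
    ContMDiffOn (𝓘(ℝ, EP).prod Y.I) Z.I ∞ φ Ω ∧
    ∀ a ∈ s, ∀ p, (p, evA a p) ∈ Ω ∧ evB (Φ a) p = φ (p, evA a p)

theorem IsSuperposition.mono {Φ : A → B} {s t : Set A}
    (h : IsSuperposition (EP := EP) Y Z evA evB Φ s) (hts : t ⊆ s) :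
    IsSuperposition (EP := EP) Y Z evA evB Φ t := by
  obtain ⟨Ω, φ, hΩ, hφ, h⟩ := h
  exact ⟨Ω, φ, hΩ, hφ, fun a ha => h a (hts ha)⟩

theorem IsSuperposition.comp {Φ : A → B} {Ψ : B → C} {s : Set A} {t : Set B}
    (hΨ : IsSuperposition (EP := EP) Z W evB evC Ψ t)
    (hΦ : IsSuperposition (EP := EP) Y Z evA evB Φ s) (hst : MapsTo Φ s t) :
    IsSuperposition (EP := EP) Y W evA evC (fun a => Ψ (Φ a)) s := by
  obtain ⟨Ω, φ, hΩ, hφ, h⟩ := hΦ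
  obtain ⟨Ω', ψ, hΩ', hψ, h'⟩ := hΨ
  have hc : ContMDiffOn (𝓘(ℝ, EP).prod Y.I) (𝓘(ℝ, EP).prod Z.I) ∞
      (fun z : P × Y.M => (z.1, φ z)) Ω := contMDiffOn_fst.prodMk hφ
  refine ⟨Ω ∩ (fun z => (z.1, φ z)) ⁻¹' Ω', fun z => ψ (z.1, φ z),
    hc.continuousOn.isOpen_inter_preimage hΩ hΩ', hψ.comp (hc.mono inter_subset_left)
      fun z hz => hz.2, fun a ha p => ?_⟩
  have h1 := h a ha p
  have h2 := h' (Φ a) (hst ha) p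
  rw [h1.2] at h2
  exact ⟨⟨h1.1, h2.1⟩, h2.2⟩

theorem IsSuperposition.prodMap {A' B' : Type*} {Y' : BundledManifold.{u₃}}
    {Z' : BundledManifold.{u₄}} {evA' : A' → P → Y'.M} {evB' : B' → P → Z'.M} {Φ : A → B}
    {Φ' : A' → B'} {s : Set A} {s' : Set A'}
    (h : IsSuperposition (EP := EP) Y Z evA evB Φ s)
    (h' : IsSuperposition (EP := EP) Y' Z' evA' evB' Φ' s') :
    IsSuperposition (EP := EP) (Y.prod Y') (Z.prod Z')
      (fun (c : A × A') p => (evA c.1 p, evA' c.2 p))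
      (fun (c : B × B') p => (evB c.1 p, evB' c.2 p)) (Prod.map Φ Φ') (s ×ˢ s') := by
  obtain ⟨Ω, φ, hΩ, hφ, h⟩ := h
  obtain ⟨Ω', φ', hΩ', hφ', h'⟩ := h'
  have h1 : ContMDiff (𝓘(ℝ, EP).prod (Y.I.prod Y'.I)) (𝓘(ℝ, EP).prod Y.I) ∞
      (fun z : P × (Y.M × Y'.M) => (z.1, z.2.1)) :=
    contMDiff_fst.prodMk (ContMDiff.comp contMDiff_fst contMDiff_snd)
  have h2 : ContMDiff (𝓘(ℝ, EP).prod (Y.I.prod Y'.I)) (𝓘(ℝ, EP).prod Y'.I) ∞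
      (fun z : P × (Y.M × Y'.M) => (z.1, z.2.2)) :=
    contMDiff_fst.prodMk (ContMDiff.comp contMDiff_snd contMDiff_snd)
  refine ⟨(fun z : P × (Y.M × Y'.M) => (z.1, z.2.1)) ⁻¹' Ω ∩
    (fun z : P × (Y.M × Y'.M) => (z.1, z.2.2)) ⁻¹' Ω',
    fun z => (φ (z.1, z.2.1), φ' (z.1, z.2.2)),
    (hΩ.preimage h1.continuous).inter (hΩ'.preimage h2.continuous),
    (hφ.comp h1.contMDiffOn fun z hz => hz.1).prodMk (hφ'.comp h2.contMDiffOn fun z hz => hz.2),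
    fun a ha p => ?_⟩
  have e1 := h a.1 ha.1 p
  have e2 := h' a.2 ha.2 p
  exact ⟨⟨e1.1, e2.1⟩, Prod.ext e1.2 e2.2⟩

/-- The map `p ↦ φ (p, f p)` is `φ` composed with the graph map `p ↦ (p, f p)`, so stability under
pairing and under post-composition suffices. -/
theorem IsSuperposition.smTendsto [T2Space P] {Φ : A → B} {s : Set A}
    (hA : Realizes (EP := EP) Y evA) (h : IsSuperposition (EP := EP) Y Z evA evB Φ s) {a : A}
    (ha : a ∈ s) :
    SmTendsto (bundle EP P) Z univ (fun a => evB (Φ a)) (𝓝[s] a) (evB (Φ a)) := by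
  obtain ⟨Ω, φ, hΩ, hφ, h⟩ := h
  have hid : ContMDiff 𝓘(ℝ, EP) 𝓘(ℝ, EP) ∞ (id : P → P) := contMDiff_id
  have hs : ∀ a, ContMDiff 𝓘(ℝ, EP) (𝓘(ℝ, EP).prod Y.I) ∞ (fun p => (p, evA a p)) :=
    fun a => hid.prodMk (hA.smooth a)
  have h1 : SmTendsto (bundle EP P) ((bundle EP P).prod Y) univ (fun a p => (p, evA a p)) (𝓝[s] a)
      (fun p => (p, evA a p)) :=
    SmTendsto.mono_left (((Realizes.const (A := A) (Y := bundle EP P) hid).prodMk hA).smTendsto a)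
      nhdsWithin_le_nhds
  have hφ' : ContMDiffOn (M := ((bundle EP P).prod Y).M) ((bundle EP P).prod Y).I Z.I ∞ φ Ω := hφ
  have hs' : ∀ a, ContMDiffOn (M' := ((bundle EP P).prod Y).M) (bundle EP P).I
      ((bundle EP P).prod Y).I ∞ (fun p => (p, evA a p)) univ := fun a => (hs a).contMDiffOn
  have h2 := h1.comp_left (Z := Z) (φ := φ) (O := Ω) isOpen_univ (subset_univ _) hΩ hφ'
    (Eventually.of_forall hs') (hs' a)
    (by filter_upwards [self_mem_nhdsWithin] with b hb p _ using (h b hb p).1)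
    (fun p _ => (h a ha p).1)
  refine h2.congr isOpen_univ (subset_univ _) ?_ fun p _ => (h a ha p).2
  filter_upwards [self_mem_nhdsWithin] with b hb p _ using (h b hb p).2

theorem IsSuperposition.continuousOn [T2Space P] {Φ : A → B} {s : Set A}
    (h : IsSuperposition (EP := EP) Y Z evA evB Φ s) (hA : Realizes (EP := EP) Y evA)
    (hB : RealizesInducing (EP := EP) Z evB) : ContinuousOn Φ s :=
  fun _ ha => hB.tendsto (h.smTendsto hA ha)

end Superposition

/-! ### Superposition operators have continuous iterated directional derivatives. -/

section LCSmooth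

variable {EP P : Type u} [NormedAddCommGroup EP] [NormedSpace ℝ EP] [TopologicalSpace P]
  [ChartedSpace EP P] [IsManifold 𝓘(ℝ, EP) ∞ P]
  {F : Type v} [NormedAddCommGroup F] [NormedSpace ℝ F]
  {F' : Type u₁} [NormedAddCommGroup F'] [NormedSpace ℝ F']
  {V V' : Type*} [TopologicalSpace V] [TopologicalSpace V']
  {ev : V → P → F} {ev' : V' → P → F'}

theorem contMDiff_prod_to_space :
    ContMDiff (𝓘(ℝ, F).prod 𝓘(ℝ, F')) 𝓘(ℝ, F × F') ∞ (fun z : F × F' => z) := by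
  exact contMDiff_fst.prodMk_space contMDiff_snd

theorem contMDiff_space_to_prod :
    ContMDiff 𝓘(ℝ, F × F') (𝓘(ℝ, F).prod 𝓘(ℝ, F')) ∞ (fun z : F × F' => z) := by
  exact contDiff_fst.contMDiff.prodMk contDiff_snd.contMDiff

theorem Realizes.prodMk_space [T2Space P] {ev' : V → P → F'}
    (h : Realizes (EP := EP) (bundle F F) ev) (h' : Realizes (EP := EP) (bundle F' F') ev') :
    Realizes (EP := EP) (bundle (F × F') (F × F')) (fun a p => (ev a p, ev' a p)) :=
  (h.prodMk h').comp (Z := bundle (F × F') (F × F')) (φ := fun z => z) contMDiff_prod_to_space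

theorem Realizes.sum [T2Space P] {ι : Type*} {e : ι → V → P → F}
    (h : ∀ i, Realizes (EP := EP) (bundle F F) (e i)) (t : Finset ι) :
    Realizes (EP := EP) (bundle F F) (fun a p => ∑ i ∈ t, e i a p) := by
  classical
  induction t using Finset.induction_on with
  | empty =>
    simp only [Finset.sum_empty]
    exact Realizes.const (Y := bundle F F) contMDiff_const
  | insert i t hi ih =>
    simp only [Finset.sum_insert hi]
    exact ((h i).prodMk_space ih).comp (Z := bundle F F) (φ := fun z => z.1 + z.2)
      contDiff_add.contMDiff

theorem Realizes.pi [T2Space P] {n : ℕ} {e : Fin n → V → P → F}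
    (h : ∀ i, Realizes (EP := EP) (bundle F F) (e i)) :
    Realizes (EP := EP) (bundle (Fin n → F) (Fin n → F)) (fun a p i => e i a p) := by
  have h1 : ∀ i, Realizes (EP := EP) (bundle (Fin n → F) (Fin n → F))
      (fun a p => (Pi.single i (e i a p) : Fin n → F)) := fun i =>
    (h i).comp (Z := bundle (Fin n → F) (Fin n → F)) (φ := fun y => Pi.single i y)
      (ContinuousLinearMap.single ℝ (fun _ : Fin n => F) i).contDiff.contMDiff
  have h2 := Realizes.sum h1 Finset.univ
  have h3 : (fun (a : V) (p : P) => ∑ i, (Pi.single i (e i a p) : Fin n → F)) =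
      fun a p i => e i a p := by
    funext a p
    exact Finset.univ_sum_single _
  rwa [h3] at h2

variable [AddCommGroup V] [Module ℝ V] [ContinuousAdd V] [ContinuousSMul ℝ V]
  [AddCommGroup V'] [Module ℝ V']

/-- Superposition operators are smooth. -/
theorem IsSuperposition.lcSmooth [T2Space P] [CompleteSpace F'] {Φ : V → V'} {s : Set V}
    (h : IsSuperposition (EP := EP) (bundle F F) (bundle F' F') ev ev' Φ s) (hs : IsOpen s)
    (hV : Realizes (EP := EP) (bundle F F) ev)
    (hV' : RealizesInducing (EP := EP) (bundle F' F') ev')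
    (hadd : ∀ a b p, ev (a + b) p = ev a p + ev b p) (hsmul : ∀ (r : ℝ) a p, ev (r • a) p = r • ev a p)
    (hsub' : ∀ a b p, ev' (a - b) p = ev' a p - ev' b p)
    (hsmul' : ∀ (r : ℝ) a p, ev' (r • a) p = r • ev' a p)
    (hinj : Function.Injective ev')
    (hcl : ∀ g : P → F', ContMDiff 𝓘(ℝ, EP) 𝓘(ℝ, F') ∞ g →
      (∃ u : ℝ → V', ∀ p, Tendsto (fun r => ev' (u r) p) (𝓝[≠] 0) (𝓝 (g p))) → ∃ b, ev' b = g) :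
    LCSmooth Φ s := by
  classical
  obtain ⟨Ω, φ, hΩ, hφ, h⟩ := h
  -- The point and its `n` directions are bundled into one map on `P`, so that the `n`-th derivative
  -- becomes superposition by `iterFibre φ n`.
  let J : (n : ℕ) → V × (Fin n → V) → P → F × (Fin n → F) :=
    fun n y p => (ev y.1 p, fun j => ev (y.2 j) p)
  have hJ : ∀ n, Realizes (EP := EP) (bundle (F × (Fin n → F)) (F × (Fin n → F))) (J n) := fun n =>
    (hV.comp_continuous continuous_fst).prodMk_space
      (Realizes.pi fun i => hV.comp_continuous ((continuous_apply i).comp continuous_snd))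
  have hJΩ : ∀ n (y : V × (Fin n → V)), y.1 ∈ s → ∀ p, (p, J n y p) ∈ iterFibreDomain Ω n :=
    fun n y hy p => (h y.1 hy p).1
  have hφn := fun n => contMDiffOn_iterFibre hΩ hφ n
  let D : (n : ℕ) → V × (Fin (n + 1) → V) → P → F × (Fin n → F) :=
    fun n y p => (ev (y.2 (Fin.last n)) p, 0)
  let y₀ : (n : ℕ) → V × (Fin (n + 1) → V) → ℝ → V × (Fin n → V) :=
    fun n y r => (y.1 + r • y.2 (Fin.last n), fun j => y.2 j.castSucc)
  have hy₀ : ∀ n y r p, J n (y₀ n y r) p = J n (y₀ n y 0) p + r • D n y p := by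
    intro n y r p
    simp only [J, D, y₀, hadd, hsmul]
    ext <;> simp
  -- The Hadamard integral runs over a segment, so all of it has to stay in `s`, not only its
  -- endpoints.
  have hnear : ∀ n (y : V × (Fin (n + 1) → V)), y.1 ∈ s → ∀ᶠ r in 𝓝 (0 : ℝ),
      (∀ t ∈ Icc (0 : ℝ) 1, (y₀ n y (t * r)).1 ∈ s) := by
    intro n y hy
    have hc : Continuous fun r : ℝ => (y₀ n y r).1 := by
      simp only [y₀]
      fun_prop
    have h0 : (y₀ n y 0).1 ∈ s := by simpa [y₀] using hy
    obtain ⟨ε, hε, hb⟩ := Metric.eventually_nhds_iff_ball.1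
      (hc.continuousAt.eventually (hs.mem_nhds h0))
    filter_upwards [Metric.ball_mem_nhds (0 : ℝ) hε] with r hr t ht
    refine hb _ ?_
    rw [mem_ball_zero_iff] at hr ⊢
    rw [norm_mul, Real.norm_of_nonneg ht.1]
    exact (mul_le_of_le_one_left (norm_nonneg _) ht.2).trans_lt hr
  have hdom : ∀ n (y : V × (Fin (n + 1) → V)) r, (∀ t ∈ Icc (0 : ℝ) 1, (y₀ n y (t * r)).1 ∈ s) →
      ∀ p, (p, (J n (y₀ n y 0) p, D n y p, r)) ∈ fibreHadamardDomain (iterFibreDomain Ω n) := by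
    intro n y r hr p t ht
    have := hJΩ n _ (hr t ht) p
    rwa [hy₀, mul_smul] at this
  have hquot : ∀ n (y : V × (Fin (n + 1) → V)) (r : ℝ), r ≠ 0 →
      (∀ t ∈ Icc (0 : ℝ) 1, (y₀ n y (t * r)).1 ∈ s) → ∀ p,
      r⁻¹ • (iterFibre φ n (p, J n (y₀ n y r) p) - iterFibre φ n (p, J n (y₀ n y 0) p)) =
        fibreHadamard (iterFibre φ n) (p, (J n (y₀ n y 0) p, D n y p, r)) := by
    intro n y r hr0 hr p
    have := smul_fibreHadamard (isOpen_iterFibreDomain hΩ n) (hφn n) (hdom n y r hr p)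
    simp only at this
    rw [hy₀, ← this, smul_smul, inv_mul_cancel₀ hr0, one_smul]
  have hzero : ∀ n (y : V × (Fin (n + 1) → V)) p,
      fibreHadamard (iterFibre φ n) (p, (J n (y₀ n y 0) p, D n y p, 0)) =
        iterFibre φ (n + 1) (p, J (n + 1) y p) := by
    intro n y p
    rw [fibreHadamard_zero]
    simp [iterFibre, J, D, y₀]
  -- The step `r` is treated as a constant map `P → ℝ` depending continuously on `r`. Convergence of
  -- the difference quotients is then continuity at `r = 0` of superposition by `fibreHadamard`.
  have hsm : ∀ n (y : V × (Fin (n + 1) → V)), y.1 ∈ s →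
      SmTendsto (bundle EP P) (bundle F' F') univ
        (fun r p => fibreHadamard (iterFibre φ n) (p, (J n (y₀ n y 0) p, D n y p, r))) (𝓝 0)
        (fun p => iterFibre φ (n + 1) (p, J (n + 1) y p)) := by
    intro n y hy
    have hid : ContMDiff 𝓘(ℝ, EP) 𝓘(ℝ, EP) ∞ (id : P → P) := contMDiff_id
    have hJs := (hJ n).smooth (y₀ n y 0)
    have hDs : ContMDiff 𝓘(ℝ, EP) 𝓘(ℝ, F × (Fin n → F)) ∞ (D n y) :=
      (hV.smooth (y.2 (Fin.last n))).prodMk_space contMDiff_const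
    have hb : ContMDiff 𝓘(ℝ, EP) ((𝓘(ℝ, EP)).prod 𝓘(ℝ, (F × (Fin n → F)) × (F × (Fin n → F)))) ∞
        (fun p : P => (p, (J n (y₀ n y 0) p, D n y p))) := hid.prodMk (hJs.prodMk_space hDs)
    let Y : BundledManifold := (bundle EP P).prod
      (bundle ((F × (Fin n → F)) × (F × (Fin n → F))) ((F × (Fin n → F)) × (F × (Fin n → F))))
    have hR : Realizes (EP := EP) (Y.prod (bundle ℝ ℝ))
        (fun (r : ℝ) (p : P) => ((p, (J n (y₀ n y 0) p, D n y p)), r)) :=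
      (Realizes.const (A := ℝ) (Y := Y) hb).prodMk (Z := bundle ℝ ℝ) (evB' := fun r _ => r)
        ⟨fun r => contMDiff_const, fun r => smTendsto_const_of_tendsto (X := bundle EP P)
          (Y := bundle ℝ ℝ) (c := fun r : ℝ => r) tendsto_id⟩
    have hre : ContMDiff ((𝓘(ℝ, EP).prod 𝓘(ℝ, (F × (Fin n → F)) × (F × (Fin n → F)))).prod 𝓘(ℝ, ℝ))
        (𝓘(ℝ, EP).prod 𝓘(ℝ, (F × (Fin n → F)) × (F × (Fin n → F)) × ℝ)) ∞
        (fun z : (P × ((F × (Fin n → F)) × (F × (Fin n → F)))) × ℝ =>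
          (z.1.1, (z.1.2.1, z.1.2.2, z.2))) := by
      have e1 : ContMDiff ((𝓘(ℝ, EP).prod 𝓘(ℝ, (F × (Fin n → F)) × (F × (Fin n → F)))).prod 𝓘(ℝ, ℝ)) 𝓘(ℝ, EP) ∞
        (fun z : (P × ((F × (Fin n → F)) × (F × (Fin n → F)))) × ℝ => z.1.1) :=
        ContMDiff.comp (I' := 𝓘(ℝ, EP).prod 𝓘(ℝ, (F × (Fin n → F)) × (F × (Fin n → F)))) contMDiff_fst contMDiff_fst
      have e2 : ContMDiff ((𝓘(ℝ, EP).prod 𝓘(ℝ, (F × (Fin n → F)) × (F × (Fin n → F)))).prod 𝓘(ℝ, ℝ))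
          𝓘(ℝ, (F × (Fin n → F)) × (F × (Fin n → F))) ∞
        (fun z : (P × ((F × (Fin n → F)) × (F × (Fin n → F)))) × ℝ => z.1.2) :=
        ContMDiff.comp (I' := 𝓘(ℝ, EP).prod 𝓘(ℝ, (F × (Fin n → F)) × (F × (Fin n → F)))) contMDiff_snd contMDiff_fst
      have e3 : ContMDiff ((𝓘(ℝ, EP).prod 𝓘(ℝ, (F × (Fin n → F)) × (F × (Fin n → F)))).prod 𝓘(ℝ, ℝ)) 𝓘(ℝ, ℝ) ∞
        (fun z : (P × ((F × (Fin n → F)) × (F × (Fin n → F)))) × ℝ => z.2) := contMDiff_snd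
      have e4 : ContDiff ℝ ∞ (fun y : ((F × (Fin n → F)) × (F × (Fin n → F))) × ℝ =>
          (y.1.1, y.1.2, y.2)) := by fun_prop
      exact e1.prodMk (e4.contMDiff.comp (e2.prodMk_space e3))
    have hψ := (contMDiffOn_fibreHadamard (isOpen_iterFibreDomain hΩ n) (hφn n)).comp
      hre.contMDiffOn (s := (fun z : (P × ((F × (Fin n → F)) × (F × (Fin n → F)))) × ℝ =>
          (z.1.1, (z.1.2.1, z.1.2.2, z.2))) ⁻¹' fibreHadamardDomain (iterFibreDomain Ω n))
      fun z hz => hz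
    have hlim := (hR.smTendsto 0).comp_left (Y := Y.prod (bundle ℝ ℝ)) (Z := bundle F' F') isOpen_univ (subset_univ _)
      ((isOpen_fibreHadamardDomain (isOpen_iterFibreDomain hΩ n)).preimage hre.continuous) hψ
      (Eventually.of_forall fun r => (hR.smooth r).contMDiffOn) (hR.smooth 0).contMDiffOn
      (by filter_upwards [hnear n y hy] with r hr p _ using hdom n y r hr p)
      (fun p _ => hdom n y 0 (hnear n y hy).self_of_nhds p)
    exact hlim.congr isOpen_univ (subset_univ _) (Eventually.of_forall fun r p _ => rfl)
      fun p _ => (hzero n y p).symm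
  have hsmooth : ∀ n (y : V × (Fin n → V)), y.1 ∈ s →
      ContMDiff 𝓘(ℝ, EP) 𝓘(ℝ, F') ∞ (fun p => iterFibre φ n (p, J n y p)) := by
    intro n y hy
    rw [← contMDiffOn_univ]
    have hid : ContMDiff 𝓘(ℝ, EP) 𝓘(ℝ, EP) ∞ (id : P → P) := contMDiff_id
    exact (hφn n).comp (hid.prodMk ((hJ n).smooth y)).contMDiffOn fun p _ => hJΩ n y hy p
  -- The candidate derivative is so far only a smooth function on `P`. By induction its difference
  -- quotients come from `V'`, and `hcl` places their pointwise limit in `V'`.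
  have hex : ∀ n (y : V × (Fin n → V)), y.1 ∈ s →
      ∃ b, ev' b = fun p => iterFibre φ n (p, J n y p) := by
    intro n
    induction n with
    | zero => exact fun y hy => ⟨Φ y.1, funext fun p => (h y.1 hy p).2⟩
    | succ n ih =>
      intro y hy
      choose! b hb using ih
      refine hcl _ (hsmooth (n + 1) y hy) ⟨fun r => r⁻¹ • (b (y₀ n y r) - b (y₀ n y 0)), fun p => ?_⟩
      refine (((hsm n y hy).tendsto_apply (mem_univ p)).mono_left
        (nhdsWithin_le_nhds (s := {0}ᶜ))).congr' ?_
      filter_upwards [nhdsWithin_le_nhds (hnear n y hy), self_mem_nhdsWithin] with r hr hr0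
      have h1 : (y₀ n y r).1 ∈ s := by simpa using hr 1 (by simp)
      have h2 : (y₀ n y 0).1 ∈ s := by simpa using hr 0 (by simp)
      rw [hsmul', hsub', hb _ h1, hb _ h2]
      exact (hquot n y r hr0 hr p).symm
  choose! b hb using hex
  refine ⟨fun n x w => if x ∈ s then b n (x, w) else 0, ?_, ?_, ?_⟩
  · intro x hx v
    simp only [if_pos hx]
    refine hinj ((hb 0 (x, v) hx).trans (funext fun p => ?_))
    exact ((h x hx p).2).symm
  · intro n x hx v w
    simp only [if_pos hx]
    refine hV'.tendsto ?_
    set y : V × (Fin (n + 1) → V) := (x, Fin.snoc v w) with hy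
    have hyx : ∀ r, y₀ n y r = (x + r • w, v) := fun r => by
      simp [y₀, hy, Fin.snoc_castSucc, Fin.snoc_last]
    refine ((hsm n y hx).mono_left (nhdsWithin_le_nhds (s := {0}ᶜ))).congr isOpen_univ
      (subset_univ _) ?_ (fun p _ => by rw [hb (n + 1) y hx])
    filter_upwards [nhdsWithin_le_nhds (hnear n y hx), self_mem_nhdsWithin] with r hr hr0 p _
    have h1 : (y₀ n y r).1 ∈ s := by simpa using hr 1 (by simp)
    have h1' : x + r • w ∈ s := by simpa [hyx] using h1
    have h2 := hquot n y r hr0 hr p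
    rw [if_pos h1', hsmul', hsub', hb n _ h1', hb n (x, v) hx]
    refine Eq.trans ?_ h2
    rw [hyx, hyx, zero_smul, add_zero]
  · intro n
    have hsup : IsSuperposition (EP := EP) (bundle (F × (Fin n → F)) (F × (Fin n → F)))
        (bundle F' F') (J n) ev' (fun y : V × (Fin n → V) => if y.1 ∈ s then b n (y.1, y.2) else 0)
        (s ×ˢ univ) := by
      refine ⟨iterFibreDomain Ω n, iterFibre φ n, isOpen_iterFibreDomain hΩ n, hφn n,
        fun y hy p => ⟨hJΩ n y hy.1 p, ?_⟩⟩
      simp only [if_pos hy.1]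
      rw [hb n _ hy.1]
    exact hsup.continuousOn (hJ n) hV'

end LCSmooth

end

section

open BundledManifold

/-! ## Local trivializations of a principal bundle -/

section Trivializations

variable {EM M EP P EK K : Type*}
  [NormedAddCommGroup EM] [NormedSpace ℝ EM] [TopologicalSpace M] [ChartedSpace EM M]
  [NormedAddCommGroup EP] [NormedSpace ℝ EP] [TopologicalSpace P] [ChartedSpace EP P]
  [NormedAddCommGroup EK] [NormedSpace ℝ EK] [TopologicalSpace K] [ChartedSpace EK K] [Group K]

/-- A local trivialization of a principal bundle over a chart domain `N` with chart `χ`, given by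
the section `σ`, in the chart, and the `K`-valued coordinate `κ`. -/
structure LocalTriv (Q : PrincipalBundle EM M EP P EK K) where
  N : Set M
  O : Set EM
  χ : M → EM
  σ : EM → P
  κ : P → K
  isOpen_N : IsOpen N
  isOpen_O : IsOpen O
  smooth_χ : ContMDiffOn 𝓘(ℝ, EM) 𝓘(ℝ, EM) ∞ χ N
  mapsTo : MapsTo χ N O
  smooth_σ : ContMDiffOn 𝓘(ℝ, EM) 𝓘(ℝ, EP) ∞ σ O
  smooth_κ : ContMDiffOn 𝓘(ℝ, EP) 𝓘(ℝ, EK) ∞ κ (Q.proj ⁻¹' N)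
  proj_σ : ∀ x ∈ N, Q.proj (σ (χ x)) = x
  act_κ : ∀ p, Q.proj p ∈ N → Q.act (σ (χ (Q.proj p))) (κ p) = p
  κ_act : ∀ p k, Q.proj p ∈ N → κ (Q.act p k) = κ p * k

/-- The section is the preimage of `(x, 1)` under a trivialization, precomposed with the inverse of
a chart. Its domain is thus open in the vector space `EM`, where iterated tangent maps can later be
written as ordinary derivatives. -/
theorem PrincipalBundle.exists_localTriv [IsManifold 𝓘(ℝ, EM) ∞ M]
    (Q : PrincipalBundle EM M EP P EK K) (x : M) : ∃ t : LocalTriv Q, x ∈ t.N := by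
  obtain ⟨V, Φ, hV, hxV, hs, ht, hΦ, hΦ', h1, h2⟩ := Q.locally_trivial x
  set c := extChartAt 𝓘(ℝ, EM) x with hc
  have hsym : ∀ y ∈ V, (y, (1 : K)) ∈ Φ.target := fun y hy => ht ▸ ⟨hy, trivial⟩
  have hproj : ∀ y ∈ V, Q.proj (Φ.symm (y, 1)) = y := fun y hy => by
    rw [← h1 _ (Φ.map_target (hsym y hy)), Φ.right_inv (hsym y hy)]
  have hcc : ContMDiffOn 𝓘(ℝ, EM) 𝓘(ℝ, EM) ∞ c.symm c.target := contMDiffOn_extChartAt_symm x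
  refine ⟨⟨V ∩ c.source, c.target ∩ c.symm ⁻¹' V, c, fun y => Φ.symm (c.symm y, 1),
    fun p => (Φ p).2, hV.inter (isOpen_extChartAt_source x),
    hcc.continuousOn.isOpen_inter_preimage (isOpen_extChartAt_target x) hV, ?_, ?_, ?_, ?_, ?_, ?_,
    ?_⟩, hxV, mem_extChartAt_source x⟩
  · exact (contMDiffOn_extChartAt (I := 𝓘(ℝ, EM)) (n := ∞) (x := x)).mono fun y hy => by
      simpa [hc] using hy.2
  · intro y hy
    refine ⟨c.map_source hy.2, ?_⟩
    rw [mem_preimage, c.left_inv hy.2]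
    exact hy.1
  · exact hΦ'.comp ((hcc.mono inter_subset_left).prodMk contMDiffOn_const)
      fun y hy => hsym _ hy.2
  · have : Q.proj ⁻¹' (V ∩ c.source) ⊆ Φ.source := fun p hp => hs ▸ hp.1
    exact contMDiff_snd.comp_contMDiffOn (hΦ.mono this)
  · intro y hy
    rw [c.left_inv hy.2, hproj _ hy.1]
  · intro p hp
    rw [c.left_inv hp.2]
    have hps : p ∈ Φ.source := hs ▸ hp.1
    have h0 := Φ.map_target (hsym _ hp.1)
    have h0' : Q.act (Φ.symm (Q.proj p, 1)) (Φ p).2 ∈ Φ.source := by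
      rw [hs, mem_preimage, Q.proj_act, hproj _ hp.1]
      exact hp.1
    refine Φ.injOn h0' hps (Prod.ext ?_ ?_)
    · rw [h1 _ h0', Q.proj_act, hproj _ hp.1, h1 _ hps]
    · rw [h2 _ h0, Φ.right_inv (hsym _ hp.1), one_mul]
  · intro p k hp
    exact h2 _ (hs ▸ hp.1) k

/-- A compact base is covered by the interiors of finitely many trivializations. -/
theorem PrincipalBundle.exists_finite_localTriv [IsManifold 𝓘(ℝ, EM) ∞ M] [CompactSpace M]
    [T2Space M] (Q : PrincipalBundle EM M EP P EK K) :
    ∃ (n : ℕ) (t : Fin n → LocalTriv Q) (V : Fin n → Set M),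
      (∀ i, IsClosed (V i)) ∧ (∀ i, V i ⊆ (t i).N) ∧ ⋃ i, V i = univ := by
  choose t ht using Q.exists_localTriv
  obtain ⟨s, hs⟩ := isCompact_univ.elim_finite_subcover (fun x => (t x).N)
    (fun x => (t x).isOpen_N) (fun x _ => mem_iUnion.2 ⟨x, ht x⟩)
  let e := s.equivFin
  have hcov : ⋃ i, (t (e.symm i)).N = univ := by
    refine univ_subset_iff.1 fun x hx => ?_
    obtain ⟨y, hy, hxy⟩ := mem_iUnion₂.1 (hs hx)
    exact mem_iUnion.2 ⟨e ⟨y, hy⟩, by simpa using hxy⟩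
  -- Shrinking lemma in the normal space `M`. The closed sets are compact, so local sections carry
  -- them to compact subsets of `P`.
  obtain ⟨V, hV, hVc, hVs⟩ := exists_iUnion_eq_closed_subset
    (fun i => (t (e.symm i)).isOpen_N) (fun x => toFinite _) hcov
  exact ⟨_, fun i => t (e.symm i), V, hVc, hVs, hV⟩

theorem PrincipalBundle.surjective_proj [IsManifold 𝓘(ℝ, EM) ∞ M]
    (Q : PrincipalBundle EM M EP P EK K) : Function.Surjective Q.proj := fun x => by
  obtain ⟨t, ht⟩ := Q.exists_localTriv x
  exact ⟨_, t.proj_σ x ht⟩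

theorem PrincipalBundle.t2Space [T2Space M] [LieGroup 𝓘(ℝ, EK) ∞ K]
    (Q : PrincipalBundle EM M EP P EK K) : T2Space P := by
  haveI : T2Space K := t2Space_of_lieGroup EK K
  refine ⟨fun p p' hne => ?_⟩
  by_cases hb : Q.proj p = Q.proj p'
  · obtain ⟨V, Φ, hV, hxV, hs, -⟩ := Q.locally_trivial (Q.proj p)
    have hp : p ∈ Φ.source := hs ▸ hxV
    have hp' : p' ∈ Φ.source := by rw [hs, mem_preimage, ← hb]; exact hxV
    obtain ⟨u, v, hu, hv, hwu, hwv, huv⟩ := t2_separation (fun h => hne (Φ.injOn hp hp' h))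
    exact ⟨Φ.source ∩ Φ ⁻¹' u, Φ.source ∩ Φ ⁻¹' v, Φ.continuousOn.isOpen_inter_preimage
      Φ.open_source hu, Φ.continuousOn.isOpen_inter_preimage Φ.open_source hv, ⟨hp, hwu⟩,
      ⟨hp', hwv⟩, disjoint_left.2 fun x hx hx' => disjoint_left.1 huv hx.2 hx'.2⟩
  · obtain ⟨u, v, hu, hv, hwu, hwv, huv⟩ := t2_separation hb
    have hc := Q.smooth_proj.continuous
    exact ⟨_, _, hu.preimage hc, hv.preimage hc, hwu, hwv, huv.preimage _⟩

end Trivializations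

/-! ## Smooth actions by automorphisms -/

section Action

variable {EK K F L : Type*} [NormedAddCommGroup EK] [NormedSpace ℝ EK] [TopologicalSpace K]
  [ChartedSpace EK K] [Group K] [LieGroup 𝓘(ℝ, EK) ∞ K]
  [NormedAddCommGroup F] [NormedSpace ℝ F] [TopologicalSpace L]
  [ChartedSpace F L] [Group L] [LieGroup 𝓘(ℝ, F) ∞ L]

/-- `β` is a smooth right action of `K` on `L` by automorphisms. -/
structure IsSmoothAction (EK F : Type*) {K L : Type*} [NormedAddCommGroup EK] [NormedSpace ℝ EK]
    [TopologicalSpace K] [ChartedSpace EK K] [Group K] [NormedAddCommGroup F] [NormedSpace ℝ F]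
    [TopologicalSpace L] [ChartedSpace F L] [Group L] (β : K → L → L) : Prop where
  smooth : ContMDiff (𝓘(ℝ, EK).prod 𝓘(ℝ, F)) 𝓘(ℝ, F) ∞ (fun x : K × L => β x.1 x.2)
  one : ∀ x, β 1 x = x
  mul : ∀ k l x, β (k * l) x = β l (β k x)
  map_mul : ∀ k x y, β k (x * y) = β k x * β k y

/-- The infinitesimal action. -/
def actionDeriv (F : Type*) {K L : Type*} [NormedAddCommGroup F] [NormedSpace ℝ F]
    [TopologicalSpace L] [ChartedSpace F L] [Group L] (β : K → L → L) (k : K) : F →L[ℝ] F :=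
  mfderiv 𝓘(ℝ, F) 𝓘(ℝ, F) (β k) 1

variable {β : K → L → L}

namespace IsSmoothAction

theorem map_one (h : IsSmoothAction EK F β) (k : K) : β k 1 = 1 := by
  have := h.map_mul k 1 1
  rw [mul_one] at this
  exact (mul_eq_left.1 this.symm)

theorem apply_inv (h : IsSmoothAction EK F β) (k : K) (x : L) : β k (β k⁻¹ x) = x := by
  rw [← h.mul, inv_mul_cancel, h.one]

theorem smooth_apply (h : IsSmoothAction EK F β) (k : K) :
    ContMDiff 𝓘(ℝ, F) 𝓘(ℝ, F) ∞ (β k) :=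
  h.smooth.comp (contMDiff_const.prodMk contMDiff_id)

theorem deriv_one (h : IsSmoothAction EK F β) : actionDeriv F β (1 : K) = ContinuousLinearMap.id ℝ F := by
  have : β 1 = id := funext h.one
  rw [actionDeriv, this]
  exact mfderiv_id

theorem deriv_mul (h : IsSmoothAction EK F β) (k l : K) (v : F) :
    actionDeriv F β (k * l) v = actionDeriv F β l (actionDeriv F β k v) := by
  have h1 : β (k * l) = β l ∘ β k := funext (h.mul k l)
  have hk := ((h.smooth_apply k).contMDiffAt (x := 1)).mdifferentiableAt (by simp)
  have hl := ((h.smooth_apply l).contMDiffAt (x := β k 1)).mdifferentiableAt (by simp)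
  have h2 := mfderiv_comp (I'' := 𝓘(ℝ, F)) (1 : L) hl hk
  rw [← h1] at h2
  have h3 : (mfderiv 𝓘(ℝ, F) 𝓘(ℝ, F) (β l) (β k 1) : F →L[ℝ] F) = actionDeriv F β l := by
    rw [h.map_one]; rfl
  have h4 : actionDeriv F β (k * l) =
      (mfderiv 𝓘(ℝ, F) 𝓘(ℝ, F) (β l) (β k 1) : F →L[ℝ] F).comp (actionDeriv F β k) := h2
  rw [h4, h3]
  rfl

theorem deriv_inv_apply (h : IsSmoothAction EK F β) (k : K) (v : F) :
    actionDeriv F β k⁻¹ (actionDeriv F β k v) = v := by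
  rw [← h.deriv_mul, mul_inv_cancel, h.deriv_one]; rfl

theorem deriv_apply_inv (h : IsSmoothAction EK F β) (k : K) (v : F) :
    actionDeriv F β k (actionDeriv F β k⁻¹ v) = v := by
  rw [← h.deriv_mul, inv_mul_cancel, h.deriv_one]; rfl

/-- Differentiation with parameters gives smoothness in tangent coordinates. Every `β k` fixes `1`,
so the coordinate changes are trivial there and the statement holds for the operator norm. -/
theorem contMDiff_deriv (h : IsSmoothAction EK F β) :
    ContMDiff 𝓘(ℝ, EK) 𝓘(ℝ, F →L[ℝ] F) ∞ (fun k : K => actionDeriv F β k) := by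
  intro k
  have h1 := ContMDiffAt.mfderiv (x₀ := k) (m := ∞) (n := ∞) (f := fun k => β k) (g := fun _ => (1 : L))
    (J := 𝓘(ℝ, EK)) (I := 𝓘(ℝ, F)) (I' := 𝓘(ℝ, F)) h.smooth.contMDiffAt contMDiffAt_const (by simp)
  refine h1.congr_of_eventuallyEq (Eventually.of_forall fun k' => ?_)
  have hy : ∀ k', β k' 1 ∈ (chartAt F (β k 1)).source := fun k' => by
    rw [h.map_one, h.map_one]
    exact mem_chart_source F (1 : L)
  have h2 := inTangentCoordinates_eq (I := 𝓘(ℝ, F)) (I' := 𝓘(ℝ, F)) (fun _ : K => (1 : L))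
    (fun k => β k 1) (fun k => actionDeriv F β k) (x₀ := k) (x := k')
    (mem_chart_source F (1 : L)) (hy k')
  have h3 : ∀ (y y₀ : L) (w : F), y = 1 → y₀ = 1 →
      (tangentBundleCore 𝓘(ℝ, F) L).coordChange (achart F y) (achart F y₀) y w = w := by
    rintro - - w rfl rfl
    exact (tangentBundleCore 𝓘(ℝ, F) L).coordChange_self _ _ (mem_chart_source F (1 : L)) w
  refine Eq.trans ?_ h2.symm
  ext v
  simp only [ContinuousLinearMap.comp_apply]
  rw [h3 _ _ _ (h.map_one k') (h.map_one k), h3 _ _ _ rfl rfl]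

theorem contMDiff_deriv_apply (h : IsSmoothAction EK F β) :
    ContMDiff (𝓘(ℝ, EK).prod 𝓘(ℝ, F)) 𝓘(ℝ, F) ∞
      (fun x : K × F => actionDeriv F β x.1 x.2) :=
  (h.contMDiff_deriv.comp contMDiff_fst).clm_apply contMDiff_snd

theorem lieExp_deriv [CompleteSpace F] (h : IsSmoothAction EK F β) (k : K) (v : F) :
    lieExp L (actionDeriv F β k v) = β k (lieExp L v) :=
  (map_lieExp (h.smooth_apply k) (h.map_mul k) v).symm

end IsSmoothAction

end Action

end

section

open BundledManifold

/-! ## Spaces of equivariant maps -/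

section EquivariantMaps

variable {EM : Type u₁} {M : Type u₁} {EP P : Type u} {EK K : Type u₂}
  [NormedAddCommGroup EM] [NormedSpace ℝ EM] [TopologicalSpace M] [ChartedSpace EM M]
  [NormedAddCommGroup EP] [NormedSpace ℝ EP] [TopologicalSpace P] [ChartedSpace EP P]
  [IsManifold 𝓘(ℝ, EP) ∞ P]
  [NormedAddCommGroup EK] [NormedSpace ℝ EK] [TopologicalSpace K] [ChartedSpace EK K] [Group K]

/-- `A` is, through `ev`, the space of all smooth maps `f : P → Y` with `f (p k) = β k (f p)`, with
the `C^∞`-topology. -/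
structure IsEquivariantMapSpace (Q : PrincipalBundle EM M EP P EK K) (Y : BundledManifold.{v})
    (β : K → Y.M → Y.M) {A : Type*} [TopologicalSpace A] (ev : A → P → Y.M) : Prop
    extends RealizesInducing (EP := EP) Y ev where
  injective : Function.Injective ev
  equivariant : ∀ a p k, ev a (Q.act p k) = β k (ev a p)
  exists_eq : ∀ f : P → Y.M, ContMDiff 𝓘(ℝ, EP) Y.I ∞ f →
    (∀ p k, f (Q.act p k) = β k (f p)) → ∃ a, ev a = f

variable {Q : PrincipalBundle EM M EP P EK K} {Y : BundledManifold.{v}} {β : K → Y.M → Y.M}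
  {A : Type*} [TopologicalSpace A] {ev : A → P → Y.M}

theorem Realizes.continuous_apply (h : Realizes (EP := EP) Y ev) (p : P) :
    Continuous fun a => ev a p :=
  continuous_iff_continuousAt.2 fun a => (h.smTendsto a).tendsto_apply (mem_univ p)

theorem IsEquivariantMapSpace.t2Space [T2Space Y.M] (h : IsEquivariantMapSpace Q Y β ev) :
    T2Space A :=
  T2Space.of_injective_continuous h.injective
    (continuous_pi fun p => h.toRealizes.continuous_apply p)

/-- The maps whose graph lies in an invariant open set form an open set. -/
theorem IsEquivariantMapSpace.isOpen_setOf_forall_mem [IsManifold 𝓘(ℝ, EM) ∞ M] [CompactSpace M]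
    [T2Space M] [T2Space P] (h : IsEquivariantMapSpace Q Y β ev) {Ω : Set (P × Y.M)}
    (hΩ : IsOpen Ω) (hinv : ∀ p k y, (p, y) ∈ Ω → (Q.act p k, β k y) ∈ Ω) :
    IsOpen {a | ∀ p, (p, ev a p) ∈ Ω} := by
  obtain ⟨n, t, V, hVc, hVt, hV⟩ := Q.exists_finite_localTriv
  rw [isOpen_iff_mem_nhds]
  intro a ha
  have hid : ContMDiff 𝓘(ℝ, EP) 𝓘(ℝ, EP) ∞ (id : P → P) := contMDiff_id
  have h1 : SmTendsto (bundle EP P) ((bundle EP P).prod Y) univ (fun a p => (p, ev a p)) (𝓝 a)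
      (fun p => (p, ev a p)) :=
    ((Realizes.const (A := A) (Y := bundle EP P) hid).prodMk h.toRealizes).smTendsto a
  -- As `P` need not be compact, the condition is imposed only on the compact images of the `V i`
  -- under local sections; invariance of `Ω` carries it to all of `P`.
  have h2 : ∀ i, IsCompact ((fun x => (t i).σ ((t i).χ x)) '' V i) := fun i =>
    (hVc i).isCompact.image_of_continuousOn ((((t i).smooth_σ.comp (t i).smooth_χ
      (t i).mapsTo).continuousOn).mono (hVt i))
  have h3 : ∀ i, ∀ᶠ b in 𝓝 a, MapsTo (fun p => (p, ev b p))
      ((fun x => (t i).σ ((t i).χ x)) '' V i) Ω := fun i =>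
    h1 0 _ (h2 i) (subset_univ _) Ω hΩ fun p _ => ha p
  filter_upwards [Filter.eventually_all.2 h3] with b hb p
  obtain ⟨i, hi⟩ := mem_iUnion.1 (hV ▸ mem_univ (Q.proj p))
  have h4 := hinv _ ((t i).κ p) _ (hb i (mem_image_of_mem _ hi))
  rwa [← h.equivariant, (t i).act_κ p (hVt i hi)] at h4

end EquivariantMaps

/-! ## Spaces of maps with values in a normed space -/

section LinearMaps

variable {EP P : Type u} [NormedAddCommGroup EP] [NormedSpace ℝ EP] [TopologicalSpace P]
  [ChartedSpace EP P] [IsManifold 𝓘(ℝ, EP) ∞ P]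
  {F : Type v} [NormedAddCommGroup F] [NormedSpace ℝ F]
  {V : Type*} [AddCommGroup V] [Module ℝ V]

/-- The vector space structure of a space of maps is pointwise. -/
structure IsPointwiseLinear (ev : V → P → F) : Prop where
  map_add : ∀ a b p, ev (a + b) p = ev a p + ev b p
  map_smul : ∀ (r : ℝ) a p, ev (r • a) p = r • ev a p

variable {ev : V → P → F}

theorem IsPointwiseLinear.map_zero (h : IsPointwiseLinear ev) (p : P) : ev 0 p = 0 := by
  simpa using h.map_smul 0 0 p

theorem IsPointwiseLinear.map_neg (h : IsPointwiseLinear ev) (a : V) (p : P) :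
    ev (-a) p = -ev a p := by
  simpa using h.map_smul (-1) a p

theorem IsPointwiseLinear.map_sub (h : IsPointwiseLinear ev) (a b : V) (p : P) :
    ev (a - b) p = ev a p - ev b p := by
  rw [sub_eq_add_neg, h.map_add, h.map_neg, sub_eq_add_neg]

theorem IsPointwiseLinear.prod {F' : Type u₁} [NormedAddCommGroup F'] [NormedSpace ℝ F']
    {V' : Type*} [AddCommGroup V'] [Module ℝ V'] {ev' : V' → P → F'} (h : IsPointwiseLinear ev)
    (h' : IsPointwiseLinear ev') :
    IsPointwiseLinear (fun (c : V × V') p => (ev c.1 p, ev' c.2 p)) where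
  map_add _ _ _ := Prod.ext (h.map_add _ _ _) (h'.map_add _ _ _)
  map_smul _ _ _ := Prod.ext (h.map_smul _ _ _) (h'.map_smul _ _ _)

variable [TopologicalSpace V]

theorem RealizesInducing.continuousAdd [T2Space P] (h : RealizesInducing (EP := EP) (bundle F F) ev)
    (hl : IsPointwiseLinear ev) : ContinuousAdd V where
  continuous_add := by
    refine continuous_iff_continuousAt.2 fun c => h.tendsto ?_
    have h1 := (((h.toRealizes.comp_continuous continuous_fst).prodMk_space
      (h.toRealizes.comp_continuous continuous_snd)).comp (Z := bundle F F)
      (φ := fun z : F × F => z.1 + z.2) contDiff_add.contMDiff).smTendsto c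
    have e : ∀ c : V × V, ev (c.1 + c.2) = fun p => ev c.1 p + ev c.2 p :=
      fun c => funext fun p => hl.map_add _ _ _
    simpa only [e] using h1

theorem RealizesInducing.continuousSMul [T2Space P]
    (h : RealizesInducing (EP := EP) (bundle F F) ev)
    (hl : IsPointwiseLinear ev) : ContinuousSMul ℝ V where
  continuous_smul := by
    refine continuous_iff_continuousAt.2 fun c => h.tendsto ?_
    have h0 : Realizes (EP := EP) (bundle ℝ ℝ) (fun (c : ℝ × V) (_ : P) => c.1) :=
      ⟨fun r => contMDiff_const, fun r => smTendsto_const_of_tendsto (X := bundle EP P)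
        (Y := bundle ℝ ℝ) (c := fun c : ℝ × V => c.1) continuous_fst.continuousAt⟩
    have h1 := ((h0.prodMk_space (h.toRealizes.comp_continuous continuous_snd)).comp
      (Z := bundle F F) (φ := fun z : ℝ × F => z.1 • z.2) contDiff_smul.contMDiff).smTendsto c
    have e : ∀ c : ℝ × V, ev (c.1 • c.2) = fun p => c.1 • ev c.2 p :=
      fun c => funext fun p => hl.map_smul _ _ _
    simpa only [e] using h1

theorem RealizesInducing.isTopologicalAddGroup [T2Space P]
    (h : RealizesInducing (EP := EP) (bundle F F) ev) (hl : IsPointwiseLinear ev) :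
    IsTopologicalAddGroup V := by
  haveI := h.continuousAdd hl
  haveI := h.continuousSMul hl
  haveI : ContinuousNeg V := ⟨by simpa using (continuous_const_smul (-1 : ℝ) : Continuous fun v : V => _)⟩
  exact ⟨⟩

end LinearMaps

/-! ## Charts given by superposition -/

section Charts

variable {EP P : Type u} [NormedAddCommGroup EP] [NormedSpace ℝ EP] [TopologicalSpace P]
  [ChartedSpace EP P] [IsManifold 𝓘(ℝ, EP) ∞ P]
  {F₁ : Type u₁} [NormedAddCommGroup F₁] [NormedSpace ℝ F₁]
  {F₂ : Type u₂} [NormedAddCommGroup F₂] [NormedSpace ℝ F₂]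
  {V₁ V₂ G₁ G₂ : Type*} [TopologicalSpace V₁] [TopologicalSpace V₂] [TopologicalSpace G₁]
  [TopologicalSpace G₂] {Y₁ : BundledManifold.{u₃}} {Y₂ : BundledManifold.{u₄}}
  {ev₁ : G₁ → P → Y₁.M} {ev₂ : G₂ → P → Y₂.M} {lev₁ : V₁ → P → F₁} {lev₂ : V₂ → P → F₂}

/-- A chart such that it and its inverse are given by superposition. -/
def IsSuperChart {V G : Type*} [TopologicalSpace V] [TopologicalSpace G] (Y : BundledManifold.{u₃})
    (ev : G → P → Y.M) (lev : V → P → F₁) (e : OpenPartialHomeomorph G V) : Prop :=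
  IsSuperposition (EP := EP) Y (bundle F₁ F₁) ev lev e e.source ∧
    IsSuperposition (EP := EP) (bundle F₁ F₁) Y lev ev e.symm e.target

theorem IsSuperChart.prod_symm {a : OpenPartialHomeomorph G₁ V₁} {b : OpenPartialHomeomorph G₂ V₂}
    (ha : IsSuperChart (EP := EP) Y₁ ev₁ lev₁ a) (hb : IsSuperChart (EP := EP) Y₂ ev₂ lev₂ b) :
    IsSuperposition (EP := EP) (bundle (F₁ × F₂) (F₁ × F₂)) (Y₁.prod Y₂)
      (fun (c : V₁ × V₂) p => (lev₁ c.1 p, lev₂ c.2 p))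
      (fun (c : G₁ × G₂) p => (ev₁ c.1 p, ev₂ c.2 p)) (a.prod b).symm (a.prod b).target := by
  obtain ⟨Ω, φ, hΩ, hφ, h⟩ := ha.2.prodMap hb.2
  have h1 : ContMDiff (𝓘(ℝ, EP).prod 𝓘(ℝ, F₁ × F₂)) (𝓘(ℝ, EP).prod (𝓘(ℝ, F₁).prod 𝓘(ℝ, F₂))) ∞
      (fun z : P × (F₁ × F₂) => z) :=
    contMDiff_fst.prodMk (contMDiff_space_to_prod.comp contMDiff_snd)
  exact ⟨Ω, φ, hΩ, ContMDiffOn.comp (M' := P × (F₁ × F₂))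
    (I' := 𝓘(ℝ, EP).prod (𝓘(ℝ, F₁).prod 𝓘(ℝ, F₂))) hφ
    h1.contMDiffOn fun z hz => hz, h⟩

/-- The local representative is a composite of three superpositions (inverse chart, map, chart),
hence a superposition between the model spaces, and `IsSuperposition.lcSmooth` applies. -/
theorem IsSuperposition.chartSmoothOn [T2Space P] [CompleteSpace F₂]
    [AddCommGroup V₁] [Module ℝ V₁] [AddCommGroup V₂] [Module ℝ V₂]
    [ContinuousAdd V₁] [ContinuousSMul ℝ V₁]
    {A : Set (OpenPartialHomeomorph G₁ V₁)} {B : Set (OpenPartialHomeomorph G₂ V₂)}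
    (hA : ∀ a ∈ A, IsSuperposition (EP := EP) (bundle F₁ F₁) Y₁ lev₁ ev₁ a.symm a.target)
    (hB : ∀ b ∈ B, IsSuperposition (EP := EP) Y₂ (bundle F₂ F₂) ev₂ lev₂ b b.source)
    {f : G₁ → G₂} {U : Set G₁} (hf : IsSuperposition (EP := EP) Y₁ Y₂ ev₁ ev₂ f U) (hU : IsOpen U)
    (h₁ : Realizes (EP := EP) Y₁ ev₁) (h₂ : RealizesInducing (EP := EP) Y₂ ev₂)
    (hl₁ : Realizes (EP := EP) (bundle F₁ F₁) lev₁) (hp₁ : IsPointwiseLinear lev₁)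
    (hl₂ : RealizesInducing (EP := EP) (bundle F₂ F₂) lev₂) (hp₂ : IsPointwiseLinear lev₂)
    (hinj : Function.Injective lev₂)
    (hcl : ∀ g : P → F₂, ContMDiff 𝓘(ℝ, EP) 𝓘(ℝ, F₂) ∞ g →
      (∃ u : ℝ → V₂, ∀ p, Tendsto (fun r => lev₂ (u r) p) (𝓝[≠] 0) (𝓝 (g p))) →
      ∃ b, lev₂ b = g) :
    ChartSmoothOn A B f U := by
  have hc := hf.continuousOn h₁ h₂
  refine ⟨hc, fun a ha b hb => ?_⟩
  have h3 : IsSuperposition (EP := EP) (bundle F₁ F₁) (bundle F₂ F₂) lev₁ lev₂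
      (fun x => b (f (a.symm x))) (a.target ∩ a.symm ⁻¹' (U ∩ f ⁻¹' b.source)) := by
    refine (hB b hb).comp (hf.comp ((hA a ha).mono inter_subset_left) fun x hx => hx.2.1)
      fun x hx => hx.2.2
  exact h3.lcSmooth (a.isOpen_inter_preimage_symm (hc.isOpen_inter_preimage hU b.open_source))
    hl₁ hl₂ hp₁.map_add hp₁.map_smul hp₂.map_sub hp₂.map_smul hinj hcl

end Charts

end

section

open BundledManifold

/-! ## The fibrewise logarithm -/

section FibreLog

variable {EM M EP P EK K F L : Type*}
  [NormedAddCommGroup EM] [NormedSpace ℝ EM] [TopologicalSpace M] [ChartedSpace EM M]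
  [IsManifold 𝓘(ℝ, EM) ∞ M] [CompactSpace M] [T2Space M]
  [NormedAddCommGroup EP] [NormedSpace ℝ EP] [TopologicalSpace P] [ChartedSpace EP P]
  [NormedAddCommGroup EK] [NormedSpace ℝ EK] [TopologicalSpace K] [ChartedSpace EK K] [Group K]
  [LieGroup 𝓘(ℝ, EK) ∞ K]
  [NormedAddCommGroup F] [NormedSpace ℝ F] [CompleteSpace F] [TopologicalSpace L]
  [ChartedSpace F L] [Group L] [LieGroup 𝓘(ℝ, F) ∞ L]

/-- The data of a smooth equivariant fibrewise logarithm on `P × L`. -/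
structure FibreLog (Q : PrincipalBundle EM M EP P EK K) (F : Type*) {L : Type*}
    [NormedAddCommGroup F] [NormedSpace ℝ F] [TopologicalSpace L] [ChartedSpace F L] [Group L]
    (β : K → L → L) where
  Ω : Set (P × F)
  Ω' : Set (P × L)
  log : P × L → F
  isOpen_Ω : IsOpen Ω
  isOpen_Ω' : IsOpen Ω'
  zero_mem : ∀ p, (p, 0) ∈ Ω
  act_mem : ∀ p k v, (p, v) ∈ Ω → (Q.act p k, actionDeriv F β k v) ∈ Ω
  exp_mem : ∀ p v, (p, v) ∈ Ω → (p, lieExp L v) ∈ Ω'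
  log_mem : ∀ p g, (p, g) ∈ Ω' → (p, log (p, g)) ∈ Ω
  log_exp : ∀ p v, (p, v) ∈ Ω → log (p, lieExp L v) = v
  exp_log : ∀ p g, (p, g) ∈ Ω' → lieExp L (log (p, g)) = g
  smooth : ContMDiffOn (𝓘(ℝ, EP).prod 𝓘(ℝ, F)) 𝓘(ℝ, F) ∞ log Ω'

variable {Q : PrincipalBundle EM M EP P EK K} {β : K → L → L}

theorem FibreLog.act_mem' (D : FibreLog Q F β) (h : IsSmoothAction EK F β) (p : P) (k : K) (g : L)
    (hg : (p, g) ∈ D.Ω') : (Q.act p k, β k g) ∈ D.Ω' := by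
  have h1 := D.exp_mem _ _ (D.act_mem p k _ (D.log_mem p g hg))
  rwa [h.lieExp_deriv, D.exp_log p g hg] at h1

theorem FibreLog.log_act (D : FibreLog Q F β) (h : IsSmoothAction EK F β) (p : P) (k : K) (g : L)
    (hg : (p, g) ∈ D.Ω') : D.log (Q.act p k, β k g) = actionDeriv F β k (D.log (p, g)) := by
  have h1 := D.log_exp _ _ (D.act_mem p k _ (D.log_mem p g hg))
  rwa [h.lieExp_deriv, D.exp_log p g hg] at h1

/-- A neighbourhood `W` on which `exp` is injective is usually not invariant under `K`. Over `p` it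
is replaced by the vectors that the inverse of each `K`-coordinate of `p` moves into `W`. Changing
`p` to `p k` changes the coordinate by `k`, so the family is invariant, and injectivity of `exp`
over each `p` is inherited from `W`. -/
theorem exists_fibreLog (Q : PrincipalBundle EM M EP P EK K) (h : IsSmoothAction EK F β) :
    Nonempty (FibreLog Q F β) := by
  classical
  obtain ⟨n, t, V, hVc, hVt, hV⟩ := Q.exists_finite_localTriv
  obtain ⟨W, W', log, hW, hW', h0W, hexp, hlog, hle, hel, hlogs⟩ :=
    exists_lieExp_inverse (F := F) (L := L)
  have hcov : ∀ p, ∃ i, Q.proj p ∈ V i := fun p => mem_iUnion.1 (hV ▸ mem_univ (Q.proj p))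
  let Ω : Set (P × F) :=
    {z | ∀ i, Q.proj z.1 ∈ V i → actionDeriv F β ((t i).κ z.1)⁻¹ z.2 ∈ W}
  have hΩ : IsOpen Ω := by
    have h1 : Ω = ⋂ i, {z | Q.proj z.1 ∈ V i → actionDeriv F β ((t i).κ z.1)⁻¹ z.2 ∈ W} := by
      ext z; simp [Ω]
    rw [h1]
    refine isOpen_iInter_of_finite fun i => ?_
    have hN : IsOpen {z : P × F | Q.proj z.1 ∈ (t i).N} :=
      (t i).isOpen_N.preimage (Q.smooth_proj.continuous.comp continuous_fst)
    have hc : ContinuousOn (fun z : P × F => actionDeriv F β ((t i).κ z.1)⁻¹ z.2)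
        {z : P × F | Q.proj z.1 ∈ (t i).N} := by
      have e1 : ContinuousOn (fun z : P × F => (t i).κ z.1) {z : P × F | Q.proj z.1 ∈ (t i).N} :=
        (t i).smooth_κ.continuousOn.comp continuous_fst.continuousOn fun z hz => hz
      haveI := topologicalGroup_of_lieGroup 𝓘(ℝ, EK) ∞ (G := K)
      exact h.contMDiff_deriv_apply.continuous.comp_continuousOn
        (e1.inv.prodMk continuous_snd.continuousOn)
    -- Openness uses that `V i` is closed: the condition is vacuous on the open complement and is an
    -- open condition over the larger set `(t i).N`.
    have h2 : {z : P × F | Q.proj z.1 ∈ V i → actionDeriv F β ((t i).κ z.1)⁻¹ z.2 ∈ W} =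
        {z | Q.proj z.1 ∈ V i}ᶜ ∪ ({z : P × F | Q.proj z.1 ∈ (t i).N} ∩
          (fun z : P × F => actionDeriv F β ((t i).κ z.1)⁻¹ z.2) ⁻¹' W) := by
      ext z
      by_cases hz : Q.proj z.1 ∈ V i
      · simp [hz, hVt i hz]
      · simp [hz]
    rw [h2]
    exact (((hVc i).preimage (Q.smooth_proj.continuous.comp continuous_fst)).isOpen_compl).union
      (hc.isOpen_inter_preimage hN hW)
  have hinj : ∀ p v v', (p, v) ∈ Ω → (p, v') ∈ Ω → lieExp L v = lieExp L v' → v = v' := by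
    intro p v v' hv hv' he
    obtain ⟨i, hi⟩ := hcov p
    have h1 := congrArg log (show lieExp L (actionDeriv F β ((t i).κ p)⁻¹ v) =
      lieExp L (actionDeriv F β ((t i).κ p)⁻¹ v') by rw [h.lieExp_deriv, h.lieExp_deriv, he])
    rw [hle _ (hv i hi), hle _ (hv' i hi)] at h1
    rw [← h.deriv_apply_inv ((t i).κ p) v, h1, h.deriv_apply_inv]
  let Ω' : Set (P × L) := {z | ∃ v, (z.1, v) ∈ Ω ∧ lieExp L v = z.2}
  let LOG : P × L → F := fun z => if hz : z ∈ Ω' then hz.choose else 0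
  have hLOG : ∀ z ∈ Ω', (z.1, LOG z) ∈ Ω ∧ lieExp L (LOG z) = z.2 := fun z hz => by
    simp only [LOG, dif_pos hz]
    exact hz.choose_spec
  -- local description of the logarithm
  have hloc : ∀ z₀ ∈ Ω', ∃ (N₀ : Set (P × L)) (ψ : P × L → F), IsOpen N₀ ∧ z₀ ∈ N₀ ∧
      ContMDiffOn (𝓘(ℝ, EP).prod 𝓘(ℝ, F)) 𝓘(ℝ, F) ∞ ψ N₀ ∧ N₀ ⊆ Ω' ∧ ∀ z ∈ N₀, LOG z = ψ z := by
    rintro ⟨p₀, g₀⟩ ⟨v₀, hv₀, rfl⟩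
    obtain ⟨i, hi⟩ := hcov p₀
    set k := (t i).κ p₀ with hk
    have hw₀ : actionDeriv F β k⁻¹ v₀ ∈ W := hv₀ i hi
    -- The coordinate is frozen at its value over `p₀`. Wherever `(z.1, ψ z)` stays in `Ω`,
    -- fibrewise injectivity forces `ψ` to be the logarithm, which is therefore smooth.
    let ψ : P × L → F := fun z => actionDeriv F β k (log (β k⁻¹ z.2))
    have hβ : ContMDiff (𝓘(ℝ, EP).prod 𝓘(ℝ, F)) 𝓘(ℝ, F) ∞ (fun z : P × L => β k⁻¹ z.2) :=
      (h.smooth_apply k⁻¹).comp contMDiff_snd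
    have hS : IsOpen ((fun z : P × L => β k⁻¹ z.2) ⁻¹' W') := hW'.preimage hβ.continuous
    have hψ : ContMDiffOn (𝓘(ℝ, EP).prod 𝓘(ℝ, F)) 𝓘(ℝ, F) ∞ ψ
        ((fun z : P × L => β k⁻¹ z.2) ⁻¹' W') :=
      (actionDeriv F β k).contDiff.contMDiff.comp_contMDiffOn
        (hlogs.comp hβ.contMDiffOn fun z hz => hz)
    have hψc : ContinuousOn (fun z : P × L => (z.1, ψ z))
        ((fun z : P × L => β k⁻¹ z.2) ⁻¹' W') := continuousOn_fst.prodMk hψ.continuousOn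
    have hN₀ : ∀ z ∈ (fun z : P × L => β k⁻¹ z.2) ⁻¹' W' ∩ (fun z : P × L => (z.1, ψ z)) ⁻¹' Ω,
        (z.1, ψ z) ∈ Ω ∧ lieExp L (ψ z) = z.2 := fun z hz => by
      refine ⟨hz.2, ?_⟩
      rw [h.lieExp_deriv, hel _ hz.1, h.apply_inv]
    refine ⟨_, ψ, hψc.isOpen_inter_preimage hS hΩ, ⟨?_, ?_⟩, hψ.mono inter_subset_left,
      fun z hz => ⟨ψ z, hN₀ z hz⟩, fun z hz => ?_⟩
    · rw [mem_preimage]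
      simp only
      rw [← h.lieExp_deriv]
      exact hexp hw₀
    · rw [mem_preimage]
      simp only [ψ]
      rw [← h.lieExp_deriv, hle _ hw₀, h.deriv_apply_inv]
      exact hv₀
    · have h1 := hN₀ z hz
      have h2 := hLOG z ⟨ψ z, h1⟩
      exact hinj _ _ _ h2.1 h1.1 (h2.2.trans h1.2.symm)
  refine ⟨⟨Ω, Ω', LOG, hΩ, ?_, ?_, ?_, ?_, ?_, ?_, ?_, ?_⟩⟩
  · rw [isOpen_iff_mem_nhds]
    intro z hz
    obtain ⟨N₀, ψ, hN, hzN, -, hsub, -⟩ := hloc z hz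
    exact mem_of_superset (hN.mem_nhds hzN) hsub
  · intro p i _
    simpa using h0W
  · intro p k v hv i hi
    rw [Q.proj_act] at hi
    rw [(t i).κ_act p k (hVt i hi), mul_inv_rev, h.deriv_mul, h.deriv_inv_apply]
    exact hv i hi
  · exact fun p v hv => ⟨v, hv, rfl⟩
  · exact fun p g hg => (hLOG _ hg).1
  · intro p v hv
    have h2 := hLOG (p, lieExp L v) ⟨v, hv, rfl⟩
    exact hinj _ _ _ h2.1 hv h2.2
  · exact fun p g hg => (hLOG _ hg).2
  · intro z hz
    obtain ⟨N₀, ψ, hN, hzN, hψ, hsub, heq⟩ := hloc z hz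
    refine ContMDiffAt.contMDiffWithinAt ?_
    refine (hψ.contMDiffAt (hN.mem_nhds hzN)).congr_of_eventuallyEq ?_
    filter_upwards [hN.mem_nhds hzN] with y hy using heq y hy

end FibreLog

/-! ## The Lie group structure on spaces of equivariant maps -/

section LieGroupStructure

variable {EM : Type u₁} {M : Type u₁} {EP P : Type u} {EK K : Type u₂}
  [NormedAddCommGroup EM] [NormedSpace ℝ EM] [TopologicalSpace M] [ChartedSpace EM M]
  [IsManifold 𝓘(ℝ, EM) ∞ M] [CompactSpace M] [T2Space M]
  [NormedAddCommGroup EP] [NormedSpace ℝ EP] [TopologicalSpace P] [ChartedSpace EP P]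
  [IsManifold 𝓘(ℝ, EP) ∞ P]
  [NormedAddCommGroup EK] [NormedSpace ℝ EK] [TopologicalSpace K] [ChartedSpace EK K] [Group K]
  [LieGroup 𝓘(ℝ, EK) ∞ K]
  {F L : Type v} [NormedAddCommGroup F] [NormedSpace ℝ F] [CompleteSpace F] [TopologicalSpace L]
  [ChartedSpace F L] [Group L] [LieGroup 𝓘(ℝ, F) ∞ L]
  {Q : PrincipalBundle EM M EP P EK K} {β : K → L → L}
  {G V : Type*} [TopologicalSpace G] [TopologicalSpace V] {ev : G → P → L} {lev : V → P → F}

/-- Equivariance passes to pointwise limits because each `A k` is continuous. This supplies the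
closure hypothesis of `IsSuperposition.lcSmooth`. -/
theorem IsEquivariantMapSpace.exists_lev_eq_of_tendsto {W : Type*} [TopologicalSpace W]
    {lev : W → P → F} {A : K → F →L[ℝ] F}
    (hV : IsEquivariantMapSpace Q (bundle F F) (fun k v => A k v) lev)
    {ι : Type*} {l : Filter ι} [l.NeBot] (g : P → F) (hg : ContMDiff 𝓘(ℝ, EP) 𝓘(ℝ, F) ∞ g)
    (hu : ∃ u : ι → W, ∀ p, Tendsto (fun r => lev (u r) p) l (𝓝 (g p))) : ∃ b, lev b = g := by
  obtain ⟨u, hu⟩ := hu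
  refine hV.exists_eq g hg fun p k => tendsto_nhds_unique (hu (Q.act p k)) ?_
  have h1 := ((A k).continuous.tendsto (g p)).comp (hu p)
  refine h1.congr fun r => ?_
  exact (hV.equivariant (u r) p k).symm

/-- `exp` and the fibrewise logarithm provide a chart. -/
theorem exists_expChart (h : IsSmoothAction EK F β)
    (hG : IsEquivariantMapSpace Q (bundle F L) β ev)
    (hV : IsEquivariantMapSpace Q (bundle F F) (fun k v => actionDeriv F β k v) lev)
    (v₀ : V) (hv₀ : ∀ p, lev v₀ p = 0) :
    ∃ e : OpenPartialHomeomorph G V, IsSuperChart (EP := EP) (bundle F L) ev lev e ∧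
      v₀ ∈ e.target ∧ ∀ ξ ∈ e.target, ∀ p, ev (e.symm ξ) p = lieExp L (lev ξ p) := by
  classical
  haveI : T2Space P := Q.t2Space
  obtain ⟨D⟩ := exists_fibreLog Q h
  have hx : ∀ ξ : V, ∃ g : G, ev g = fun p => lieExp L (lev ξ p) := fun ξ =>
    hG.exists_eq _ (contMDiff_lieExp.comp (hV.smooth ξ)) fun p k => by
      rw [hV.equivariant, h.lieExp_deriv]
  have hy : ∀ g : G, (∀ p, (p, ev g p) ∈ D.Ω') → ∃ ξ : V, lev ξ = fun p => D.log (p, ev g p) := by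
    intro g hg
    refine hV.exists_eq _ ?_ fun p k => ?_
    · rw [← contMDiffOn_univ]
      have hid : ContMDiff 𝓘(ℝ, EP) 𝓘(ℝ, EP) ∞ (id : P → P) := contMDiff_id
      exact D.smooth.comp (hid.prodMk (hG.smooth g)).contMDiffOn fun p _ => hg p
    · rw [hG.equivariant, D.log_act h _ _ _ (hg p)]
  choose E hE using hx
  haveI : Nonempty V := ⟨v₀⟩
  choose! LG hLG using hy
  have hSE : IsSuperposition (EP := EP) (bundle F F) (bundle F L) lev ev E
      {ξ | ∀ p, (p, lev ξ p) ∈ D.Ω} :=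
    ⟨univ, fun z => lieExp L z.2, isOpen_univ,
      (contMDiff_lieExp.comp contMDiff_snd).contMDiffOn,
      fun ξ _ p => ⟨trivial, congrFun (hE ξ) p⟩⟩
  have hSL : IsSuperposition (EP := EP) (bundle F L) (bundle F F) ev lev LG
      {g | ∀ p, (p, ev g p) ∈ D.Ω'} :=
    ⟨D.Ω', D.log, D.isOpen_Ω', D.smooth, fun g hg p => ⟨hg p, congrFun (hLG g hg) p⟩⟩
  refine ⟨⟨⟨⟨LG, E, {g | ∀ p, (p, ev g p) ∈ D.Ω'}, {ξ | ∀ p, (p, lev ξ p) ∈ D.Ω}, ?_, ?_, ?_, ?_⟩,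
    ?_, ?_⟩, ?_, ?_⟩, ⟨hSL, hSE⟩, ?_, fun ξ _ p => congrFun (hE ξ) p⟩
  · intro g hg p
    rw [hLG g hg]
    exact D.log_mem _ _ (hg p)
  · intro ξ hξ p
    rw [hE]
    exact D.exp_mem _ _ (hξ p)
  · intro g hg
    refine hG.injective ?_
    rw [hE, hLG g hg]
    exact funext fun p => D.exp_log _ _ (hg p)
  · intro ξ hξ
    have h1 : ∀ p, (p, ev (E ξ) p) ∈ D.Ω' := fun p => by
      rw [hE]
      exact D.exp_mem _ _ (hξ p)
    refine hV.injective ?_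
    rw [hLG _ h1, hE]
    exact funext fun p => D.log_exp _ _ (hξ p)
  · exact hSL.continuousOn hG.toRealizes hV.toRealizesInducing
  · exact hSE.continuousOn hV.toRealizes hG.toRealizesInducing
  -- Here the invariance of the fibrewise domains is indispensable: it makes the domain of the chart
  -- open.
  · exact hG.isOpen_setOf_forall_mem D.isOpen_Ω' (D.act_mem' h)
  · exact hV.isOpen_setOf_forall_mem D.isOpen_Ω D.act_mem
  · intro p
    rw [hv₀]
    exact D.zero_mem p

variable [Group G]

theorem isSuperposition_mul (hmul : ∀ f g p, ev (f * g) p = ev f p * ev g p) :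
    IsSuperposition (EP := EP) ((bundle F L).prod (bundle F L)) (bundle F L)
      (fun (c : G × G) p => (ev c.1 p, ev c.2 p)) ev (fun x : G × G => x.1 * x.2) univ := by
  refine ⟨univ, fun z : P × (L × L) => z.2.1 * z.2.2, isOpen_univ, ContMDiff.contMDiffOn ?_,
    fun _ _ _ => ⟨trivial, hmul _ _ _⟩⟩
  have h1 : ContMDiff (𝓘(ℝ, F).prod 𝓘(ℝ, F)) 𝓘(ℝ, F) ∞ (fun z : L × L => z.1 * z.2) :=
    contMDiff_mul 𝓘(ℝ, F) ∞
  have h2 : ContMDiff (𝓘(ℝ, EP).prod (𝓘(ℝ, F).prod 𝓘(ℝ, F))) 𝓘(ℝ, F) ∞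
      (fun z : P × (L × L) => z.2.1 * z.2.2) := h1.comp contMDiff_snd
  exact h2

theorem ev_one (hmul : ∀ f g p, ev (f * g) p = ev f p * ev g p) (p : P) : ev 1 p = 1 := by
  have h1 := hmul 1 1 p
  rw [mul_one] at h1
  exact mul_eq_left.1 h1.symm

theorem ev_inv (hmul : ∀ f g p, ev (f * g) p = ev f p * ev g p) (g : G) (p : P) :
    ev g⁻¹ p = (ev g p)⁻¹ := by
  rw [eq_inv_iff_mul_eq_one, ← hmul, inv_mul_cancel, ev_one hmul]

theorem isSuperposition_inv (hmul : ∀ f g p, ev (f * g) p = ev f p * ev g p) :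
    IsSuperposition (EP := EP) (bundle F L) (bundle F L) ev ev (fun x : G => x⁻¹) univ :=
  ⟨univ, fun z : P × L => z.2⁻¹, isOpen_univ,
    ((contMDiff_inv 𝓘(ℝ, F) ∞).comp contMDiff_snd).contMDiffOn,
    fun _ _ _ => ⟨trivial, ev_inv hmul _ _⟩⟩

theorem isSuperposition_mul_left (hmul : ∀ f g p, ev (f * g) p = ev f p * ev g p)
    (hG : Realizes (EP := EP) (bundle F L) ev) (g : G) :
    IsSuperposition (EP := EP) (bundle F L) (bundle F L) ev ev (fun x : G => g * x) univ :=
  ⟨univ, fun z : P × L => ev g z.1 * z.2, isOpen_univ,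
    (((hG.smooth g).comp contMDiff_fst).mul contMDiff_snd).contMDiffOn,
    fun _ _ _ => ⟨trivial, hmul _ _ _⟩⟩

theorem IsEquivariantMapSpace.isTopologicalGroup
    (hG : IsEquivariantMapSpace Q (bundle F L) β ev)
    (hmul : ∀ f g p, ev (f * g) p = ev f p * ev g p) [T2Space P] : IsTopologicalGroup G where
  continuous_mul := continuousOn_univ.1 ((isSuperposition_mul (EP := EP) hmul).continuousOn
    (hG.toRealizes.prod hG.toRealizes) hG.toRealizesInducing)
  continuous_inv := continuousOn_univ.1 ((isSuperposition_inv (EP := EP) hmul).continuousOn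
    hG.toRealizes hG.toRealizesInducing)

variable [AddCommGroup V] [Module ℝ V]

/-- The group of equivariant maps is a Lie group whose atlas consists of all charts given by
superposition. -/
theorem exists_lcLieGroup (h : IsSmoothAction EK F β)
    (hG : IsEquivariantMapSpace Q (bundle F L) β ev)
    (hV : IsEquivariantMapSpace Q (bundle F F) (fun k v => actionDeriv F β k v) lev)
    (hmul : ∀ f g p, ev (f * g) p = ev f p * ev g p) (hl : IsPointwiseLinear lev) :
    ∃ A : LCLieGroup V G, A.atlas = {e | IsSuperChart (EP := EP) (bundle F L) ev lev e} ∧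
      HasExpChart A ev lev := by
  haveI : T2Space P := Q.t2Space
  haveI : T2Space L := t2Space_of_lieGroup F L
  haveI := hV.toRealizesInducing.continuousAdd hl
  haveI := hV.toRealizesInducing.continuousSMul hl
  haveI := hG.isTopologicalGroup hmul
  obtain ⟨e, he, h0, hexp⟩ := exists_expChart h hG hV 0 hl.map_zero
  have hcl := fun g hg => hV.exists_lev_eq_of_tendsto (l := 𝓝[≠] (0 : ℝ)) g hg
  have key : ∀ f : G → G,
      IsSuperposition (EP := EP) (bundle F L) (bundle F L) ev ev f univ →
      ChartSmoothOn {e | IsSuperChart (EP := EP) (bundle F L) ev lev e}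
        {e | IsSuperChart (EP := EP) (bundle F L) ev lev e} f univ := fun f hf =>
    hf.chartSmoothOn (fun a ha => ha.2) (fun b hb => hb.1) isOpen_univ hG.toRealizes
      hG.toRealizesInducing hV.toRealizes hl hV.toRealizesInducing hl hV.injective hcl
  have hsymm : ∀ p, ev (e.symm 0) p = 1 := fun p => by
    rw [hexp 0 h0, hl.map_zero, lieExp_zero]
  refine ⟨⟨{e | IsSuperChart (EP := EP) (bundle F L) ev lev e},
    hG.t2Space (Y := bundle F L), fun g => ?_, fun a ha b hb => ?_, ?_, key _ (isSuperposition_inv hmul)⟩,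
    rfl, e, he, h0, hexp⟩
  -- Left translation is itself a superposition, so the translated exponential chart belongs to the
  -- atlas and covers `g`.
  · refine ⟨(Homeomorph.mulLeft g⁻¹).toOpenPartialHomeomorph.trans e, ⟨?_, ?_⟩, ?_⟩
    · exact he.1.comp ((isSuperposition_mul_left hmul hG.toRealizes g⁻¹).mono (subset_univ _))
        fun x hx => by simpa using hx
    · have h1 := ((isSuperposition_mul_left hmul hG.toRealizes g).comp he.2 (mapsTo_univ _ _))
      refine IsSuperposition.mono (t := ((Homeomorph.mulLeft g⁻¹).toOpenPartialHomeomorph.trans e).target)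
        (s := e.target) ?_ (by simp)
      convert h1 using 1
      funext x
      simp [Homeomorph.mulLeft_symm]
    · have h1 : e.symm 0 = 1 := hG.injective (funext fun p => by rw [hsymm, ev_one hmul])
      have h2 := e.map_target h0
      rw [h1] at h2
      simpa using h2
  -- Compatibility of charts is smoothness of the identity map.
  · have h1 : IsSuperposition (EP := EP) (bundle F L) (bundle F L) ev ev (fun x : G => x) univ :=
      ⟨univ, fun z : P × L => z.2, isOpen_univ, contMDiff_snd.contMDiffOn,
        fun _ _ _ => ⟨trivial, rfl⟩⟩
    simpa using (key _ h1).2 a ha b hb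
  · refine (isSuperposition_mul (EP := EP) hmul).chartSmoothOn
      (lev₁ := fun (c : V × V) p => (lev c.1 p, lev c.2 p)) ?_ (fun b hb => hb.1) isOpen_univ
      (hG.toRealizes.prod hG.toRealizes) hG.toRealizesInducing
      ((hV.toRealizes.comp_continuous continuous_fst).prodMk_space
        (hV.toRealizes.comp_continuous continuous_snd)) (hl.prod hl) hV.toRealizesInducing hl
      hV.injective hcl
    rintro - ⟨a, ha, b, hb, rfl⟩
    exact IsSuperChart.prod_symm ha hb

end LieGroupStructure

end

section

open BundledManifold

/-! ## Iterated tangent maps between vector spaces -/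

section Flat

/-- The model space of `Tⁿ E`, a product of `2ⁿ` copies of `E`. -/
abbrev iterModel (E : Type u) [NormedAddCommGroup E] [NormedSpace ℝ E] (n : ℕ) : Type u :=
  ((bundle E E).iterTangent n).E

/-- The iterated tangent bundle of a vector space. -/
abbrev iterSpace (E : Type u) [NormedAddCommGroup E] [NormedSpace ℝ E] (n : ℕ) : Type u :=
  ((bundle E E).iterTangent n).M

/-- The model with corners of the iterated tangent bundle of a vector space. -/
abbrev iterI (E : Type u) [NormedAddCommGroup E] [NormedSpace ℝ E] (n : ℕ) :
    ModelWithCorners ℝ (iterModel E n) ((bundle E E).iterTangent n).H :=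
  ((bundle E E).iterTangent n).I

variable {E : Type u} [NormedAddCommGroup E] [NormedSpace ℝ E]
  {F : Type v} [NormedAddCommGroup F] [NormedSpace ℝ F]

instance finiteDimensional_iterModel [FiniteDimensional ℝ E] (n : ℕ) :
    FiniteDimensional ℝ (iterModel E n) := by
  induction n with
  | zero => assumption
  | succ n ih => exact (inferInstance : FiniteDimensional ℝ (iterModel E n × iterModel E n))

instance completeSpace_iterModel [CompleteSpace E] (n : ℕ) : CompleteSpace (iterModel E n) := by
  induction n with
  | zero => assumption
  | succ n ih => exact (inferInstance : CompleteSpace (iterModel E n × iterModel E n))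

/-- The trivialization `Tⁿ E → E ^ (2ⁿ)`. -/
def flat (E : Type u) [NormedAddCommGroup E] [NormedSpace ℝ E] :
    (n : ℕ) → iterSpace E n → iterModel E n
  | 0 => id
  | n + 1 => fun w =>
    ((flat E n (Bundle.TotalSpace.proj w), (mfderiv (iterI E n) 𝓘(ℝ, iterModel E n) (flat E n)
      (Bundle.TotalSpace.proj w) : iterModel E n →L[ℝ] iterModel E n) (Bundle.TotalSpace.snd w)) :
      iterModel E n × iterModel E n)

/-- The inverse of `flat`. -/
def unflat (E : Type u) [NormedAddCommGroup E] [NormedSpace ℝ E] :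
    (n : ℕ) → iterModel E n → iterSpace E n
  | 0 => id
  | n + 1 => fun y : iterModel E n × iterModel E n =>
    tangentMap 𝓘(ℝ, iterModel E n) (iterI E n) (unflat E n) ⟨y.1, y.2⟩

theorem contMDiff_flat (n : ℕ) :
    ContMDiff (iterI E n) 𝓘(ℝ, iterModel E n) ∞ (flat E n) := by
  induction n with
  | zero => exact contMDiff_id
  | succ n ih =>
    have h1 := ih.contMDiff_tangentMap (m := ∞) (by simp)
    have h2 : ContMDiff (iterI E n).tangent 𝓘(ℝ, iterModel E n) ∞
        (fun w : TangentBundle (iterI E n) (iterSpace E n) => flat E n w.proj) :=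
      ih.comp (Bundle.contMDiff_proj (TangentSpace (iterI E n) (M := iterSpace E n)))
    have h3 := (contMDiff_snd_tangentBundle_modelSpace (n := ∞) (iterModel E n)
      𝓘(ℝ, iterModel E n)).comp h1
    exact h2.prodMk_space h3

theorem contMDiff_mk_tangentBundle :
    ContMDiff 𝓘(ℝ, E × E) 𝓘(ℝ, E).tangent ∞
      (fun y : E × E => (⟨y.1, y.2⟩ : TangentBundle 𝓘(ℝ, E) E)) := by
  intro y
  refine Bundle.contMDiffAt_totalSpace.2 ⟨contDiff_fst.contMDiff.contMDiffAt, ?_⟩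
  convert! (contDiff_snd (𝕜 := ℝ) (E := E) (F := E) (n := ∞)).contMDiff.contMDiffAt (x := y) with z
  simp only [mfld_simps]
  rfl

theorem contMDiff_unflat (n : ℕ) :
    ContMDiff 𝓘(ℝ, iterModel E n) (iterI E n) ∞ (unflat E n) := by
  induction n with
  | zero => exact contMDiff_id
  | succ n ih =>
    exact (ih.contMDiff_tangentMap (m := ∞) (by simp)).comp contMDiff_mk_tangentBundle

theorem unflat_flat (n : ℕ) (w : iterSpace E n) : unflat E n (flat E n w) = w := by
  induction n with
  | zero => rfl
  | succ n ih =>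
    have h1 : tangentMap (iterI E n) (iterI E n) (unflat E n ∘ flat E n) w =
        tangentMap 𝓘(ℝ, iterModel E n) (iterI E n) (unflat E n)
          (tangentMap (iterI E n) 𝓘(ℝ, iterModel E n) (flat E n) w) :=
      tangentMap_comp_at w ((contMDiff_unflat n).contMDiffAt.mdifferentiableAt (by simp))
        ((contMDiff_flat n).contMDiffAt.mdifferentiableAt (by simp))
    have h2 : unflat E n ∘ flat E n = id := funext ih
    rw [h2, tangentMap_id] at h1
    exact h1.symm

/-- The base point of an element of `E ^ (2ⁿ)`. -/
def flatBase (E : Type u) [NormedAddCommGroup E] [NormedSpace ℝ E] :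
    (n : ℕ) → iterModel E n → E
  | 0 => id
  | n + 1 => fun y : iterModel E n × iterModel E n => flatBase E n y.1

theorem iterProj_unflat (n : ℕ) (y : iterModel E n) :
    (bundle E E).iterProj n (unflat E n y) = flatBase E n y := by
  induction n with
  | zero => rfl
  | succ n ih => exact ih _

theorem continuous_flatBase (n : ℕ) : Continuous (flatBase E n) := by
  induction n with
  | zero => exact continuous_id
  | succ n ih =>
    exact ih.comp (continuous_fst : Continuous fun y : iterModel E n × iterModel E n => y.1)

/-- The iterated tangent map, as a map `E ^ (2ⁿ) → F ^ (2ⁿ)`. -/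
def flatMap (f : E → F) (n : ℕ) (y : iterModel E n) : iterModel F n :=
  flat F n (iterTangentMap (X := bundle E E) (Y := bundle F F) f n (unflat E n y))

variable {f g : E → F} {O : Set E}

theorem contDiffOn_flatMap (hO : IsOpen O) (hf : ContDiffOn ℝ ∞ f O) (n : ℕ) :
    ContDiffOn ℝ ∞ (flatMap f n) (flatBase E n ⁻¹' O) := by
  rw [← contMDiffOn_iff_contDiffOn]
  have h1 := contMDiffOn_iterTangentMap (X := bundle E E) (Y := bundle F F) hO
    (contMDiffOn_iff_contDiffOn.2 hf) n
  refine (contMDiff_flat n).comp_contMDiffOn (h1.comp (contMDiff_unflat n).contMDiffOn ?_)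
  intro y hy
  rwa [mem_preimage, mem_preimage, iterProj_unflat]

/-- The recursion behind all computations with iterated tangent maps on vector spaces: one more
tangent functor adds the Fréchet derivative of the previous level as second component. -/
theorem flatMap_succ (hO : IsOpen O) (hf : ContDiffOn ℝ ∞ f O) (n : ℕ)
    (y : iterModel E n × iterModel E n) (hy : flatBase E n y.1 ∈ O) :
    flatMap f (n + 1) y =
      ((flatMap f n y.1, fderiv ℝ (flatMap f n) y.1 y.2) : iterModel F n × iterModel F n) := by
  have h1 := contMDiffOn_iterTangentMap (X := bundle E E) (Y := bundle F F) hO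
    (contMDiffOn_iff_contDiffOn.2 hf) n
  have hy' : (bundle E E).iterProj n (unflat E n y.1) ∈ O := by rwa [iterProj_unflat]
  have h2 := (h1.contMDiffAt ((hO.preimage ((bundle E E).continuous_iterProj n)).mem_nhds
    hy')).mdifferentiableAt (by simp)
  have h3 := ((contMDiff_unflat (E := E) n).contMDiffAt (x := y.1)).mdifferentiableAt (by simp)
  have h4 := ((contMDiff_flat (E := F) n).contMDiffAt
    (x := iterTangentMap (X := bundle E E) (Y := bundle F F) f n (unflat E n y.1))).mdifferentiableAt
    (by simp)
  refine Prod.ext rfl ?_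
  have h5 := mfderiv_comp y.1 h4 (h2.comp y.1 h3)
  have h6 := mfderiv_comp y.1 h2 h3
  rw [h6] at h5
  have h7 : fderiv ℝ (flatMap f n) y.1 =
    (mfderiv 𝓘(ℝ, iterModel E n) 𝓘(ℝ, iterModel F n) (flatMap f n) y.1) := mfderiv_eq_fderiv.symm
  rw [h7]
  exact (congrArg (fun T : iterModel E n →L[ℝ] iterModel F n => T y.2) h5).symm

theorem flatMap_congr (hO : IsOpen O) (h : EqOn f g O) (n : ℕ) :
    EqOn (flatMap f n) (flatMap g n) (flatBase E n ⁻¹' O) := by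
  intro y hy
  rw [flatMap, flatMap, iterTangentMap_congr (X := bundle E E) (Y := bundle F F) hO h]
  rwa [iterProj_unflat]

theorem eventually_flatBase_mem (hO : IsOpen O) (n : ℕ) {y : iterModel E n}
    (hy : flatBase E n y ∈ O) : ∀ᶠ z in 𝓝 y, flatBase E n z ∈ O :=
  (hO.preimage (continuous_flatBase n)).mem_nhds hy

theorem differentiableAt_flatMap (hO : IsOpen O) (hf : ContDiffOn ℝ ∞ f O) (n : ℕ)
    {y : iterModel E n} (hy : flatBase E n y ∈ O) : DifferentiableAt ℝ (flatMap f n) y :=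
  ((contDiffOn_flatMap hO hf n).contDiffAt (eventually_flatBase_mem hO n hy)).differentiableAt
    (by simp)

theorem flatMap_add (hO : IsOpen O) (hf : ContDiffOn ℝ ∞ f O) (hg : ContDiffOn ℝ ∞ g O) (n : ℕ)
    {y : iterModel E n} (hy : flatBase E n y ∈ O) :
    flatMap (fun x => f x + g x) n y = flatMap f n y + flatMap g n y := by
  induction n with
  | zero => rfl
  | succ n ih =>
    have h1 : flatMap (fun x => f x + g x) n =ᶠ[𝓝 (y : iterModel E n × iterModel E n).1]
        fun z => flatMap f n z + flatMap g n z := by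
      filter_upwards [eventually_flatBase_mem hO n hy] with z hz using ih hz
    rw [flatMap_succ hO (hf.add hg) n y hy, flatMap_succ hO hf n y hy, flatMap_succ hO hg n y hy,
      h1.fderiv_eq, h1.self_of_nhds, fderiv_fun_add (differentiableAt_flatMap hO hf n hy)
        (differentiableAt_flatMap hO hg n hy)]
    rfl

theorem flatMap_smul (hO : IsOpen O) (hf : ContDiffOn ℝ ∞ f O) (c : ℝ) (n : ℕ)
    {y : iterModel E n} (hy : flatBase E n y ∈ O) :
    flatMap (fun x => c • f x) n y = c • flatMap f n y := by
  induction n with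
  | zero => rfl
  | succ n ih =>
    have h1 : flatMap (fun x => c • f x) n =ᶠ[𝓝 (y : iterModel E n × iterModel E n).1]
        fun z => c • flatMap f n z := by
      filter_upwards [eventually_flatBase_mem hO n hy] with z hz using ih hz
    rw [flatMap_succ hO (hf.const_smul c) n y hy, flatMap_succ hO hf n y hy,
      h1.fderiv_eq, h1.self_of_nhds, fderiv_fun_const_smul (differentiableAt_flatMap hO hf n hy)]
    rfl

/-- The flattened iterated tangent map over `O`, as a continuous map. -/
def flatContinuousMap (hO : IsOpen O) (hf : ContDiffOn ℝ ∞ f O) (n : ℕ) :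
    C(flatBase E n ⁻¹' O, iterModel F n) :=
  ⟨fun y => flatMap f n y, ((contDiffOn_flatMap hO hf n).continuousOn).domRestrict⟩

/-- Compact sets are carried back and forth by `flat` and `unflat`. Convergence thereby takes place
in spaces of continuous maps into normed spaces, which have a linear and a uniform structure. -/
theorem tendsto_flatContinuousMap_iff {A : Type*} {l : Filter A} {φ : A → E → F} (hO : IsOpen O)
    (hφ : ∀ a, ContDiffOn ℝ ∞ (φ a) O) (hf : ContDiffOn ℝ ∞ f O) :
    (∀ n, Tendsto (fun a => flatContinuousMap hO (hφ a) n) l (𝓝 (flatContinuousMap hO hf n))) ↔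
      SmTendsto (bundle E E) (bundle F F) O φ l f := by
  refine forall_congr' fun n => ?_
  rw [ContinuousMap.tendsto_nhds_compactOpen]
  constructor
  · intro h K hK hKO U hU hm
    have hb : ∀ w ∈ K, flatBase E n (flat E n w) ∈ O := fun w hw => by
      rw [← iterProj_unflat, unflat_flat]
      exact hKO hw
    have hc : ContinuousOn (fun w => flat E n w) K := (contMDiff_flat n).continuous.continuousOn
    have hK' : IsCompact {y : flatBase E n ⁻¹' O | (y : iterModel E n) ∈ flat E n '' K} := by
      refine Topology.IsInducing.subtypeVal.isCompact_preimage_iff ?_ |>.2 (hK.image_of_continuousOn hc)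
      rw [Subtype.range_coe]
      rintro - ⟨w, hw, rfl⟩
      exact hb w hw
    have h1 := h _ hK' (unflat F n ⁻¹' U) (hU.preimage (contMDiff_unflat n).continuous) ?_
    · filter_upwards [h1] with a ha w hw
      have h2 := ha (x := ⟨flat E n w, hb w hw⟩) (mem_image_of_mem _ hw)
      simp only [flatContinuousMap, ContinuousMap.coe_mk, flatMap, mem_preimage, unflat_flat] at h2
      exact h2
    · rintro ⟨-, hy⟩ ⟨w, hw, rfl⟩
      simp only [flatContinuousMap, ContinuousMap.coe_mk, flatMap, mem_preimage, unflat_flat]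
      exact hm hw
  · intro h K hK U hU hm
    have h1 := h (unflat E n '' (Subtype.val '' K))
      ((hK.image continuous_subtype_val).image (contMDiff_unflat n).continuous) ?_
      (flat F n ⁻¹' U) (hU.preimage (contMDiff_flat n).continuous) ?_
    · filter_upwards [h1] with a ha y hy
      exact ha (mem_image_of_mem _ (mem_image_of_mem _ hy))
    · rintro - ⟨-, ⟨y, hy, rfl⟩, rfl⟩
      rw [mem_preimage, iterProj_unflat]
      exact y.2
    · rintro - ⟨-, ⟨y, hy, rfl⟩, rfl⟩
      exact hm hy

end Flat

end

section

open BundledManifold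

/-! ### Closedness of smooth maps under convergence of all derivatives. -/

section Limits

variable {E : Type u} [NormedAddCommGroup E] [NormedSpace ℝ E] [FiniteDimensional ℝ E]
  {F : Type v} [NormedAddCommGroup F] [NormedSpace ℝ F] {O : Set E}

/-- Limits of smooth maps, all of whose iterated tangent maps converge, are smooth. -/
theorem exists_contDiffOn_of_tendsto_flat {ι : Type*} {l : Filter ι} [l.NeBot] (hO : IsOpen O)
    {φ : ι → E → F} (hφ : ∀ a, ContDiffOn ℝ ∞ (φ a) O) (g : ∀ n, C(flatBase E n ⁻¹' O, iterModel F n))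
    (hg : ∀ n, Tendsto (fun a => flatContinuousMap hO (hφ a) n) l (𝓝 (g n))) :
    ∃ (f : E → F) (hf : ContDiffOn ℝ ∞ f O), ∀ n, flatContinuousMap hO hf n = g n := by
  classical
  haveI := fun n => FiniteDimensional.proper ℝ (iterModel E n)
  let G : (n : ℕ) → iterModel E n → iterModel F n := fun n y =>
    if hy : flatBase E n y ∈ O then g n ⟨y, hy⟩ else 0
  have hG : ∀ n y (hy : flatBase E n y ∈ O), G n y = g n ⟨y, hy⟩ := fun n y hy => dif_pos hy
  have hpt : ∀ n y, flatBase E n y ∈ O → Tendsto (fun a => flatMap (φ a) n y) l (𝓝 (G n y)) := by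
    intro n y hy
    rw [hG n y hy]
    have h1 : Continuous fun h : C(flatBase E n ⁻¹' O, iterModel F n) => h ⟨y, hy⟩ :=
      continuous_eval_const _
    exact (h1.tendsto (g n)).comp (hg n)
  have hunif : ∀ n K, IsCompact K → K ⊆ flatBase E n ⁻¹' O →
      TendstoUniformlyOn (fun a => flatMap (φ a) n) (G n) l K := by
    intro n K hK hKO
    have h1 := ContinuousMap.tendsto_iff_forall_isCompact_tendstoUniformlyOn.1 (hg n)
      (Subtype.val ⁻¹' K) (Topology.IsInducing.subtypeVal.isCompact_preimage_iff
        (by rwa [Subtype.range_coe]) |>.2 hK)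
    intro u hu
    filter_upwards [h1 u hu] with a ha y hy
    have := ha ⟨y, hKO hy⟩ hy
    rwa [← hG] at this
  -- the derivative of `G n`
  have hlin : ∀ n y, flatBase E n y ∈ O → ∃ T : iterModel E n →L[ℝ] iterModel F n,
      ∀ v, (T v = (G (n + 1) ((y, v) : iterModel E n × iterModel E n) :
        iterModel F n × iterModel F n).2) := by
    intro n y hy
    have h1 : Tendsto (fun a v => fderiv ℝ (flatMap (φ a) n) y v) l
        (𝓝 fun v => (G (n + 1) ((y, v) : iterModel E n × iterModel E n) :
          iterModel F n × iterModel F n).2) := by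
      refine tendsto_pi_nhds.2 fun v => ?_
      have h2 := hpt (n + 1) ((y, v) : iterModel E n × iterModel E n) hy
      have h3 := ((continuous_snd :
        Continuous fun z : iterModel F n × iterModel F n => z.2).tendsto _).comp h2
      refine h3.congr fun a => ?_
      exact congrArg Prod.snd (flatMap_succ hO (hφ a) n (y, v) hy)
    exact ⟨LinearMap.toContinuousLinearMap (linearMapOfTendsto _
      (fun a => (fderiv ℝ (flatMap (φ a) n) y : iterModel E n →ₗ[ℝ] iterModel F n)) h1),
      fun v => rfl⟩
  choose! T hT using hlin
  have hderiv : ∀ n y, flatBase E n y ∈ O → HasFDerivAt (G n) (T n y) y := by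
    intro n y hy
    have hOn := hO.preimage (continuous_flatBase (E := E) n)
    refine hasFDerivAt_of_tendstoLocallyUniformlyOn (l := l) (f := fun a => flatMap (φ a) n)
      (f' := fun a => fderiv ℝ (flatMap (φ a) n)) hOn ?_ (fun a z hz =>
        (differentiableAt_flatMap hO (hφ a) n hz).hasFDerivAt) (fun z hz => hpt n z hz) hy
    rw [tendstoLocallyUniformlyOn_iff_forall_isCompact hOn]
    intro K hKO hK
    -- The product of `K` with the closed unit ball is compact in finite dimension, and uniform
    -- convergence of level `n + 1` on it is uniform convergence of the derivatives in operator
    -- norm.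
    have h1 := (Metric.tendstoUniformlyOn_iff (α := iterModel F n × iterModel F n)).1
      (hunif (n + 1) (K ×ˢ Metric.closedBall (0 : iterModel E n) 1)
        (hK.prod (isCompact_closedBall _ _)) (fun z hz => hKO hz.1))
    rw [Metric.tendstoUniformlyOn_iff]
    intro ε hε
    filter_upwards [h1 (ε / 2) (half_pos hε)] with a ha z hz
    rw [dist_eq_norm]
    refine lt_of_le_of_lt ?_ (half_lt_self hε)
    refine ContinuousLinearMap.opNorm_le_of_unit_norm (half_pos hε).le fun v hv => ?_
    have h2 := (ha (z, v) ⟨hz, by simp [hv]⟩).le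
    rw [flatMap_succ hO (hφ a) n (z, v) (hKO hz)] at h2
    rw [sub_apply, hT n z (hKO hz), ← dist_eq_norm]
    exact (le_max_right _ _).trans h2
  -- The derivative of level `n` is a component of level `n + 1`, so regularity is gained for all
  -- levels simultaneously by induction on `m`.
  have hsm : ∀ (m : ℕ) n, ContDiffOn ℝ m (G n) (flatBase E n ⁻¹' O) := by
    intro m
    induction m with
    | zero =>
      intro n
      exact contDiffOn_zero.2 fun y hy => (hderiv n y hy).continuousAt.continuousWithinAt
    | succ m ih =>
      intro n
      have hOn := hO.preimage (continuous_flatBase (E := E) n)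
      rw [Nat.cast_succ, contDiffOn_succ_iff_fderiv_of_isOpen hOn]
      refine ⟨fun y hy => (hderiv n y hy).differentiableAt.differentiableWithinAt, by simp, ?_⟩
      rw [contDiffOn_clm_apply]
      intro v
      have h1 : ContDiffOn ℝ m (fun y : iterModel E n => (G (n + 1)
          ((y, v) : iterModel E n × iterModel E n) : iterModel F n × iterModel F n).2)
          (flatBase E n ⁻¹' O) :=
        contDiff_snd.comp_contDiffOn ((ih (n + 1)).comp
          ((contDiff_id.prodMk contDiff_const : ContDiff ℝ m fun y : iterModel E n =>
            ((y, v) : iterModel E n × iterModel E n)).contDiffOn) fun y hy => hy)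
      refine h1.congr fun y hy => ?_
      rw [(hderiv n y hy).fderiv, hT n y hy]
  let G₀ : E → F := G 0
  have hf : ContDiffOn ℝ ∞ G₀ O := (contDiffOn_infty (𝕜 := ℝ) (E := E) (F := F)).2 fun m => hsm m 0
  have hflat : ∀ n y, flatBase E n y ∈ O → flatMap G₀ n y = G n y := by
    intro n
    induction n with
    | zero => exact fun y hy => rfl
    | succ n ih =>
      rintro ⟨y, v⟩ hy
      have h1 : flatMap G₀ n =ᶠ[𝓝 y] G n := by
        filter_upwards [eventually_flatBase_mem hO n hy] with z hz using ih z hz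
      rw [flatMap_succ hO hf n (y, v) hy]
      refine Prod.ext ?_ ?_
      · simp only
        rw [ih y hy]
        have h2 := ((continuous_fst :
          Continuous fun z : iterModel F n × iterModel F n => z.1).tendsto _).comp
          (hpt (n + 1) ((y, v) : iterModel E n × iterModel E n) hy)
        refine tendsto_nhds_unique (hpt n y hy) (h2.congr fun a => ?_)
        exact congrArg Prod.fst (flatMap_succ hO (hφ a) n (y, v) hy)
      · simp only
        rw [h1.fderiv_eq, (hderiv n y hy).fderiv, hT n y hy]
  refine ⟨G₀, hf, fun n => ContinuousMap.ext fun y => ?_⟩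
  exact (hflat n y y.2).trans (hG n y y.2)

end Limits

/-- Makes the target of the embedding in `IsEquivariantMapSpace.isFrechetSpace` a uniform group, so
that an inducing homomorphism into it is uniformly inducing. -/
instance instIsUniformAddGroupContinuousMap {X F : Type*} [TopologicalSpace X]
    [UniformSpace F] [AddCommGroup F] [IsUniformAddGroup F] : IsUniformAddGroup C(X, F) where
  uniformContinuous_sub := by
    rw [ContinuousMap.isUniformEmbedding_toUniformOnFunIsCompact.isUniformInducing.uniformContinuous_iff]
    have h1 := (ContinuousMap.isUniformEmbedding_toUniformOnFunIsCompact (α := X) (β := F)).uniformContinuous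
    exact uniformContinuous_sub.comp (h1.prodMap h1)

end

section

open BundledManifold

/-! ## Fréchet spaces of equivariant maps -/

section Frechet

variable {EM : Type u₁} {M : Type u₁} {EP P : Type u} {EK K : Type u₂}
  [NormedAddCommGroup EM] [NormedSpace ℝ EM] [FiniteDimensional ℝ EM]
  [TopologicalSpace M] [ChartedSpace EM M]
  [IsManifold 𝓘(ℝ, EM) ∞ M] [CompactSpace M] [T2Space M]
  [NormedAddCommGroup EP] [NormedSpace ℝ EP] [TopologicalSpace P] [ChartedSpace EP P]
  [IsManifold 𝓘(ℝ, EP) ∞ P]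
  [NormedAddCommGroup EK] [NormedSpace ℝ EK] [TopologicalSpace K] [ChartedSpace EK K] [Group K]
  [LieGroup 𝓘(ℝ, EK) ∞ K]
  {F : Type v} [NormedAddCommGroup F] [NormedSpace ℝ F]
  {Q : PrincipalBundle EM M EP P EK K} {A : K → F →L[ℝ] F}
  {V : Type*} [TopologicalSpace V] {lev : V → P → F}

theorem LocalTriv.contDiffOn_comp_σ (t : LocalTriv Q) {f : P → F}
    (hf : ContMDiff 𝓘(ℝ, EP) 𝓘(ℝ, F) ∞ f) : ContDiffOn ℝ ∞ (fun y => f (t.σ y)) t.O := by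
  rw [← contMDiffOn_iff_contDiffOn]
  exact hf.comp_contMDiffOn t.smooth_σ

theorem LocalTriv.isOpen_preimage (t : LocalTriv Q) : IsOpen (Q.proj ⁻¹' t.N) :=
  t.isOpen_N.preimage Q.smooth_proj.continuous

theorem LocalTriv.contMDiffOn_χ_proj (t : LocalTriv Q) :
    ContMDiffOn 𝓘(ℝ, EP) 𝓘(ℝ, EM) ∞ (fun p => t.χ (Q.proj p)) (Q.proj ⁻¹' t.N) :=
  t.smooth_χ.comp Q.smooth_proj.contMDiffOn fun _ hp => hp

theorem IsEquivariantMapSpace.eq_apply_σ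
    (hV : IsEquivariantMapSpace Q (bundle F F) (fun k v => A k v) lev) (t : LocalTriv Q) (v : V)
    {p : P} (hp : Q.proj p ∈ t.N) :
    lev v p = A (t.κ p) (lev v (t.σ (t.χ (Q.proj p)))) := by
  rw [← hV.equivariant, t.act_κ p hp]

/-- Convergence of equivariant maps can be tested in finitely many trivializations. -/
theorem IsEquivariantMapSpace.le_nhds_of_smTendsto [T2Space P]
    (hA : ContMDiff (𝓘(ℝ, EK).prod 𝓘(ℝ, F)) 𝓘(ℝ, F) ∞ (fun x : K × F => A x.1 x.2))
    (hV : IsEquivariantMapSpace Q (bundle F F) (fun k v => A k v) lev)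
    {n : ℕ} {t : Fin n → LocalTriv Q} {C : Fin n → Set M} (hCc : ∀ i, IsClosed (C i))
    (hCt : ∀ i, C i ⊆ (t i).N) (hC : ⋃ i, C i = univ) {l : Filter V} {v : V}
    (h : ∀ i, SmTendsto (bundle EM EM) (bundle F F) (t i).O (fun w y => lev w ((t i).σ y)) l
      (fun y => lev v ((t i).σ y))) : l ≤ 𝓝 v := by
  refine hV.le_nhds v l (SmTendsto.of_finite_cover (C := fun i => Q.proj ⁻¹' C i)
    (fun i => (hCc i).preimage Q.smooth_proj.continuous) (fun p _ => ?_) fun i => ?_)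
  · obtain ⟨i, hi⟩ := mem_iUnion.1 (hC ▸ mem_univ (Q.proj p))
    exact mem_iUnion.2 ⟨i, hi⟩
  have hsub : Q.proj ⁻¹' C i ⊆ Q.proj ⁻¹' (t i).N := preimage_mono (hCt i)
  have hsm : ∀ w, ContMDiffOn 𝓘(ℝ, EM) 𝓘(ℝ, F) ∞ (fun y => lev w ((t i).σ y)) (t i).O := fun w =>
    contMDiffOn_iff_contDiffOn.2 ((t i).contDiffOn_comp_σ (hV.smooth w))
  have h1 : SmTendsto (bundle EP P) (bundle F F) (Q.proj ⁻¹' C i)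
      (fun w p => lev w ((t i).σ ((t i).χ (Q.proj p)))) l
      (fun p => lev v ((t i).σ ((t i).χ (Q.proj p)))) :=
    (h i).comp_right (Z := bundle EP P) (s := fun p => (t i).χ (Q.proj p)) (t i).isOpen_O
      (t i).isOpen_preimage hsub (t i).contMDiffOn_χ_proj (Eventually.of_forall hsm) (hsm v)
      (fun p hp => (t i).mapsTo hp) (fun p hp => (t i).mapsTo (hCt i hp))
  have hsm' : ∀ w, ContMDiffOn 𝓘(ℝ, EP) 𝓘(ℝ, F) ∞
      (fun p => lev w ((t i).σ ((t i).χ (Q.proj p)))) (Q.proj ⁻¹' (t i).N) := fun w =>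
    (hsm w).comp (t i).contMDiffOn_χ_proj fun p hp => (t i).mapsTo hp
  have h2 : SmTendsto (bundle EP P) ((bundle EK K).prod (bundle F F)) (Q.proj ⁻¹' C i)
      (fun w p => ((t i).κ p, lev w ((t i).σ ((t i).χ (Q.proj p))))) l
      (fun p => ((t i).κ p, lev v ((t i).σ ((t i).χ (Q.proj p))))) :=
    SmTendsto.prodMk (Y := bundle EK K) smTendsto_const h1 (t i).isOpen_preimage hsub
      (Eventually.of_forall fun _ => (t i).smooth_κ) (t i).smooth_κ (Eventually.of_forall hsm')
      (hsm' v)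
  have hpair : ∀ w, ContMDiffOn 𝓘(ℝ, EP) (𝓘(ℝ, EK).prod 𝓘(ℝ, F)) ∞
      (fun p => ((t i).κ p, lev w ((t i).σ ((t i).χ (Q.proj p))))) (Q.proj ⁻¹' (t i).N) :=
    fun w => (t i).smooth_κ.prodMk (hsm' w)
  have h3 := h2.comp_left (Y := (bundle EK K).prod (bundle F F)) (Z := bundle F F)
    (φ := fun x : K × F => A x.1 x.2) (O := univ)
    (t i).isOpen_preimage hsub isOpen_univ hA.contMDiffOn (Eventually.of_forall hpair) (hpair v)
    (Eventually.of_forall fun _ => mapsTo_univ _ _) (mapsTo_univ _ _)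
  exact h3.congr (t i).isOpen_preimage hsub
    (Eventually.of_forall fun w p hp => hV.eq_apply_σ (t i) w hp)
    fun p hp => hV.eq_apply_σ (t i) v hp

variable [AddCommGroup V] [Module ℝ V] [CompleteSpace F]

/-- The spaces of equivariant maps with values in a Banach space are Fréchet spaces. -/
theorem IsEquivariantMapSpace.isFrechetSpace
    (hA : ContMDiff (𝓘(ℝ, EK).prod 𝓘(ℝ, F)) 𝓘(ℝ, F) ∞ (fun x : K × F => A x.1 x.2))
    (hV : IsEquivariantMapSpace Q (bundle F F) (fun k v => A k v) lev) (hl : IsPointwiseLinear lev) :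
    IsFrechetSpace V := by
  haveI : T2Space P := Q.t2Space
  haveI := hV.toRealizesInducing.isTopologicalAddGroup hl
  haveI := hV.toRealizesInducing.continuousSMul hl
  haveI := fun n => FiniteDimensional.proper ℝ (iterModel EM n)
  obtain ⟨n, t, C, hCc, hCt, hC⟩ := Q.exists_finite_localTriv
  haveI : ∀ (i : Fin n) (m : ℕ), LocallyCompactSpace (flatBase EM m ⁻¹' (t i).O) := fun i m =>
    ((t i).isOpen_O.preimage (continuous_flatBase m)).locallyCompactSpace
  -- A countable product. Each factor consists of maps from an open subset of a finite-dimensional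
  -- space to a Banach space, so it is metrizable and complete for compact convergence.
  let W := (x : Fin n × ℕ) → C(flatBase EM x.2 ⁻¹' (t x.1).O, iterModel F x.2)
  have hs : ∀ i v, ContDiffOn ℝ ∞ (fun y => lev v ((t i).σ y)) (t i).O := fun i v =>
    (t i).contDiffOn_comp_σ (hV.smooth v)
  let J : V →ₗ[ℝ] W :=
    { toFun := fun v x => flatContinuousMap (t x.1).isOpen_O (hs x.1 v) x.2
      map_add' := fun v w => by
        funext x
        refine ContinuousMap.ext fun y => ?_
        have h1 := flatMap_add (t x.1).isOpen_O (hs x.1 v) (hs x.1 w) x.2 y.2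
        simp only [← hl.map_add] at h1
        exact h1
      map_smul' := fun c v => by
        funext x
        refine ContinuousMap.ext fun y => ?_
        have h1 := flatMap_smul (t x.1).isOpen_O (hs x.1 v) c x.2 y.2
        simp only [← hl.map_smul] at h1
        exact h1 }
  have hJt : ∀ (l : Filter V) (v : V), Tendsto J l (𝓝 (J v)) ↔
      ∀ i, SmTendsto (bundle EM EM) (bundle F F) (t i).O (fun w y => lev w ((t i).σ y)) l
      (fun y => lev v ((t i).σ y)) := by
    intro l v
    rw [tendsto_pi_nhds]
    constructor
    · exact fun h i => (tendsto_flatContinuousMap_iff (t i).isOpen_O (hs i) (hs i v)).1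
        fun m => h (i, m)
    · exact fun h x => (tendsto_flatContinuousMap_iff (t x.1).isOpen_O (hs x.1) (hs x.1 v)).2
        (h x.1) x.2
  have hJi : IsInducing J := by
    rw [isInducing_iff_nhds]
    intro v
    refine le_antisymm ?_ ?_
    · rw [← tendsto_iff_comap, hJt]
      intro i
      exact (hV.smTendsto v).comp_right (Z := bundle EM EM) isOpen_univ (t i).isOpen_O subset_rfl
        (t i).smooth_σ (Eventually.of_forall fun w => (hV.smooth w).contMDiffOn)
        (hV.smooth v).contMDiffOn (mapsTo_univ _ _) (mapsTo_univ _ _)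
    · exact hV.le_nhds_of_smTendsto hA hCc hCt hC ((hJt _ v).1 tendsto_comap)
  have hJinj : Function.Injective J := by
    intro v w hvw
    refine hV.injective (funext fun p => ?_)
    obtain ⟨i, hi⟩ := mem_iUnion.1 (hC ▸ mem_univ (Q.proj p))
    rw [hV.eq_apply_σ (t i) v (hCt i hi), hV.eq_apply_σ (t i) w (hCt i hi)]
    have h1 := DFunLike.congr_fun (congrFun hvw (i, 0)) ⟨(t i).χ (Q.proj p), (t i).mapsTo (hCt i hi)⟩
    exact congrArg _ h1
  have hmet : TopologicalSpace.MetrizableSpace V := by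
    haveI : TopologicalSpace.MetrizableSpace W := UniformSpace.metrizableSpace
    exact (Topology.IsEmbedding.mk hJi hJinj).metrizableSpace
  refine ⟨inferInstance, inferInstance, ?_, hmet, ?_⟩
  · have h1 : (inferInstance : TopologicalSpace V) =
      TopologicalSpace.induced J inferInstance := hJi.eq_induced
    have h2 := LocallyConvexSpace.induced J
    rwa [← h1] at h2
  · letI := IsTopologicalAddGroup.rightUniformSpace V
    haveI : IsUniformAddGroup V := isUniformAddGroup_of_addCommGroup
    have hJu : IsUniformInducing J := AddMonoidHom.isUniformInducing_of_isInducing hJi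
    rw [completeSpace_iff_isComplete_range hJu]
    haveI : TopologicalSpace.MetrizableSpace W := UniformSpace.metrizableSpace
    -- The target is metrizable, so it suffices to follow sequences. The local limits are extended
    -- along the fibres by equivariance and agree on overlaps, all being pointwise limits of the
    -- same maps.
    refine IsClosed.isComplete (IsSeqClosed.isClosed ?_)
    intro u g hu hg
    choose v hv using hu
    obtain rfl : (fun a => J (v a)) = u := funext hv
    rw [tendsto_pi_nhds] at hg
    -- the limit exists locally
    have hloc := fun i => exists_contDiffOn_of_tendsto_flat (l := atTop) (t i).isOpen_O
      (fun a => hs i (v a)) (fun m => g (i, m)) (fun m => hg (i, m))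
    choose f hf hfg using hloc
    have hflim : ∀ i y, y ∈ (t i).O →
        Tendsto (fun a => lev (v a) ((t i).σ y)) atTop (𝓝 (f i y)) := by
      intro i y hy
      have h1 : Continuous fun h : C(flatBase EM 0 ⁻¹' (t i).O, iterModel F 0) =>
        h ⟨y, hy⟩ := continuous_eval_const _
      have h2 := (h1.tendsto (g (i, 0))).comp (hg (i, 0))
      rw [← hfg i 0] at h2
      exact h2
    have hlim : ∀ i p, Q.proj p ∈ (t i).N → Tendsto (fun a => lev (v a) p) atTop
        (𝓝 (A ((t i).κ p) (f i ((t i).χ (Q.proj p))))) := by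
      intro i p hp
      have h1 := ((A ((t i).κ p)).continuous.tendsto _).comp (hflim i _ ((t i).mapsTo hp))
      exact h1.congr fun a => (hV.eq_apply_σ (t i) (v a) hp).symm
    have hex : ∀ p, ∃ y, Tendsto (fun a => lev (v a) p) atTop (𝓝 y) := fun p => by
      obtain ⟨i, hi⟩ := mem_iUnion.1 (hC ▸ mem_univ (Q.proj p))
      exact ⟨_, hlim i p (hCt i hi)⟩
    choose φ hφ using hex
    have hφs : ContMDiff 𝓘(ℝ, EP) 𝓘(ℝ, F) ∞ φ := by
      intro p
      obtain ⟨i, hi⟩ := mem_iUnion.1 (hC ▸ mem_univ (Q.proj p))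
      have h1 : ContMDiffOn 𝓘(ℝ, EP) 𝓘(ℝ, F) ∞
          (fun p => A ((t i).κ p) (f i ((t i).χ (Q.proj p)))) (Q.proj ⁻¹' (t i).N) :=
        hA.comp_contMDiffOn ((t i).smooth_κ.prodMk
          ((contMDiffOn_iff_contDiffOn.2 (hf i)).comp (t i).contMDiffOn_χ_proj
            fun p hp => (t i).mapsTo hp))
      have h2 := (t i).isOpen_preimage.mem_nhds (show p ∈ Q.proj ⁻¹' (t i).N from hCt i hi)
      refine (h1.contMDiffAt h2).congr_of_eventuallyEq ?_
      filter_upwards [h2] with p' hp' using tendsto_nhds_unique (hφ p') (hlim i p' hp')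
    obtain ⟨b, hb⟩ := hV.exists_lev_eq_of_tendsto φ hφs ⟨v, hφ⟩
    refine ⟨b, funext fun x => ContinuousMap.ext fun y => ?_⟩
    rw [← hfg x.1 x.2]
    refine flatMap_congr (t x.1).isOpen_O (fun z hz => ?_) x.2 y.2
    simp only [hb]
    exact tendsto_nhds_unique (hφ _) (hflim x.1 z hz)

end Frechet

end

section

open BundledManifold

/-! ## Metrizable groups -/

/-- Birkhoff–Kakutani: the right uniformity is pulled back from the neighbourhoods of `1`, so it is
countably generated. -/
theorem IsTopologicalGroup.metrizableSpace_of_isCountablyGenerated {G : Type*} [Group G]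
    [TopologicalSpace G] [IsTopologicalGroup G] [T2Space G] [(𝓝 (1 : G)).IsCountablyGenerated] :
    TopologicalSpace.MetrizableSpace G := by
  letI := IsTopologicalGroup.rightUniformSpace G
  haveI : (uniformity G).IsCountablyGenerated := by
    change (comap (fun p : G × G => p.2 * p.1⁻¹) (𝓝 1)).IsCountablyGenerated
    infer_instance
  exact UniformSpace.metrizableSpace

theorem OpenPartialHomeomorph.isCountablyGenerated_nhds {X Y : Type*} [TopologicalSpace X]
    [TopologicalSpace Y] [FirstCountableTopology Y] (e : OpenPartialHomeomorph X Y) {x : X}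
    (hx : x ∈ e.source) : (𝓝 x).IsCountablyGenerated := by
  rw [← e.symm_map_nhds_eq hx]
  infer_instance

/-! ## The conjugation action -/

section Conj

variable {EK K F L : Type*} [NormedAddCommGroup EK] [NormedSpace ℝ EK] [TopologicalSpace K]
  [ChartedSpace EK K] [Group K] [LieGroup 𝓘(ℝ, EK) ∞ K]
  [NormedAddCommGroup F] [NormedSpace ℝ F] [TopologicalSpace L]
  [ChartedSpace F L] [Group L] [LieGroup 𝓘(ℝ, F) ∞ L]

/-- A surjective homomorphism with central kernel and smooth local sections. -/
structure IsCentralQuotient (EK F : Type*) {K L : Type*} [NormedAddCommGroup EK] [NormedSpace ℝ EK]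
    [TopologicalSpace K] [ChartedSpace EK K] [Group K] [NormedAddCommGroup F] [NormedSpace ℝ F]
    [TopologicalSpace L] [ChartedSpace F L] [Group L] (q : L →* K) : Prop where
  surjective : Function.Surjective q
  central : ∀ l, q l = 1 → ∀ x, l * x = x * l
  local_section : ∃ (U : Set K) (σ : K → L), IsOpen U ∧ (1 : K) ∈ U ∧
    ContMDiffOn 𝓘(ℝ, EK) 𝓘(ℝ, F) ∞ σ U ∧ ∀ k ∈ U, q (σ k) = k

theorem isCentralQuotient_id : IsCentralQuotient EK EK (MonoidHom.id K) where
  surjective k := ⟨k, rfl⟩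
  central l hl x := by
    obtain rfl : l = 1 := hl
    simp
  local_section := ⟨univ, id, isOpen_univ, trivial, contMDiffOn_id, fun _ _ => rfl⟩

theorem IsCentralExtension.isCentralQuotient {EZ Z : Type*} [NormedAddCommGroup EZ]
    [NormedSpace ℝ EZ] [TopologicalSpace Z] [ChartedSpace EZ Z] [Group Z] {ι : Z →* L} {q : L →* K}
    (h : IsCentralExtension (EZ := EZ) (EKhat := F) (EK := EK) ι q) : IsCentralQuotient EK F q where
  surjective := h.surjective
  central l hl x := by
    have h1 : l ∈ ι.range := by
      rw [h.exact]
      exact hl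
    obtain ⟨z, rfl⟩ := h1
    exact h.central z x
  local_section := by
    obtain ⟨U, σ, r, hU, h1, hσ, hq, -⟩ := h.local_section
    exact ⟨U, σ, hU, h1, hσ, hq⟩

open Classical in
/-- For a surjective homomorphism `q : L → K` with central kernel, the right action of `K` on `L`
by conjugation. -/
def conjAction (q : L →* K) (k : K) (x : L) : L :=
  if h : ∃ l, q l = k then h.choose⁻¹ * x * h.choose else x

variable {q : L →* K}

/-- The chosen preimage differs from `l` by an element of the kernel, which is central and drops out
of the conjugation. -/
theorem IsCentralQuotient.conjAction_apply (h : IsCentralQuotient EK F q) (l x : L) :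
    conjAction q (q l) x = l⁻¹ * x * l := by
  have hex : ∃ l', q l' = q l := ⟨l, rfl⟩
  rw [conjAction, dif_pos hex]
  set c := hex.choose
  have hc : q c = q l := hex.choose_spec
  have h1 : ∀ y, (c⁻¹ * l) * y = y * (c⁻¹ * l) := h.central _ (by rw [map_mul, map_inv, hc]; group)
  have h2 : l = c * (c⁻¹ * l) := by group
  rw [h2]
  calc c⁻¹ * x * c = (c⁻¹ * l)⁻¹ * ((c⁻¹ * l) * (c⁻¹ * x * c)) := by group
    _ = (c * (c⁻¹ * l))⁻¹ * x * (c * (c⁻¹ * l)) := by rw [h1 (c⁻¹ * x * c)]; group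

/-- Near `q c` the map `k ↦ c σ((q c)⁻¹ k)` is a smooth lift, and conjugation by a smooth lift is
smooth. -/
theorem IsCentralQuotient.isSmoothAction (h : IsCentralQuotient EK F q) :
    IsSmoothAction EK F (conjAction q) where
  smooth := by
    rintro ⟨k₀, x₀⟩
    obtain ⟨c, rfl⟩ := h.surjective k₀
    obtain ⟨U, σ, hU, h1, hσ, hq⟩ := h.local_section
    have hm : ContMDiff (𝓘(ℝ, EK).prod 𝓘(ℝ, F)) 𝓘(ℝ, EK) ∞
        (fun z : K × L => (q c)⁻¹ * z.1) := contMDiff_const.mul contMDiff_fst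
    have hs : ContMDiffOn (𝓘(ℝ, EK).prod 𝓘(ℝ, F)) 𝓘(ℝ, F) ∞
        (fun z : K × L => c * σ ((q c)⁻¹ * z.1)) ((fun z : K × L => (q c)⁻¹ * z.1) ⁻¹' U) :=
      contMDiffOn_const.mul (hσ.comp hm.contMDiffOn fun z hz => hz)
    have hnhds : (fun z : K × L => (q c)⁻¹ * z.1) ⁻¹' U ∈ 𝓝 (q c, x₀) :=
      (hU.preimage hm.continuous).mem_nhds (by simpa using h1)
    have h2 := (((hs.inv).mul contMDiffOn_snd).mul hs).contMDiffAt hnhds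
    refine h2.congr_of_eventuallyEq ?_
    filter_upwards [hnhds] with z hz
    have h3 : z.1 = q (c * σ ((q c)⁻¹ * z.1)) := by
      rw [map_mul, hq _ hz, mul_inv_cancel_left]
    conv_lhs => rw [h3]
    exact h.conjAction_apply _ _
  one x := by
    have := h.conjAction_apply 1 x
    simpa using this
  mul k l x := by
    obtain ⟨k, rfl⟩ := h.surjective k
    obtain ⟨l, rfl⟩ := h.surjective l
    rw [← map_mul, h.conjAction_apply, h.conjAction_apply, h.conjAction_apply]
    group
  map_mul k x y := by
    obtain ⟨k, rfl⟩ := h.surjective k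
    simp only [h.conjAction_apply]
    group

theorem IsCentralQuotient.actionDeriv_conjAction (h : IsCentralQuotient EK F q) (l : L) :
    actionDeriv F (conjAction q) (q l) = lieAd (F := F) l⁻¹ := by
  have h1 : conjAction q (q l) = fun x => l⁻¹ * x * l⁻¹⁻¹ := by
    funext x
    rw [h.conjAction_apply, inv_inv]
  rw [actionDeriv, h1]
  rfl

theorem isSmoothAction_trivial : IsSmoothAction EK F (fun (_ : K) (x : L) => x) where
  smooth := contMDiff_snd
  one _ := rfl
  mul _ _ _ := rfl
  map_mul _ _ _ := rfl

theorem actionDeriv_trivial (k : K) :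
    actionDeriv F (fun (_ : K) (x : L) => x) k = ContinuousLinearMap.id ℝ F :=
  mfderiv_id

end Conj

/-! ## Gauge groups, gauge algebras and mapping groups as spaces of equivariant maps -/

section Instances

variable {EM : Type u₁} {M : Type u₁} {EP P : Type u} {EK K : Type u₂}
  [NormedAddCommGroup EM] [NormedSpace ℝ EM] [TopologicalSpace M] [ChartedSpace EM M]
  [IsManifold 𝓘(ℝ, EM) ∞ M]
  [NormedAddCommGroup EP] [NormedSpace ℝ EP] [TopologicalSpace P] [ChartedSpace EP P]
  [IsManifold 𝓘(ℝ, EP) ∞ P]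
  [NormedAddCommGroup EK] [NormedSpace ℝ EK] [TopologicalSpace K] [ChartedSpace EK K] [Group K]
  [LieGroup 𝓘(ℝ, EK) ∞ K]
  {F : Type v} {L : Type v} [NormedAddCommGroup F] [NormedSpace ℝ F] [TopologicalSpace L]
  [ChartedSpace F L]

theorem realizesInducing_of_isInducing [IsManifold 𝓘(ℝ, F) ∞ L] {A : Type*} [TopologicalSpace A]
    {j : A → C^∞⟮𝓘(ℝ, EP), P; 𝓘(ℝ, F), L⟯} (hj : IsInducing j) :
    RealizesInducing (EP := EP) (bundle F L) (fun a p => j a p) where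
  smooth a := (j a).contMDiff
  smTendsto a := tendsto_smoothMap_iff.1 (hj.continuous.tendsto a)
  le_nhds a l h := by
    rw [hj.nhds_eq_comap, ← tendsto_iff_comap]
    exact tendsto_smoothMap_iff.2 h

variable [Group L] [LieGroup 𝓘(ℝ, F) ∞ L] {q : L →* K}

theorem isEquivariantMapSpace_gaugeGroup (Q : PrincipalBundle EM M EP P EK K)
    (h : IsCentralQuotient EK F q) :
    IsEquivariantMapSpace Q (bundle F L) (conjAction q) (fun (f : gaugeGroup F Q q) p => f.1 p) where
  toRealizesInducing := realizesInducing_of_isInducing Topology.IsInducing.subtypeVal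
  injective f g hfg := Subtype.ext (ContMDiffMap.ext fun p => congrFun hfg p)
  equivariant f p k := by
    obtain ⟨l, rfl⟩ := h.surjective k
    rw [h.conjAction_apply]
    exact f.2 p l
  exists_eq f hf hfe := ⟨⟨⟨f, hf⟩, fun p l => by
    rw [← h.conjAction_apply]
    exact hfe p (q l)⟩, rfl⟩

theorem isEquivariantMapSpace_gaugeAlgebra (Q : PrincipalBundle EM M EP P EK K)
    (h : IsCentralQuotient EK F q) :
    IsEquivariantMapSpace Q (bundle F F) (fun k v => actionDeriv F (conjAction q) k v)
      (fun (ξ : gaugeAlgebra F Q q) p => ξ.1 p) where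
  toRealizesInducing := realizesInducing_of_isInducing Topology.IsInducing.subtypeVal
  injective f g hfg := Subtype.ext (ContMDiffMap.ext fun p => congrFun hfg p)
  equivariant ξ p k := by
    obtain ⟨l, rfl⟩ := h.surjective k
    rw [h.actionDeriv_conjAction]
    exact ξ.2 p l
  exists_eq f hf hfe := ⟨⟨⟨f, hf⟩, fun p l => by
    rw [← h.actionDeriv_conjAction]
    exact hfe p (q l)⟩, rfl⟩

theorem isPointwiseLinear_gaugeAlgebra (Q : PrincipalBundle EM M EP P EK K) (q : L →* K) :
    IsPointwiseLinear (fun (ξ : gaugeAlgebra F Q q) p => ξ.1 p) :=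
  ⟨fun _ _ _ => rfl, fun _ _ _ => rfl⟩

theorem isPointwiseLinear_comp_proj (Q : PrincipalBundle EM M EP P EK K) :
    IsPointwiseLinear (fun (ξ : C^∞⟮𝓘(ℝ, EM), M; 𝓘(ℝ, F), F⟯) p => ξ (Q.proj p)) :=
  ⟨fun _ _ _ => rfl, fun _ _ _ => rfl⟩

end Instances

section MappingGroup

variable {EM : Type u₁} {M : Type u₁} {EP P : Type u} {EK K : Type u₂}
  [NormedAddCommGroup EM] [NormedSpace ℝ EM] [TopologicalSpace M] [ChartedSpace EM M]
  [IsManifold 𝓘(ℝ, EM) ∞ M] [CompactSpace M] [T2Space M]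
  [NormedAddCommGroup EP] [NormedSpace ℝ EP] [TopologicalSpace P] [ChartedSpace EP P]
  [IsManifold 𝓘(ℝ, EP) ∞ P]
  [NormedAddCommGroup EK] [NormedSpace ℝ EK] [TopologicalSpace K] [ChartedSpace EK K] [Group K]
  {F : Type v} {N : Type v} [NormedAddCommGroup F] [NormedSpace ℝ F] [TopologicalSpace N]
  [ChartedSpace F N] [IsManifold 𝓘(ℝ, F) ∞ N]

/-- Smooth maps on the base are the invariant smooth maps on the total space. -/
theorem isEquivariantMapSpace_comp_proj (Q : PrincipalBundle EM M EP P EK K) :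
    IsEquivariantMapSpace Q (bundle F N) (fun _ y => y)
      (fun (f : C^∞⟮𝓘(ℝ, EM), M; 𝓘(ℝ, F), N⟯) p => f (Q.proj p)) where
  smooth f := f.contMDiff.comp Q.smooth_proj
  smTendsto f := by
    have h1 : SmTendsto (bundle EM M) (bundle F N) univ
        (fun g : C^∞⟮𝓘(ℝ, EM), M; 𝓘(ℝ, F), N⟯ => g) (𝓝 f) f := tendsto_smoothMap_iff.1 tendsto_id
    exact h1.comp_right (Z := bundle EP P) isOpen_univ isOpen_univ subset_rfl
      Q.smooth_proj.contMDiffOn (Eventually.of_forall fun g => g.contMDiff.contMDiffOn)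
      f.contMDiff.contMDiffOn (mapsTo_univ _ _) (mapsTo_univ _ _)
  le_nhds f l h := by
    obtain ⟨n, t, C, hCc, hCt, hC⟩ := Q.exists_finite_localTriv
    refine (tendsto_id' (x := l) (y := 𝓝 f)).1 (tendsto_smoothMap_iff.2
      (SmTendsto.of_finite_cover hCc hC.ge fun i => ?_))
    -- Convergence on `P` is brought back to `M` by pulling back along local sections over a finite
    -- closed cover.
    have h1 := h.comp_right (Z := bundle EM M) (s := fun x => (t i).σ ((t i).χ x)) isOpen_univ
      (t i).isOpen_N (hCt i) ((t i).smooth_σ.comp (t i).smooth_χ (t i).mapsTo)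
      (Eventually.of_forall fun g => (g.contMDiff.comp Q.smooth_proj).contMDiffOn)
      (f.contMDiff.comp Q.smooth_proj).contMDiffOn (mapsTo_univ _ _) (mapsTo_univ _ _)
    exact h1.congr (t i).isOpen_N (hCt i)
      (Eventually.of_forall fun g x hx => congrArg g ((t i).proj_σ x hx).symm)
      fun x hx => congrArg f ((t i).proj_σ x hx).symm
  injective f g hfg := ContMDiffMap.ext fun x => by
    obtain ⟨p, rfl⟩ := Q.surjective_proj x
    exact congrFun hfg p
  equivariant f p k := by rw [Q.proj_act]
  exists_eq f hf hfe := by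
    have hs := Function.surjInv_eq Q.surjective_proj
    set s := Function.surjInv Q.surjective_proj
    have h1 : ∀ p p', Q.proj p = Q.proj p' → f p = f p' := by
      intro p p' hpp
      obtain ⟨t, ht⟩ := Q.exists_localTriv (Q.proj p)
      rw [← t.act_κ p ht, ← t.act_κ p' (hpp ▸ ht), hfe, hfe, hpp]
    -- The set-theoretic section `s` has no regularity; since `f` is constant on fibres it may be
    -- replaced locally by a smooth section.
    refine ⟨⟨fun x => f (s x), fun x => ?_⟩, funext fun p => h1 _ _ (hs _)⟩
    obtain ⟨t, ht⟩ := Q.exists_localTriv x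
    have h2 : ContMDiffOn 𝓘(ℝ, EM) 𝓘(ℝ, F) ∞ (fun x => f (t.σ (t.χ x))) t.N :=
      hf.comp_contMDiffOn (t.smooth_σ.comp t.smooth_χ t.mapsTo)
    refine (h2.contMDiffAt (t.isOpen_N.mem_nhds ht)).congr_of_eventuallyEq ?_
    filter_upwards [t.isOpen_N.mem_nhds ht] with y hy
    exact h1 _ _ ((hs y).trans (t.proj_σ y hy).symm)

theorem isEquivariantMapSpace_comp_proj_deriv {L : Type v} [TopologicalSpace L] [ChartedSpace F L]
    [Group L] [LieGroup 𝓘(ℝ, F) ∞ L] [LieGroup 𝓘(ℝ, EK) ∞ K] (Q : PrincipalBundle EM M EP P EK K) :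
    IsEquivariantMapSpace Q (bundle F F) (fun k v => actionDeriv F (fun (_ : K) (x : L) => x) k v)
      (fun (f : C^∞⟮𝓘(ℝ, EM), M; 𝓘(ℝ, F), F⟯) p => f (Q.proj p)) := by
  have h1 : (fun (k : K) (v : F) => actionDeriv F (fun (_ : K) (x : L) => x) k v) =
      fun _ v => v := by
    funext k v
    rw [actionDeriv_trivial]
    rfl
  rw [h1]
  exact isEquivariantMapSpace_comp_proj Q

end MappingGroup

end

section

open BundledManifold

/-! ## Central extensions -/

section CentralExtension

variable {EZ Z EKhat Khat EK K : Type*}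
  [NormedAddCommGroup EK] [NormedSpace ℝ EK]
  [TopologicalSpace K] [ChartedSpace EK K] [Group K] [LieGroup 𝓘(ℝ, EK) ∞ K]
  [NormedAddCommGroup EKhat] [NormedSpace ℝ EKhat]
  [TopologicalSpace Khat] [ChartedSpace EKhat Khat] [Group Khat] [LieGroup 𝓘(ℝ, EKhat) ∞ Khat]
  [NormedAddCommGroup EZ] [NormedSpace ℝ EZ]
  [TopologicalSpace Z] [ChartedSpace EZ Z] [Group Z] [LieGroup 𝓘(ℝ, EZ) ∞ Z]
  {ι : Z →* Khat} {q : Khat →* K}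

/-- The inclusion of the kernel has an inverse that extends smoothly to a neighbourhood. -/
theorem IsCentralExtension.exists_leftInverse
    (h : IsCentralExtension (EZ := EZ) (EKhat := EKhat) (EK := EK) ι q) :
    ∃ (O : Set Khat) (ρ : Khat → Z), IsOpen O ∧ ContMDiffOn 𝓘(ℝ, EKhat) 𝓘(ℝ, EZ) ∞ ρ O ∧
      ∀ g, q g = 1 → g ∈ O ∧ ι (ρ g) = g := by
  obtain ⟨U, σ, r, hU, h1, hσ, hq, hr, hg⟩ := h.local_section
  -- Nothing forces `σ 1 = 1`. Comparing the decompositions `1 = σ 1 * ι (r 1)` and `g = σ 1 * ι (r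
  -- g)` explains the correction by `(r 1)⁻¹`.
  refine ⟨q ⁻¹' U, fun g => (r 1)⁻¹ * r g, hU.preimage h.smooth_proj.continuous,
    contMDiffOn_const.mul hr, fun g hg1 => ⟨by simpa [hg1] using h1, ?_⟩⟩
  have e1 := hg 1 (by simpa using h1)
  have e2 := hg g (by simpa [hg1] using h1)
  rw [map_one] at e1
  rw [hg1] at e2
  rw [map_mul, map_inv]
  conv_rhs => rw [e2]
  congr 1
  rw [eq_comm, eq_inv_iff_mul_eq_one]
  exact e1.symm

/-- The derivative of `q` at `1`. -/
def projDeriv (EKhat EK : Type*) {Khat K : Type*} [NormedAddCommGroup EK] [NormedSpace ℝ EK]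
    [TopologicalSpace K] [ChartedSpace EK K] [Group K]
    [NormedAddCommGroup EKhat] [NormedSpace ℝ EKhat]
    [TopologicalSpace Khat] [ChartedSpace EKhat Khat] [Group Khat] (q : Khat →* K) :
    EKhat →L[ℝ] EK :=
  mfderiv 𝓘(ℝ, EKhat) 𝓘(ℝ, EK) q 1

/-- The derivative of `q` at `1` has a continuous linear right inverse. -/
theorem IsCentralExtension.exists_projDeriv_rightInverse
    (h : IsCentralExtension (EZ := EZ) (EKhat := EKhat) (EK := EK) ι q) :
    ∃ τ : EK →L[ℝ] EKhat, ∀ v, projDeriv EKhat EK q (τ v) = v := by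
  obtain ⟨U, σ, r, hU, h1, hσ, hq, hr, hg⟩ := h.local_section
  -- The section is normalized to pass through `1`, so that its derivative at `1` is a right inverse
  -- of the derivative of `q` at `1`.
  have hs : ContMDiffOn 𝓘(ℝ, EK) 𝓘(ℝ, EKhat) ∞ (fun k => (σ 1)⁻¹ * σ k) U :=
    contMDiffOn_const.mul hσ
  have hs1 := (hs.contMDiffAt (hU.mem_nhds h1)).mdifferentiableAt (by simp)
  have e1 : (σ 1)⁻¹ * σ 1 = 1 := inv_mul_cancel _
  have hq1 : MDifferentiableAt 𝓘(ℝ, EKhat) 𝓘(ℝ, EK) q ((σ 1)⁻¹ * σ 1) :=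
    (h.smooth_proj.contMDiffAt).mdifferentiableAt (by simp)
  have h2 := mfderiv_comp (1 : K) hq1 hs1
  have h3 : (q ∘ fun k => (σ 1)⁻¹ * σ k) =ᶠ[𝓝 1] id := by
    filter_upwards [hU.mem_nhds h1] with k hk
    simp [hq k hk, hq 1 h1]
  have h4 := h3.mfderiv_eq (I := 𝓘(ℝ, EK)) (I' := 𝓘(ℝ, EK))
  have h5 : (mfderiv 𝓘(ℝ, EKhat) 𝓘(ℝ, EK) q ((σ 1)⁻¹ * σ 1) : EKhat →L[ℝ] EK) =
    projDeriv EKhat EK q := by rw [e1]; rfl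
  refine ⟨mfderiv 𝓘(ℝ, EK) 𝓘(ℝ, EKhat) (fun k => (σ 1)⁻¹ * σ k) 1, fun v => ?_⟩
  rw [← h5]
  have h6 : (mfderiv 𝓘(ℝ, EK) 𝓘(ℝ, EK) (q ∘ fun k => (σ 1)⁻¹ * σ k) 1 : EK →L[ℝ] EK) v = v := by
    have h7 : (mfderiv 𝓘(ℝ, EK) 𝓘(ℝ, EK) (q ∘ fun k => (σ 1)⁻¹ * σ k) 1 : EK →L[ℝ] EK) =
      (mfderiv 𝓘(ℝ, EK) 𝓘(ℝ, EK) (id : K → K) 1 : EK →L[ℝ] EK) := h4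
    rw [h7, mfderiv_id]
    rfl
  exact (congrArg (fun T : EK →L[ℝ] EK => T v) h2).symm.trans h6

/-- Differentiate at `1` the relation that `q` intertwines the two conjugation actions. -/
theorem IsCentralExtension.projDeriv_actionDeriv
    (h : IsCentralExtension (EZ := EZ) (EKhat := EKhat) (EK := EK) ι q) (k : K) (v : EKhat) :
    projDeriv EKhat EK q (actionDeriv EKhat (conjAction q) k v) =
      actionDeriv EK (conjAction (MonoidHom.id K)) k (projDeriv EKhat EK q v) := by
  have hq := h.isCentralQuotient
  have hi := isCentralQuotient_id (EK := EK) (K := K)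
  have h1 : q ∘ conjAction q k = conjAction (MonoidHom.id K) k ∘ q := by
    obtain ⟨l, rfl⟩ := hq.surjective k
    funext x
    have e := hi.conjAction_apply (q l) (q x)
    simp only [MonoidHom.id_apply] at e
    simp only [Function.comp_apply]
    rw [hq.conjAction_apply, e, map_mul, map_mul, map_inv]
  have hb : MDifferentiableAt 𝓘(ℝ, EKhat) 𝓘(ℝ, EKhat) (conjAction q k) 1 :=
    (hq.isSmoothAction.smooth_apply k).contMDiffAt.mdifferentiableAt (by simp)
  have hb' : MDifferentiableAt 𝓘(ℝ, EK) 𝓘(ℝ, EK) (conjAction (MonoidHom.id K) k) (q 1) :=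
    (hi.isSmoothAction.smooth_apply k).contMDiffAt.mdifferentiableAt (by simp)
  have hqd : ∀ x, MDifferentiableAt 𝓘(ℝ, EKhat) 𝓘(ℝ, EK) q x := fun x =>
    h.smooth_proj.contMDiffAt.mdifferentiableAt (by simp)
  have h2 := mfderiv_comp (1 : Khat) (hqd _) hb
  have h3 := mfderiv_comp (1 : Khat) hb' (hqd 1)
  rw [h1, h3] at h2
  have h4 : (mfderiv 𝓘(ℝ, EKhat) 𝓘(ℝ, EK) q (conjAction q k 1) : EKhat →L[ℝ] EK) =
    projDeriv EKhat EK q := by rw [hq.isSmoothAction.map_one]; rfl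
  have h5 : (mfderiv 𝓘(ℝ, EK) 𝓘(ℝ, EK) (conjAction (MonoidHom.id K) k) (q 1) : EK →L[ℝ] EK) =
    actionDeriv EK (conjAction (MonoidHom.id K)) k := by rw [map_one]; rfl
  have h6 : (mfderiv 𝓘(ℝ, EKhat) 𝓘(ℝ, EK) q (conjAction q k 1) : EKhat →L[ℝ] EK)
      (actionDeriv EKhat (conjAction q) k v) =
      (mfderiv 𝓘(ℝ, EK) 𝓘(ℝ, EK) (conjAction (MonoidHom.id K) k) (q 1) : EK →L[ℝ] EK)
        (projDeriv EKhat EK q v) := (congrArg (fun T : EKhat →L[ℝ] EK => T v) h2).symm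
  rwa [h4, h5] at h6

end CentralExtension

/-! ### Equivariant linear splittings of the derivative of `q`. -/

section EquivariantSplitting

variable {EM M EP P EZ Z EKhat Khat EK K : Type*}
  [NormedAddCommGroup EM] [NormedSpace ℝ EM] [FiniteDimensional ℝ EM]
  [TopologicalSpace M] [ChartedSpace EM M] [IsManifold 𝓘(ℝ, EM) ∞ M] [CompactSpace M] [T2Space M]
  [NormedAddCommGroup EP] [NormedSpace ℝ EP]
  [TopologicalSpace P] [ChartedSpace EP P] [IsManifold 𝓘(ℝ, EP) ∞ P]
  [NormedAddCommGroup EK] [NormedSpace ℝ EK]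
  [TopologicalSpace K] [ChartedSpace EK K] [Group K] [LieGroup 𝓘(ℝ, EK) ∞ K]
  [NormedAddCommGroup EKhat] [NormedSpace ℝ EKhat]
  [TopologicalSpace Khat] [ChartedSpace EKhat Khat] [Group Khat] [LieGroup 𝓘(ℝ, EKhat) ∞ Khat]
  [NormedAddCommGroup EZ] [NormedSpace ℝ EZ]
  [TopologicalSpace Z] [ChartedSpace EZ Z] [Group Z] [LieGroup 𝓘(ℝ, EZ) ∞ Z]
  {ι : Z →* Khat} {q : Khat →* K}

/-- The derivative of `q` has a smooth equivariant family of linear right inverses over `P`. -/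
theorem exists_equivariant_splitting (Q : PrincipalBundle EM M EP P EK K)
    (h : IsCentralExtension (EZ := EZ) (EKhat := EKhat) (EK := EK) ι q) :
    ∃ T : P × EK → EKhat,
      ContMDiff (𝓘(ℝ, EP).prod 𝓘(ℝ, EK)) 𝓘(ℝ, EKhat) ∞ T ∧ (∀ p, T (p, 0) = 0) ∧
      (∀ p v, projDeriv EKhat EK q (T (p, v)) = v) ∧
      ∀ p k v, T (Q.act p k, actionDeriv EK (conjAction (MonoidHom.id K)) k v) =
        actionDeriv EKhat (conjAction q) k (T (p, v)) := by
  obtain ⟨τ, hτ⟩ := h.exists_projDeriv_rightInverse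
  have hA := h.isCentralQuotient.isSmoothAction
  have hB := (isCentralQuotient_id (EK := EK) (K := K)).isSmoothAction
  obtain ⟨n, t, C, hCc, hCt, hC⟩ := Q.exists_finite_localTriv
  -- Being a right inverse is an affine condition, so local splittings can be averaged. The weights
  -- are functions on `M`, hence constant along the fibres, and preserve equivariance.
  obtain ⟨χ, hχ⟩ := SmoothPartitionOfUnity.exists_isSubordinate 𝓘(ℝ, EM) isClosed_univ
    (fun i => (t i).N) (fun i => (t i).isOpen_N)
    (fun x _ => by
      obtain ⟨i, hi⟩ := mem_iUnion.1 (hC ▸ mem_univ x)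
      exact mem_iUnion.2 ⟨i, hCt i hi⟩)
  have hmem : ∀ i x, χ i x ≠ 0 → x ∈ (t i).N := fun i x hx => hχ i (subset_tsupport _ hx)
  have hsum : ∀ x, ∑ i, χ i x = 1 := fun x => by
    rw [← finsum_eq_sum_of_fintype]
    exact χ.sum_eq_one (mem_univ x)
  -- The equivariant family over the `i`-th trivialization that equals `τ` where the `K`-coordinate
  -- is `1`.
  let S : Fin n → P × EK → EKhat := fun i z =>
    actionDeriv EKhat (conjAction q) ((t i).κ z.1)
      (τ (actionDeriv EK (conjAction (MonoidHom.id K)) ((t i).κ z.1)⁻¹ z.2))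
  have hS : ∀ i, ContMDiffOn (𝓘(ℝ, EP).prod 𝓘(ℝ, EK)) 𝓘(ℝ, EKhat) ∞ (S i)
      ((fun z : P × EK => z.1) ⁻¹' (Q.proj ⁻¹' (t i).N)) := by
    intro i
    have h1 : ContMDiffOn (𝓘(ℝ, EP).prod 𝓘(ℝ, EK)) 𝓘(ℝ, EK) ∞ (fun z : P × EK => (t i).κ z.1)
        ((fun z : P × EK => z.1) ⁻¹' (Q.proj ⁻¹' (t i).N)) :=
      (t i).smooth_κ.comp contMDiff_fst.contMDiffOn fun z hz => hz
    have h2 := hB.contMDiff_deriv_apply.comp_contMDiffOn (h1.inv.prodMk contMDiffOn_snd)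
    exact hA.contMDiff_deriv_apply.comp_contMDiffOn
      (h1.prodMk (τ.contDiff.contMDiff.comp_contMDiffOn h2))
  refine ⟨fun z => ∑ i, χ i (Q.proj z.1) • S i z, ?_, ?_, ?_, ?_⟩
  · have h1 : ∀ i, ContMDiff (𝓘(ℝ, EP).prod 𝓘(ℝ, EK)) 𝓘(ℝ, EKhat) ∞
        (fun z : P × EK => χ i (Q.proj z.1) • S i z) := by
      intro i z
      have hπ : ContMDiff (𝓘(ℝ, EP).prod 𝓘(ℝ, EK)) 𝓘(ℝ, EM) ∞ (fun z : P × EK => Q.proj z.1) :=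
        Q.smooth_proj.comp contMDiff_fst
      by_cases hz : Q.proj z.1 ∈ tsupport (χ i)
      · have h2 : (fun z : P × EK => z.1) ⁻¹' (Q.proj ⁻¹' (t i).N) ∈ 𝓝 z :=
          ((t i).isOpen_N.preimage hπ.continuous).mem_nhds (hχ i hz)
        exact (((χ i).contMDiff.comp hπ).contMDiffAt).smul ((hS i).contMDiffAt h2)
      · have h2 : ∀ᶠ y : P × EK in 𝓝 z, Q.proj y.1 ∈ (tsupport (χ i))ᶜ :=
          hπ.continuous.continuousAt.eventually ((isClosed_tsupport _).isOpen_compl.mem_nhds hz)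
        refine (contMDiffAt_const (c := (0 : EKhat))).congr_of_eventuallyEq ?_
        filter_upwards [h2] with y hy
        rw [image_eq_zero_of_notMem_tsupport hy, zero_smul]
    exact contMDiff_finsetSum fun i _ => h1 i
  · intro p
    simp [S]
  · intro p v
    simp only [map_sum, map_smul, S]
    rw [Finset.sum_congr rfl fun i _ => by
      rw [h.projDeriv_actionDeriv, hτ, hB.deriv_apply_inv], ← Finset.sum_smul, hsum, one_smul]
  · intro p k v
    simp only [map_sum, map_smul, S, Q.proj_act]
    refine Finset.sum_congr rfl fun i _ => ?_
    -- Off the trivialization the coordinate `κ` need not be equivariant, but there the weight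
    -- vanishes.
    by_cases hi : χ i (Q.proj p) = 0
    · simp [hi]
    · rw [(t i).κ_act p k (hmem i _ hi), mul_inv_rev, hB.deriv_mul, hB.deriv_inv_apply,
        hA.deriv_mul]

end EquivariantSplitting

end

section

open BundledManifold

/-! ## The extension of gauge groups -/

section GaugeExtension

variable {EM M : Type u₁} {EP P : Type u₂} {EK K : Type u₃} {EKhat Khat : Type u₄} {EZ Z : Type u₅}
  [NormedAddCommGroup EM] [NormedSpace ℝ EM] [FiniteDimensional ℝ EM]
  [TopologicalSpace M] [ChartedSpace EM M] [IsManifold 𝓘(ℝ, EM) ∞ M] [CompactSpace M] [T2Space M]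
  [NormedAddCommGroup EP] [NormedSpace ℝ EP]
  [TopologicalSpace P] [ChartedSpace EP P] [IsManifold 𝓘(ℝ, EP) ∞ P]
  [NormedAddCommGroup EK] [NormedSpace ℝ EK]
  [TopologicalSpace K] [ChartedSpace EK K] [Group K] [LieGroup 𝓘(ℝ, EK) ∞ K]
  [NormedAddCommGroup EKhat] [NormedSpace ℝ EKhat]
  [TopologicalSpace Khat] [ChartedSpace EKhat Khat] [Group Khat] [LieGroup 𝓘(ℝ, EKhat) ∞ Khat]
  [NormedAddCommGroup EZ] [NormedSpace ℝ EZ]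
  [TopologicalSpace Z] [ChartedSpace EZ Z] [Group Z] [LieGroup 𝓘(ℝ, EZ) ∞ Z]
  (Q : PrincipalBundle EM M EP P EK K) {ι : Z →* Khat} {q : Khat →* K}
  (h : IsCentralExtension (EZ := EZ) (EKhat := EKhat) (EK := EK) ι q)

theorem isSuperposition_gaugeIncl :
    IsSuperposition (EP := EP) (bundle EZ Z) (bundle EKhat Khat)
      (fun (z : C^∞⟮𝓘(ℝ, EM), M; 𝓘(ℝ, EZ), Z⟯) p => z (Q.proj p))
      (fun (f : gaugeGroup EKhat Q q) p => f.1 p) (gaugeIncl Q h) univ :=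
  ⟨univ, fun x => ι x.2, isOpen_univ, (h.smooth_incl.comp contMDiff_snd).contMDiffOn,
    fun _ _ _ => ⟨trivial, rfl⟩⟩

theorem isSuperposition_gaugeProj :
    IsSuperposition (EP := EP) (bundle EKhat Khat) (bundle EK K)
      (fun (f : gaugeGroup EKhat Q q) p => f.1 p)
      (fun (f : gaugeGroup EK Q (MonoidHom.id K)) p => f.1 p) (gaugeProj Q h) univ :=
  ⟨univ, fun x => q x.2, isOpen_univ, (h.smooth_proj.comp contMDiff_snd).contMDiffOn,
    fun _ _ _ => ⟨trivial, rfl⟩⟩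

theorem gaugeIncl_injective : Function.Injective (gaugeIncl Q h) := by
  intro z w hzw
  refine ContMDiffMap.ext fun x => ?_
  obtain ⟨p, rfl⟩ := Q.surjective_proj x
  exact h.injective (DFunLike.congr_fun (congrArg Subtype.val hzw) p)

theorem gaugeIncl_central (z : C^∞⟮𝓘(ℝ, EM), M; 𝓘(ℝ, EZ), Z⟯) (f : gaugeGroup EKhat Q q) :
    gaugeIncl Q h z * f = f * gaugeIncl Q h z :=
  Subtype.ext (ContMDiffMap.ext fun p => h.central (z (Q.proj p)) (f.1 p))

/-- On the kernel of `gaugeProj`, the inverse of `gaugeIncl` is given by superposition. -/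
theorem exists_kernel_inverse :
    ∃ R : gaugeGroup EKhat Q q → C^∞⟮𝓘(ℝ, EM), M; 𝓘(ℝ, EZ), Z⟯,
      IsSuperposition (EP := EP) (bundle EKhat Khat) (bundle EZ Z)
        (fun (f : gaugeGroup EKhat Q q) p => f.1 p)
        (fun (z : C^∞⟮𝓘(ℝ, EM), M; 𝓘(ℝ, EZ), Z⟯) p => z (Q.proj p)) R
        {f | gaugeProj Q h f = 1} ∧
      ∀ f, gaugeProj Q h f = 1 → gaugeIncl Q h (R f) = f := by
  obtain ⟨O, ρ, hO, hρ, hρι⟩ := h.exists_leftInverse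
  have hker : ∀ f, gaugeProj Q h f = 1 → ∀ p, q (f.1 p) = 1 := fun f hf p =>
    DFunLike.congr_fun (congrArg Subtype.val hf) p
  have hex : ∀ f, gaugeProj Q h f = 1 → ∃ z : C^∞⟮𝓘(ℝ, EM), M; 𝓘(ℝ, EZ), Z⟯,
      (fun p => z (Q.proj p)) = fun p => ρ (f.1 p) := by
    intro f hf
    refine (isEquivariantMapSpace_comp_proj Q).exists_eq _ ?_ fun p k => ?_
    · rw [← contMDiffOn_univ]
      exact hρ.comp f.1.contMDiff.contMDiffOn fun p _ => (hρι _ (hker f hf p)).1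
    -- The values of `f` lie in the kernel of `q`, hence are central, and equivariance becomes
    -- invariance.
    · obtain ⟨l, rfl⟩ := h.surjective k
      have h1 := h.isCentralQuotient.central _ (hker f hf p) l
      rw [f.2 p l, mul_assoc, h1, inv_mul_cancel_left]
  choose! R hR using hex
  refine ⟨R, ⟨univ ×ˢ O, fun x => ρ x.2, isOpen_univ.prod hO,
    hρ.comp contMDiffOn_snd fun x hx => hx.2,
    fun f hf p => ⟨⟨trivial, (hρι _ (hker f hf p)).1⟩, congrFun (hR f hf) p⟩⟩, fun f hf => ?_⟩
  refine Subtype.ext (ContMDiffMap.ext fun p => ?_)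
  have h1 : ι (R f (Q.proj p)) = f.1 p := by
    rw [congrFun (hR f hf) p, (hρι _ (hker f hf p)).2]
  exact h1

theorem range_gaugeIncl : (gaugeIncl Q h).range = (gaugeProj Q h).ker := by
  obtain ⟨R, -, hR⟩ := exists_kernel_inverse Q h
  ext f
  constructor
  · rintro ⟨z, rfl⟩
    refine Subtype.ext (ContMDiffMap.ext fun p => ?_)
    have h1 : ι (z (Q.proj p)) ∈ q.ker := h.exact ▸ ⟨_, rfl⟩
    exact h1
  · exact fun hf => ⟨R f, hR f hf⟩

/-- Smooth local sections, given by superposition. -/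
theorem exists_superposition_section [CompleteSpace EKhat] [CompleteSpace EK]
    (f₀ : gaugeGroup EKhat Q q) :
    ∃ (U : Set (gaugeGroup EK Q (MonoidHom.id K)))
      (s : gaugeGroup EK Q (MonoidHom.id K) → gaugeGroup EKhat Q q)
      (r : gaugeGroup EKhat Q q → C^∞⟮𝓘(ℝ, EM), M; 𝓘(ℝ, EZ), Z⟯),
      IsOpen U ∧ gaugeProj Q h f₀ ∈ U ∧ s (gaugeProj Q h f₀) = f₀ ∧
      IsSuperposition (EP := EP) (bundle EK K) (bundle EKhat Khat)
        (fun (f : gaugeGroup EK Q (MonoidHom.id K)) p => f.1 p)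
        (fun (f : gaugeGroup EKhat Q q) p => f.1 p) s U ∧
      (∀ g ∈ U, gaugeProj Q h (s g) = g) ∧
      IsSuperposition (EP := EP) (bundle EKhat Khat) (bundle EZ Z)
        (fun (f : gaugeGroup EKhat Q q) p => f.1 p)
        (fun (z : C^∞⟮𝓘(ℝ, EM), M; 𝓘(ℝ, EZ), Z⟯) p => z (Q.proj p)) r (gaugeProj Q h ⁻¹' U) ∧
      ∀ f ∈ gaugeProj Q h ⁻¹' U, f = s (gaugeProj Q h f) * gaugeIncl Q h (r f) := by
  haveI : T2Space P := Q.t2Space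
  have hq := h.isCentralQuotient
  have hi := isCentralQuotient_id (EK := EK) (K := K)
  have hG := isEquivariantMapSpace_gaugeGroup Q hq
  have hV := isEquivariantMapSpace_gaugeAlgebra Q hq
  have hGK := isEquivariantMapSpace_gaugeGroup Q hi
  have hVK := isEquivariantMapSpace_gaugeAlgebra Q hi
  haveI := hGK.isTopologicalGroup fun _ _ _ => rfl
  obtain ⟨T, hT, hT0, hTq, hTe⟩ := exists_equivariant_splitting Q h
  obtain ⟨R, hRs, hR⟩ := exists_kernel_inverse Q h
  obtain ⟨e, he, h0, hexp⟩ := exists_expChart hi.isSmoothAction hGK hVK 0 fun p => rfl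
  -- `E ξ = f₀ exp(T ξ)`
  have hE : ∀ ξ : gaugeAlgebra EK Q (MonoidHom.id K), ∃ f : gaugeGroup EKhat Q q,
      (fun p => f.1 p) = fun p => f₀.1 p * lieExp Khat (T (p, ξ.1 p)) := by
    intro ξ
    have hid : ContMDiff 𝓘(ℝ, EP) 𝓘(ℝ, EP) ∞ (id : P → P) := contMDiff_id
    refine hG.exists_eq _ (f₀.1.contMDiff.mul (contMDiff_lieExp.comp
      (hT.comp (hid.prodMk ξ.1.contMDiff)))) fun p k => ?_
    have e1 := hG.equivariant f₀ p k
    have e2 := hVK.equivariant ξ p k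
    simp only at e1 e2
    rw [e1, e2, hTe, hq.isSmoothAction.lieExp_deriv, hq.isSmoothAction.map_mul]
  choose E hE using hE
  have hEs : IsSuperposition (EP := EP) (bundle EK EK) (bundle EKhat Khat)
      (fun (ξ : gaugeAlgebra EK Q (MonoidHom.id K)) p => ξ.1 p)
      (fun (f : gaugeGroup EKhat Q q) p => f.1 p) E univ :=
    ⟨univ, fun x => f₀.1 x.1 * lieExp Khat (T x), isOpen_univ,
      ((f₀.1.contMDiff.comp contMDiff_fst).mul (contMDiff_lieExp.comp hT)).contMDiffOn,
      fun ξ _ p => ⟨trivial, congrFun (hE ξ) p⟩⟩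
  set g₀ := gaugeProj Q h f₀ with hg₀
  -- The translate by `g₀` of the exponential chart domain, where the logarithm of `g₀⁻¹ g` is
  -- available; `s` then applies `E` to it.
  let U : Set (gaugeGroup EK Q (MonoidHom.id K)) := (fun g => g₀⁻¹ * g) ⁻¹' e.source
  let s : gaugeGroup EK Q (MonoidHom.id K) → gaugeGroup EKhat Q q := fun g => E (e (g₀⁻¹ * g))
  have he1 : e.symm 0 = 1 := hGK.injective (funext fun p => by
    rw [hexp 0 h0]
    exact lieExp_zero)
  have hs : IsSuperposition (EP := EP) (bundle EK K) (bundle EKhat Khat)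
      (fun (f : gaugeGroup EK Q (MonoidHom.id K)) p => f.1 p)
      (fun (f : gaugeGroup EKhat Q q) p => f.1 p) s U :=
    hEs.comp (he.1.comp ((isSuperposition_mul_left (fun _ _ _ => rfl) hGK.toRealizes g₀⁻¹).mono
      (subset_univ U)) fun g hg => hg) (mapsTo_univ _ _)
  have hsec : ∀ g ∈ U, gaugeProj Q h (s g) = g := by
    intro g hg
    refine Subtype.ext (ContMDiffMap.ext fun p => ?_)
    have h1 : (s g).1 p = f₀.1 p * lieExp Khat (T (p, (e (g₀⁻¹ * g)).1 p)) := congrFun (hE _) p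
    have h2 := hexp _ (e.map_source hg) p
    rw [e.left_inv hg] at h2
    have h3 : (g₀⁻¹ * g).1 p = (q (f₀.1 p))⁻¹ * g.1 p := rfl
    have h4 : q ((s g).1 p) = g.1 p := by
      -- By naturality `q` turns `exp ∘ T` into `exp` of the derivative of `q` applied to `T`, and
      -- the two linear maps cancel; what remains is `g₀ (g₀⁻¹ g)`.
      have h5 : ∀ w : EKhat, q (lieExp Khat w) = lieExp K (projDeriv EKhat EK q w) :=
        map_lieExp h.smooth_proj (map_mul q)
      rw [h1, map_mul, h5, hTq, ← h2]
      exact (congrArg (q (f₀.1 p) * ·) h3).trans (mul_inv_cancel_left _ _)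
    exact h4
  have hker : ∀ f ∈ gaugeProj Q h ⁻¹' U, gaugeProj Q h ((s (gaugeProj Q h f))⁻¹ * f) = 1 := by
    intro f hf
    rw [map_mul, map_inv, hsec _ hf, inv_mul_cancel]
  refine ⟨U, s, fun f => R ((s (gaugeProj Q h f))⁻¹ * f), e.open_source.preimage (by fun_prop),
    ?_, ?_, hs, hsec, ?_, fun f hf => ?_⟩
  · change g₀⁻¹ * g₀ ∈ e.source
    rw [inv_mul_cancel, ← he1]
    exact e.map_target h0
  · refine hG.injective ((hE _).trans (funext fun p => ?_))
    have h1 : e (g₀⁻¹ * g₀) = 0 := by rw [inv_mul_cancel, ← he1, e.right_inv h0]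
    rw [h1]
    have h2 : (0 : gaugeAlgebra EK Q (MonoidHom.id K)).1 p = 0 := rfl
    rw [h2, hT0, lieExp_zero, mul_one]
  · obtain ⟨Ω, φ, hΩ, hφ, hφs⟩ := hs.comp ((isSuperposition_gaugeProj Q h).mono
      (subset_univ (gaugeProj Q h ⁻¹' U))) fun f hf => hf
    have h1 : IsSuperposition (EP := EP) (bundle EKhat Khat) (bundle EKhat Khat)
        (fun (f : gaugeGroup EKhat Q q) p => f.1 p) (fun (f : gaugeGroup EKhat Q q) p => f.1 p)
        (fun f => (s (gaugeProj Q h f))⁻¹ * f) (gaugeProj Q h ⁻¹' U) := by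
      refine ⟨Ω, fun x => (φ x)⁻¹ * x.2, hΩ, hφ.inv.mul contMDiffOn_snd,
        fun f hf p => ⟨(hφs f hf p).1, ?_⟩⟩
      exact congrArg (fun y => y⁻¹ * f.1 p) (hφs f hf p).2
    exact hRs.comp h1 hker
  · rw [hR _ (hker f hf), mul_inv_cancel_left]

end GaugeExtension

end

end

/-! ### The central extension of gauge groups. -/

theorem proposition2p5
    {EM M : Type u₁} {EP P : Type u₂} {EK K : Type u₃} {EKhat Khat : Type u₄} {EZ Z : Type u₅}
    -- `M` is a compact manifold
    [NormedAddCommGroup EM] [NormedSpace ℝ EM] [FiniteDimensional ℝ EM]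
    [TopologicalSpace M] [ChartedSpace EM M] [IsManifold 𝓘(ℝ, EM) ∞ M]
    [CompactSpace M] [T2Space M]
    -- `P` is a manifold; `K`, `Khat`, `Z` are Banach–Lie groups
    [NormedAddCommGroup EP] [NormedSpace ℝ EP]
    [TopologicalSpace P] [ChartedSpace EP P] [IsManifold 𝓘(ℝ, EP) ∞ P]
    [NormedAddCommGroup EK] [NormedSpace ℝ EK] [CompleteSpace EK]
    [TopologicalSpace K] [ChartedSpace EK K] [Group K] [LieGroup 𝓘(ℝ, EK) ∞ K]
    [NormedAddCommGroup EKhat] [NormedSpace ℝ EKhat] [CompleteSpace EKhat]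
    [TopologicalSpace Khat] [ChartedSpace EKhat Khat] [Group Khat] [LieGroup 𝓘(ℝ, EKhat) ∞ Khat]
    [NormedAddCommGroup EZ] [NormedSpace ℝ EZ] [CompleteSpace EZ]
    [TopologicalSpace Z] [ChartedSpace EZ Z] [Group Z] [LieGroup 𝓘(ℝ, EZ) ∞ Z]
    -- `P → M` is a smooth principal `K`-bundle, `Z → Khat → K` a central extension
    (Q : PrincipalBundle EM M EP P EK K) (ι : Z →* Khat) (q : Khat →* K)
    (h : IsCentralExtension (EZ := EZ) (EKhat := EKhat) (EK := EK) ι q) :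
    -- the three modelling spaces are Fréchet spaces
    IsFrechetSpace C^∞⟮𝓘(ℝ, EM), M; 𝓘(ℝ, EZ), EZ⟯ ∧
    IsFrechetSpace (gaugeAlgebra EKhat Q q) ∧
    IsFrechetSpace (gaugeAlgebra EK Q (MonoidHom.id K)) ∧
    -- the three groups are Lie groups, with charts given by the exponential functions
    (∃ (AZ : LCLieGroup C^∞⟮𝓘(ℝ, EM), M; 𝓘(ℝ, EZ), EZ⟯ C^∞⟮𝓘(ℝ, EM), M; 𝓘(ℝ, EZ), Z⟯)
      (AKhat : LCLieGroup (gaugeAlgebra EKhat Q q) (gaugeGroup EKhat Q q))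
      (AK : LCLieGroup (gaugeAlgebra EK Q (MonoidHom.id K)) (gaugeGroup EK Q (MonoidHom.id K))),
      HasExpChart AZ (fun f x => f x) (fun ξ x => ξ x) ∧
      HasExpChart AKhat (fun f p => f.1 p) (fun ξ p => ξ.1 p) ∧
      HasExpChart AK (fun f p => f.1 p) (fun ξ p => ξ.1 p) ∧
      -- the sequence is an exact sequence of Lie groups with central kernel
      ChartSmoothOn AZ.atlas AKhat.atlas (gaugeIncl Q h) univ ∧
      ChartSmoothOn AKhat.atlas AK.atlas (gaugeProj Q h) univ ∧
      Function.Injective (gaugeIncl Q h) ∧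
      (gaugeIncl Q h).range = (gaugeProj Q h).ker ∧
      (∀ z f, gaugeIncl Q h z * f = f * gaugeIncl Q h z) ∧
      -- smooth local sections through each point `f₀`, and the local trivializations they induce
      ∀ f₀ : gaugeGroup EKhat Q q, ∃ (U : Set (gaugeGroup EK Q (MonoidHom.id K)))
        (s : gaugeGroup EK Q (MonoidHom.id K) → gaugeGroup EKhat Q q)
        (r : gaugeGroup EKhat Q q → C^∞⟮𝓘(ℝ, EM), M; 𝓘(ℝ, EZ), Z⟯),
        IsOpen U ∧ gaugeProj Q h f₀ ∈ U ∧ s (gaugeProj Q h f₀) = f₀ ∧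
        ChartSmoothOn AK.atlas AKhat.atlas s U ∧ (∀ g ∈ U, gaugeProj Q h (s g) = g) ∧
        ChartSmoothOn AKhat.atlas AZ.atlas r (gaugeProj Q h ⁻¹' U) ∧
        ∀ f ∈ gaugeProj Q h ⁻¹' U, f = s (gaugeProj Q h f) * gaugeIncl Q h (r f)) ∧
    -- metrizability
    (TopologicalSpace.MetrizableSpace Z → TopologicalSpace.MetrizableSpace K →
      TopologicalSpace.MetrizableSpace (gaugeGroup EKhat Q q)) := by
  haveI : T2Space P := Q.t2Space
  have hq := h.isCentralQuotient
  have hi := isCentralQuotient_id (EK := EK) (K := K)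
  have hG := isEquivariantMapSpace_gaugeGroup Q hq
  have hV := isEquivariantMapSpace_gaugeAlgebra Q hq
  have hl := isPointwiseLinear_gaugeAlgebra (F := EKhat) Q q
  have hGK := isEquivariantMapSpace_gaugeGroup Q hi
  have hVK := isEquivariantMapSpace_gaugeAlgebra Q hi
  have hlK := isPointwiseLinear_gaugeAlgebra (F := EK) Q (MonoidHom.id K)
  have hGZ := isEquivariantMapSpace_comp_proj (F := EZ) (N := Z) Q
  have hVZ := isEquivariantMapSpace_comp_proj_deriv (F := EZ) (L := Z) Q
  have hlZ := isPointwiseLinear_comp_proj (F := EZ) Q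
  -- Maps on `M` enter the general theory as equivariant maps on `P` for the trivial action.
  have htr := isSmoothAction_trivial (EK := EK) (K := K) (F := EZ) (L := Z)
  have FZ := hVZ.isFrechetSpace htr.contMDiff_deriv_apply hlZ
  have FKhat := hV.isFrechetSpace hq.isSmoothAction.contMDiff_deriv_apply hl
  have FK := hVK.isFrechetSpace hi.isSmoothAction.contMDiff_deriv_apply hlK
  refine ⟨FZ, FKhat, FK, ?_, fun _ _ => ?_⟩
  · obtain ⟨AZ, hAZ, eZ⟩ := exists_lcLieGroup htr hGZ hVZ (fun _ _ _ => rfl) hlZ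
    obtain ⟨AKhat, hAKhat, eKhat⟩ := exists_lcLieGroup hq.isSmoothAction hG hV (fun _ _ _ => rfl) hl
    obtain ⟨AK, hAK, eK⟩ := exists_lcLieGroup hi.isSmoothAction hGK hVK (fun _ _ _ => rfl) hlK
    haveI := FZ.addGroup
    haveI := FZ.continuousSMul
    haveI := FKhat.addGroup
    haveI := FKhat.continuousSMul
    haveI := FK.addGroup
    haveI := FK.continuousSMul
    have hpK := (isSuperposition_gaugeProj Q h).continuousOn hG.toRealizes hGK.toRealizesInducing
    refine ⟨AZ, AKhat, AK, ?_, eKhat, eK, ?_, ?_, gaugeIncl_injective Q h, range_gaugeIncl Q h,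
      gaugeIncl_central Q h, fun f₀ => ?_⟩
    -- The chart formula is known for the lifted maps on `P`; surjectivity of the projection gives
    -- it on `M`.
    · obtain ⟨e, he, h0, hexp⟩ := eZ
      refine ⟨e, he, h0, fun ξ hξ x => ?_⟩
      obtain ⟨p, rfl⟩ := Q.surjective_proj x
      exact hexp ξ hξ p
    · exact (isSuperposition_gaugeIncl Q h).chartSmoothOn (fun a ha => (hAZ ▸ ha).2)
        (fun b hb => (hAKhat ▸ hb).1) isOpen_univ hGZ.toRealizes hG.toRealizesInducing
        hVZ.toRealizes hlZ hV.toRealizesInducing hl hV.injective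
        fun g hg => hV.exists_lev_eq_of_tendsto g hg
    · exact (isSuperposition_gaugeProj Q h).chartSmoothOn (fun a ha => (hAKhat ▸ ha).2)
        (fun b hb => (hAK ▸ hb).1) isOpen_univ hG.toRealizes hGK.toRealizesInducing
        hV.toRealizes hl hVK.toRealizesInducing hlK hVK.injective
        fun g hg => hVK.exists_lev_eq_of_tendsto g hg
    · obtain ⟨U, s, r, hU, hfU, hsf, hs, hsec, hr, heq⟩ := exists_superposition_section Q h f₀
      refine ⟨U, s, r, hU, hfU, hsf, ?_, hsec, ?_, heq⟩
      · exact hs.chartSmoothOn (fun a ha => (hAK ▸ ha).2)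
          (fun b hb => (hAKhat ▸ hb).1) hU hGK.toRealizes hG.toRealizesInducing
          hVK.toRealizes hlK hV.toRealizesInducing hl hV.injective
          fun g hg => hV.exists_lev_eq_of_tendsto g hg
      · exact hr.chartSmoothOn (fun a ha => (hAKhat ▸ ha).2)
          (fun b hb => (hAZ ▸ hb).1) (hU.preimage (continuousOn_univ.1 hpK)) hG.toRealizes
          hGZ.toRealizesInducing hV.toRealizes hl hVZ.toRealizesInducing hlZ hVZ.injective
          fun g hg => hVZ.exists_lev_eq_of_tendsto g hg
  · haveI : T2Space Khat := t2Space_of_lieGroup EKhat Khat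
    haveI : T2Space (gaugeGroup EKhat Q q) := hG.t2Space (Y := bundle EKhat Khat)
    haveI := hG.isTopologicalGroup fun _ _ _ => rfl
    haveI := FKhat.metrizable
    obtain ⟨A, -, e, he, h0, hexp⟩ := exists_lcLieGroup hq.isSmoothAction hG hV (fun _ _ _ => rfl) hl
    have h1 : e.symm 0 = 1 := hG.injective (funext fun p => by
      refine (hexp 0 h0 p).trans ?_
      exact lieExp_zero (F := EKhat) (L := Khat))
    -- The exponential chart at `1` takes values in a metrizable Fréchet space, which provides a
    -- countable neighbourhood basis of `1`.
    haveI : (𝓝 (1 : gaugeGroup EKhat Q q)).IsCountablyGenerated :=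
      e.isCountablyGenerated_nhds (h1 ▸ e.map_target h0)
    exact IsTopologicalGroup.metrizableSpace_of_isCountablyGenerated
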